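/- Let $(M,\Pi)$ be a smooth Poisson manifold of dimension $n$ and (maximal) rank $2r$, with a smooth action of a compact Lie group $G$ that preserves $\Pi$. Let $f_1,\dots,f_{n-r}$ be a regular integrable system on $M$, i.e. smooth functions whose differentials are linearly independent at every point and with $\{f_i,f_j\}=0$ for all $i,j$. Let $\mathcal F$ be the foliation of $M$ that they define, whose tangent space at $x$ is $\bigcap_i \ker d_xf_i$, and suppose that the $G$-action preserves $\mathcal F$. Let $\mathcal S$ be a symplectic leaf of $\Pi$, of dimension $2\ell$ (possibly smaller than $2r$), all of whose points are fixed by $G$, let $m\in\mathcal S$, and put $s=n-2\ell$. Suppose that the integrable system is split at $m$: some neighbourhood of $m$ is isomorphic, by a diffeomorphism that preserves both the Poisson structure and the foliation, to the direct product of a piece of $\mathcal S$ through $m$, carrying an integrable system (with $\ell$ functions), and an open ball of dimension $s$ carrying a Poisson structure and an integrable system (with $n-r-\ell$ independent functions in involution). Then there exist a $G$-invariant open neighbourhood $U$ of $m$ and functions $p_1,\dots,p_\ell,q_1,\dots,q_\ell,z_1,\dots,z_s$ on $U$ such that 1. $(p_1,q_1,\dots,p_\ell,q_\ell,z_1,\dots,z_s)$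 is a system of local coordinates on $U$, centered at $m$; 2. in these coordinates $$\Pi=\sum_{i=1}^{\ell}\frac{\partial}{\partial q_i}\wedge\frac{\partial}{\partial p_i}+\sum_{i,j=1}^{s} g_{ij}(z)\,\frac{\partial}{\partial z_i}\wedge\frac{\partial}{\partial z_j},$$ where the $g_{ij}$ are smooth functions that depend only on $z=(z_1,\dots,z_s)$; 3. there is a group homomorphism $A:G\to GL_s(\mathbb R)$ such that every $g\in G$ acts on $U$, in these coordinates, by $(p,q,z)\mapsto(p,q,A(g)z)$; 4. the functions $p_1,\dots,p_\ell,z_1,\dots,z_{n-r-\ell}$ generate the integrable system on $U$, i.e. they define the foliation $\mathcal F|_U$. -/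

import Mathlib

open scoped Manifold ContDiff

noncomputable section

namespace PoissonGeom

/-- A smooth Poisson structure on an `n`-dimensional manifold `M`, given by its Poisson tensor
`Π♯ : T*M → TM`; the bracket is `{f, h} = Π(df, dh) = dh (Π♯ df)`. -/
structure PoissonStructure (n : ℕ) (M : Type*) [TopologicalSpace M]
    [ChartedSpace (EuclideanSpace ℝ (Fin n)) M] where
  /-- the map `Π♯` at the point `x` -/
  sharp : ∀ x : M, (TangentSpace (𝓡 n) x →L[ℝ] ℝ) →ₗ[ℝ] TangentSpace (𝓡 n) x
  skew : ∀ (x : M) (α β : TangentSpace (𝓡 n) x →L[ℝ] ℝ),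
    β (sharp x α) = - α (sharp x β)
  smooth : ∀ (V : Set M) (f h : M → ℝ), IsOpen V →
    ContMDiffOn (𝓡 n) 𝓘(ℝ, ℝ) ∞ f V → ContMDiffOn (𝓡 n) 𝓘(ℝ, ℝ) ∞ h V →
    ContMDiffOn (𝓡 n) 𝓘(ℝ, ℝ) ∞
      (fun x => mvfderiv (𝓡 n) h x (sharp x (mvfderiv (𝓡 n) f x))) V
  jacobi : ∀ (V : Set M) (f h k : M → ℝ), IsOpen V →
    ContMDiffOn (𝓡 n) 𝓘(ℝ, ℝ) ∞ f V → ContMDiffOn (𝓡 n) 𝓘(ℝ, ℝ) ∞ h V →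
    ContMDiffOn (𝓡 n) 𝓘(ℝ, ℝ) ∞ k V →
    let br : (M → ℝ) → (M → ℝ) → M → ℝ :=
      fun a b x => mvfderiv (𝓡 n) b x (sharp x (mvfderiv (𝓡 n) a x))
    ∀ x ∈ V, br f (br h k) x + br h (br k f) x + br k (br f h) x = 0

section Poisson

variable {n : ℕ} {M : Type*} [TopologicalSpace M] [ChartedSpace (EuclideanSpace ℝ (Fin n)) M]

/-- The Poisson bivector `Π_x(α, β)`. -/
def PoissonStructure.bivector (P : PoissonStructure n M) (x : M)
    (α β : TangentSpace (𝓡 n) x →L[ℝ] ℝ) : ℝ :=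
  β (P.sharp x α)

/-- The Poisson bracket `{f, h}`. -/
def PoissonStructure.bracket (P : PoissonStructure n M) (f h : M → ℝ) (x : M) : ℝ :=
  P.bivector x (mvfderiv (𝓡 n) f x) (mvfderiv (𝓡 n) h x)

/-- The Hamiltonian vector field of `f`. -/
def PoissonStructure.hamiltonian (P : PoissonStructure n M) (f : M → ℝ) (x : M) :
    TangentSpace (𝓡 n) x :=
  P.sharp x (mvfderiv (𝓡 n) f x)

/-- The rank of the Poisson structure at `x`. -/
def PoissonStructure.rankAt (P : PoissonStructure n M) (x : M) : ℕ :=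
  Module.finrank ℝ (LinearMap.range (P.sharp x))

/-- The rank of a Poisson manifold is the maximal rank of its Poisson tensor. -/
def PoissonStructure.HasRank (P : PoissonStructure n M) (k : ℕ) : Prop :=
  IsGreatest (Set.range P.rankAt) k

/-- `x` is joined to `y` by an integral curve, parametrised by `[0, 1]`, of the Hamiltonian vector
field of a smooth function defined on an open set that contains the curve. -/
def PoissonStructure.HamiltonianStep (P : PoissonStructure n M) (x y : M) : Prop :=
  ∃ (V : Set M) (H : M → ℝ) (γ : ℝ → M), IsOpen V ∧
    ContMDiffOn (𝓡 n) 𝓘(ℝ, ℝ) ∞ H V ∧ (∀ t ∈ Set.Icc (0 : ℝ) 1, γ t ∈ V) ∧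
    IsMIntegralCurveOn (I := 𝓡 n) γ (P.hamiltonian H) (Set.Icc 0 1) ∧ γ 0 = x ∧ γ 1 = y

/-- The symplectic leaf through `m`: the points that can be reached from `m` along finitely many
integral curves of Hamiltonian vector fields. -/
def PoissonStructure.symplecticLeaf (P : PoissonStructure n M) (m : M) : Set M :=
  {x | Relation.ReflTransGen P.HamiltonianStep m x}

/-- `φ` preserves the Poisson structure. -/
def PoissonStructure.IsPoissonMap (P : PoissonStructure n M) (φ : M → M) : Prop :=
  ∀ (x : M) (α β : TangentSpace (𝓡 n) (φ x) →L[ℝ] ℝ),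
    P.bivector (φ x) α β =
      P.bivector x (α.comp (mfderiv (𝓡 n) (𝓡 n) φ x)) (β.comp (mfderiv (𝓡 n) (𝓡 n) φ x))

/-- Smooth functions that are independent at every point (so that they define a regular foliation)
and pairwise in involution. -/
structure PoissonStructure.IsInvolutiveFamily (P : PoissonStructure n M) {ι : Type*}
    (f : ι → M → ℝ) : Prop where
  smooth : ∀ i, ContMDiff (𝓡 n) 𝓘(ℝ, ℝ) ∞ (f i)
  independent : ∀ x, LinearIndependent ℝ fun i => mvfderiv (𝓡 n) (f i) x
  involution : ∀ i j x, P.bracket (f i) (f j) x = 0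

/-- A (Liouville) integrable system on a Poisson manifold of dimension `n` and rank `2 * r`:
an involutive family of `n - r` functions. -/
structure PoissonStructure.IsIntegrableSystem (P : PoissonStructure n M) (r : ℕ)
    (f : Fin (n - r) → M → ℝ) : Prop extends P.IsInvolutiveFamily f where
  hasRank : P.HasRank (2 * r)

variable (n) in
/-- The tangent space at `x` to the common level sets of the functions `f i`. For functions
independent at every point these spaces form the tangent distribution of the foliation that the
functions define, whose leaves are the connected components of the common level sets. -/
def tangentFoliation {ι : Type*} (f : ι → M → ℝ) (x : M) : Submodule ℝ (TangentSpace (𝓡 n) x) :=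
  ⨅ i, LinearMap.ker (mvfderiv (𝓡 n) (f i) x : TangentSpace (𝓡 n) x →ₗ[ℝ] ℝ)

variable (n) in
/-- The diffeomorphism `φ` preserves the foliation defined by the functions `f i`: its differential
maps the tangent distribution onto itself. -/
def PreservesFoliation {ι : Type*} (f : ι → M → ℝ) (φ : M → M) : Prop :=
  ∀ x, (tangentFoliation n f x).map
    (mfderiv (𝓡 n) (𝓡 n) φ x : TangentSpace (𝓡 n) x →ₗ[ℝ] TangentSpace (𝓡 n) (φ x)) =
      tangentFoliation n f (φ x)

variable (n) in
/-- On the open set `U` the functions `h j` generate the foliation given by the functions `f i`: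
they are smooth and independent on `U` and define there the same foliation. -/
structure GeneratesFoliationOn {ι κ : Type*} (f : ι → M → ℝ) (h : κ → M → ℝ) (U : Set M) :
    Prop where
  smooth : ∀ j, ContMDiffOn (𝓡 n) 𝓘(ℝ, ℝ) ∞ (h j) U
  independent : ∀ x ∈ U, LinearIndependent ℝ fun j => mvfderiv (𝓡 n) (h j) x
  eq : ∀ x ∈ U, tangentFoliation n h x = tangentFoliation n f x

variable (n) in
/-- `e` is a diffeomorphism from the open set `e.source` of `M` onto the open set `e.target` of the
normed space `W`. -/
structure IsSmoothChart {W : Type*} [NormedAddCommGroup W] [NormedSpace ℝ W]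
    (e : OpenPartialHomeomorph M W) : Prop where
  smooth : ContMDiffOn (𝓡 n) 𝓘(ℝ, W) ∞ e e.source
  smooth_symm : ContMDiffOn 𝓘(ℝ, W) (𝓡 n) ∞ e.symm e.target

/-- The integrable system `f` (of rank `2 * r`, on a Poisson manifold of dimension `n`) is split at
the point `m` of a symplectic leaf of dimension `2 * l`: some neighbourhood `U = e.source` of `m`
is isomorphic, as a Poisson manifold with a foliation, to the direct product of
* a symplectic manifold with an integrable system `φ 0, ..., φ (l - 1)`, whose slice through `m` is
  the piece of the leaf in `U`, and
* a Poisson manifold of dimension `s = n - 2 * l` with an integrable system, that is, with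
  `n - r - l = s - (r - l)` independent functions in involution (whence its rank is at most
  `2 * (r - l)`; equality may fail in a region where the rank of `M` is not maximal).

The neighbourhood is taken so small that its piece of leaf is diffeomorphic to `ℝ ^ (2 * l)`; the
second factor is an open ball, which is diffeomorphic to `ℝ ^ s`. -/
def PoissonStructure.IsSplitAt (P : PoissonStructure n M) (r l s : ℕ)
    (f : Fin (n - r) → M → ℝ) (m : M) : Prop :=
  ∃ (P₁ : PoissonStructure (2 * l) (EuclideanSpace ℝ (Fin (2 * l))))
    (φ : Fin l → EuclideanSpace ℝ (Fin (2 * l)) → ℝ)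
    (P₂ : PoissonStructure s (EuclideanSpace ℝ (Fin s)))
    (ψ : Fin (n - r - l) → EuclideanSpace ℝ (Fin s) → ℝ)
    (e : OpenPartialHomeomorph M (EuclideanSpace ℝ (Fin (2 * l)) × EuclideanSpace ℝ (Fin s))),
    -- the first factor is symplectic with an integrable system
    (∀ a, P₁.rankAt a = 2 * l) ∧ P₁.IsInvolutiveFamily φ ∧
    -- the second factor
    P₂.IsInvolutiveFamily ψ ∧
    -- a diffeomorphism from a neighbourhood of `m` onto the product
    IsSmoothChart n e ∧ m ∈ e.source ∧ e.target = Set.univ ∧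
    -- the first factor corresponds to the leaf through `m`
    (∀ x ∈ e.source, (e x).2 = (e m).2 → x ∈ P.symplecticLeaf m) ∧
    -- it maps the Poisson structure to the product Poisson structure
    (∀ x ∈ e.source,
      ∀ θ η : (EuclideanSpace ℝ (Fin (2 * l)) × EuclideanSpace ℝ (Fin s)) →L[ℝ] ℝ,
      P.bivector x (θ.comp (mvfderiv (𝓡 n) e x)) (η.comp (mvfderiv (𝓡 n) e x)) =
        P₁.bivector (e x).1 (θ.comp (ContinuousLinearMap.inl ℝ _ _))
          (η.comp (ContinuousLinearMap.inl ℝ _ _)) +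
        P₂.bivector (e x).2 (θ.comp (ContinuousLinearMap.inr ℝ _ _))
          (η.comp (ContinuousLinearMap.inr ℝ _ _))) ∧
    -- it maps the foliation to the product foliation
    (∀ x ∈ e.source, ∀ v : TangentSpace (𝓡 n) x,
      v ∈ tangentFoliation n f x ↔
        (mvfderiv (𝓡 n) e x v).1 ∈ tangentFoliation (2 * l) φ (e x).1 ∧
        (mvfderiv (𝓡 n) e x v).2 ∈ tangentFoliation s ψ (e x).2)

end Poisson

/-- The space of coordinates `(p, q, z)`. -/
abbrev CJLSpace (l s : ℕ) : Type := (Fin l → ℝ) × (Fin l → ℝ) × (Fin s → ℝ)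

/-- The coordinate vector `∂/∂pᵢ`. -/
def dP {l : ℕ} (s : ℕ) (i : Fin l) : CJLSpace l s := (Pi.single i 1, 0, 0)

/-- The coordinate vector `∂/∂qᵢ`. -/
def dQ {l : ℕ} (s : ℕ) (i : Fin l) : CJLSpace l s := (0, Pi.single i 1, 0)

/-- The coordinate vector `∂/∂zᵢ`. -/
def dZ (l : ℕ) {s : ℕ} (i : Fin s) : CJLSpace l s := (0, 0, Pi.single i 1)

/-- The bivector `v ∧ w` evaluated on two covectors. -/
def wedge {W : Type*} [NormedAddCommGroup W] [NormedSpace ℝ W] (v w : W) (θ η : W →L[ℝ] ℝ) : ℝ :=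
  θ v * η w - θ w * η v

end PoissonGeom

end

/-! The split chart reduces the statement to a neighbourhood in a product of a symplectic space,
which carries the functions `φ`, and a Poisson space, which carries `ψ`. A function is basic if it
is constant along the leaves of the foliation. Basic functions are locally functions of the
integrable system (`IsBasic.exists_factor`), so they commute. By the Carathéodory-Jacobi-Lie theorem
on the symplectic factor (`exists_conjugate_functions`), the `φ i` have canonically conjugate
functions `q i`. Since `q i` does not involve the second factor, its brackets with all `φ j` and `ψ
j` are constant, so its flow preserves the foliation. This is the purpose of splitness, and it
yields an `IsCanonicalFamily`.

The conjugate pairs are made invariant one at a time (`exists_invariant_insert`). The average `P` of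
`p k` is again basic because the group preserves the foliation. The leaf consists of fixed points,
so averaging does not change brackets at `m`, and `c = {q k, P}` equals 1 there. As `c` is basic, `q
k / c` still preserves the foliation, and its bracket with `P` is constantly 1. A constant bracket
with an invariant function survives averaging, so the average `Q` of `q k / c` is conjugate to `P`.
The other functions are adjusted so as to commute with `P` (`exists_adjusted`) and then composed
with the retraction onto the level of `P` along the Hamiltonian field of `Q`. This makes them
commute with `Q`, keeps the brackets of functions that commute with `P`, and respects the foliation,
because the retraction descends to the local leaf space (`exists_leaf_retraction`).

For the transverse coordinates, covectors at `m` that annihilate the Hamiltonian fields of the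
family are realised as differentials of functions commuting with the family; those that annihilate
the leaves as well are realised by basic functions (`exists_isTransverse`). Averaging with the
isotropy representation as weight, as in Bochner's theorem, makes the action linear in `z` and keeps
these properties (`exists_linear_isTransverse`). By the Jacobi identity the brackets of the `z j`
commute with all `p i` and `q i`, hence depend on `z` only. A count of dimensions identifies the
foliation.

The analytic tools are smooth local flows, from the inverse function theorem on a Banach space of
curves, and differentiation under the integral over the compact group. -/

noncomputable section

open scoped Manifold ContDiff Topology
open Filter Set

namespace PoissonGeom

/-! ### Postcomposition with a smooth map is smooth on spaces of continuous curves. -/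

section Postcomp

universe u

/-- Pointwise application of a continuous family of continuous linear maps. -/
def pointwiseApply (I : Type*) [TopologicalSpace I] [CompactSpace I] (E F : Type u)
    [NormedAddCommGroup E] [NormedSpace ℝ E] [NormedAddCommGroup F] [NormedSpace ℝ F] :
    C(I, E →L[ℝ] F) →L[ℝ] C(I, E) →L[ℝ] C(I, F) :=
  LinearMap.mkContinuous₂
    (LinearMap.mk₂ ℝ
      (fun (A : C(I, E →L[ℝ] F)) (h : C(I, E)) =>
        (⟨fun t => A t (h t), A.continuous.clm_apply h.continuous⟩ : C(I, F)))
      (fun A B h => by ext t; simp) (fun c A h => by ext t; simp)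
      (fun A h k => by ext t; simp) (fun c A h => by ext t; simp)) 1
    (fun A h => by
      rw [one_mul, ContinuousMap.norm_le _ (by positivity)]
      intro t
      exact ((A t).le_opNorm _).trans (mul_le_mul (A.norm_coe_le_norm t) (h.norm_coe_le_norm t)
        (norm_nonneg _) (norm_nonneg A)))

theorem pointwiseApply_apply {I : Type*} [TopologicalSpace I] [CompactSpace I] {E F : Type u}
    [NormedAddCommGroup E] [NormedSpace ℝ E] [NormedAddCommGroup F] [NormedSpace ℝ F]
    (A : C(I, E →L[ℝ] F)) (h : C(I, E)) (t : I) : pointwiseApply I E F A h t = A t (h t) := rfl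

/-- Since `δ ↦ X' ∘ δ` is continuous for the uniform norm, one radius controls the variation of `X'`
near `γ t` for all `t` at once. The mean value inequality then gives a remainder estimate that is
uniform in `t`. -/
theorem hasFDerivAt_postcomp {I : Type*} [TopologicalSpace I] [CompactSpace I] {E F : Type u}
    [NormedAddCommGroup E] [NormedSpace ℝ E] [NormedAddCommGroup F] [NormedSpace ℝ F]
    (X : C(E, F)) (X' : C(E, E →L[ℝ] F)) (h : ∀ x, HasFDerivAt X (X' x) x) (γ : C(I, E)) :
    HasFDerivAt (fun γ : C(I, E) => X.comp γ) (pointwiseApply I E F (X'.comp γ)) γ := by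
  rw [hasFDerivAt_iff_isLittleO_nhds_zero, Asymptotics.isLittleO_iff]
  intro c hc
  have hcont : Continuous fun δ : C(I, E) => X'.comp δ := ContinuousMap.continuous_postcomp X'
  obtain ⟨r, hr, hball⟩ := Metric.eventually_nhds_iff.1
    ((hcont.tendsto γ).eventually (Metric.ball_mem_nhds (X'.comp γ) hc))
  filter_upwards [Metric.ball_mem_nhds (0 : C(I, E)) hr] with η hη
  rw [ContinuousMap.norm_le _ (by positivity)]
  intro t
  have key : ∀ y ∈ Metric.ball (γ t) r, ‖X' y - X' (γ t)‖ ≤ c := by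
    intro y hy
    -- Translating the whole curve by `y - γ t` gives a curve through `y` at time `t`, so the
    -- uniform bound can be read off at `y`.
    have h1 : dist (γ + ContinuousMap.const I (y - γ t)) γ < r := by
      rw [dist_eq_norm, add_sub_cancel_left]
      refine lt_of_le_of_lt ((ContinuousMap.norm_le _ (norm_nonneg (y - γ t))).2 fun s => ?_)
        (by simpa [dist_eq_norm] using hy)
      simp
    have h2 := (ContinuousMap.dist_apply_le_dist (f := X'.comp (γ + ContinuousMap.const I (y - γ t)))
      (g := X'.comp γ) t).trans (hball h1).le
    simpa [dist_eq_norm] using h2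
  have hη' : γ t + η t ∈ Metric.ball (γ t) r := by
    have := (η.norm_coe_le_norm t).trans_lt (by simpa using hη)
    simpa [dist_eq_norm] using this
  have := (convex_ball (γ t) r).norm_image_sub_le_of_norm_hasFDerivWithin_le' (f := X)
    (f' := X') (fun y _ => (h y).hasFDerivWithinAt) key (Metric.mem_ball_self hr) hη'
  simp only [add_sub_cancel_left] at this
  simp only [ContinuousMap.sub_apply, ContinuousMap.comp_apply, ContinuousMap.add_apply,
    pointwiseApply_apply]
  exact this.trans (mul_le_mul_of_nonneg_left (η.norm_coe_le_norm t) hc.le)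

/-- The derivative is postcomposition with `X'` followed by the continuous linear map
`pointwiseApply`. The induction hypothesis is applied to the target `E →L[ℝ] F`, which is why the
spaces are quantified after `k` and share a universe. -/
theorem contDiff_nat_postcomp {I : Type*} [TopologicalSpace I] [CompactSpace I] (k : ℕ) : ∀ {E F : Type u}
    [NormedAddCommGroup E] [NormedSpace ℝ E] [NormedAddCommGroup F] [NormedSpace ℝ F]
    (X : C(E, F)), ContDiff ℝ k X → ContDiff ℝ k (fun γ : C(I, E) => X.comp γ) := by
  induction k with
  | zero =>
    intro E F _ _ _ _ X _
    exact contDiff_zero.2 (ContinuousMap.continuous_postcomp X)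
  | succ k ih =>
    intro E F _ _ _ _ X hX
    have hX' : ContDiff ℝ k (fderiv ℝ X) := hX.fderiv_right (by norm_cast)
    let X' : C(E, E →L[ℝ] F) := ⟨fderiv ℝ X, hX'.continuous⟩
    have hd : ∀ x, HasFDerivAt X (X' x) x := fun x =>
      ((hX.differentiable (by norm_cast)) x).hasFDerivAt
    rw [Nat.cast_succ, contDiff_succ_iff_hasFDerivAt (n := k)]
    refine ⟨_, ?_, fun γ => hasFDerivAt_postcomp X X' hd γ⟩
    exact (pointwiseApply I E F).contDiff.comp (ih X' hX')

theorem contDiff_postcomp {I : Type*} [TopologicalSpace I] [CompactSpace I] {E F : Type u}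
    [NormedAddCommGroup E] [NormedSpace ℝ E] [NormedAddCommGroup F] [NormedSpace ℝ F]
    (X : C(E, F)) (hX : ContDiff ℝ ∞ X) : ContDiff ℝ ∞ (fun γ : C(I, E) => X.comp γ) :=
  contDiff_infty.2 fun k => contDiff_nat_postcomp k X (contDiff_infty.1 hX k)

end Postcomp

/-! ### Germs of smooth maps and the inverse function theorem. -/

section SmoothNear

variable {E F H : Type*} [NormedAddCommGroup E] [NormedSpace ℝ E] [NormedAddCommGroup F]
  [NormedSpace ℝ F] [NormedAddCommGroup H] [NormedSpace ℝ H]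

/-- `f` is smooth on a neighbourhood of `x`. -/
def SmoothNear (f : E → F) (x : E) : Prop := ∀ᶠ y in 𝓝 x, ContDiffAt ℝ ∞ f y

theorem SmoothNear.contDiffAt {f : E → F} {x : E} (h : SmoothNear f x) : ContDiffAt ℝ ∞ f x :=
  h.self_of_nhds

theorem SmoothNear.differentiableAt {f : E → F} {x : E} (h : SmoothNear f x) :
    DifferentiableAt ℝ f x := h.contDiffAt.differentiableAt (by simp)

theorem SmoothNear.continuousAt {f : E → F} {x : E} (h : SmoothNear f x) :
    ContinuousAt f x := h.contDiffAt.continuousAt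

/-- Openness is the point of this notion: `ContDiffAt ℝ ∞` at one point gives a neighbourhood for
each finite order, possibly without a common one. -/
theorem SmoothNear.eventually {f : E → F} {x : E} (h : SmoothNear f x) :
    ∀ᶠ y in 𝓝 x, SmoothNear f y := eventually_eventually_nhds.2 h

theorem SmoothNear.congr {f g : E → F} {x : E} (h : SmoothNear f x) (hg : g =ᶠ[𝓝 x] f) :
    SmoothNear g x := by
  filter_upwards [h, eventually_eventually_nhds.2 hg] with y hy hy'
  exact hy.congr_of_eventuallyEq hy'

theorem SmoothNear.comp {g : F → H} {f : E → F} {x : E} (hg : SmoothNear g (f x))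
    (hf : SmoothNear f x) : SmoothNear (g ∘ f) x := by
  filter_upwards [hf, hf.continuousAt.eventually hg] with y hy hy'
  exact hy'.comp y hy

theorem smoothNear_of_contDiff {f : E → F} (h : ContDiff ℝ ∞ f) (x : E) : SmoothNear f x :=
  Eventually.of_forall fun _ => h.contDiffAt

theorem SmoothNear.comp_contDiff {g : F → H} {f : E → F} {x : E} (hg : ContDiff ℝ ∞ g)
    (hf : SmoothNear f x) : SmoothNear (fun y => g (f y)) x := by
  filter_upwards [hf] with y hy
  exact hg.contDiffAt.comp y hy

theorem SmoothNear.smooth_fderiv {f : E → F} {x : E} (h : SmoothNear f x) :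
    SmoothNear (fderiv ℝ f) x := by
  filter_upwards [h] with y hy using hy.fderiv_right (by simp)

theorem SmoothNear.clm_apply {f : E → F →L[ℝ] H} {g : E → F} {x : E} (hf : SmoothNear f x)
    (hg : SmoothNear g x) : SmoothNear (fun y => f y (g y)) x := by
  filter_upwards [hf, hg] with y hy hy'
  exact hy.clm_apply hy'

theorem SmoothNear.prodMk {f : E → F} {g : E → H} {x : E} (hf : SmoothNear f x)
    (hg : SmoothNear g x) : SmoothNear (fun y => (f y, g y)) x := by
  filter_upwards [hf, hg] with y hy hy'
  exact hy.prodMk hy'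

theorem SmoothNear.sub {f g : E → F} {x : E} (hf : SmoothNear f x) (hg : SmoothNear g x) :
    SmoothNear (fun y => f y - g y) x := by
  filter_upwards [hf, hg] with y hy hy' using hy.sub hy'

theorem SmoothNear.neg {f : E → F} {x : E} (hf : SmoothNear f x) :
    SmoothNear (fun y => - f y) x := by
  filter_upwards [hf] with y hy using hy.neg

theorem SmoothNear.mul {f g : E → ℝ} {x : E} (hf : SmoothNear f x) (hg : SmoothNear g x) :
    SmoothNear (fun y => f y * g y) x := by
  filter_upwards [hf, hg] with y hy hy' using hy.mul hy'

theorem SmoothNear.inv {f : E → ℝ} {x : E} (hf : SmoothNear f x) (h0 : f x ≠ 0) :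
    SmoothNear (fun y => (f y)⁻¹) x := by
  filter_upwards [hf, hf.continuousAt.eventually_ne h0] with y hy hy' using hy.inv hy'

theorem smoothNear_const (c : F) (x : E) : SmoothNear (fun _ : E => c) x :=
  smoothNear_of_contDiff contDiff_const x

theorem smoothNear_id (x : E) : SmoothNear (fun y : E => y) x :=
  smoothNear_of_contDiff contDiff_id x

theorem smoothNear_pi {ι : Type*} [Fintype ι] {f : E → ι → ℝ} {x : E} :
    SmoothNear f x ↔ ∀ i, SmoothNear (fun y => f y i) x := by
  simp only [SmoothNear, ← eventually_all, contDiffAt_pi]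

theorem smoothNear_of_contDiffOn {f : E → F} {U : Set E} (h : ContDiffOn ℝ ∞ f U) (hU : IsOpen U)
    {x : E} (hx : x ∈ U) : SmoothNear f x := by
  filter_upwards [hU.mem_nhds hx] with y hy using h.contDiffAt (hU.mem_nhds hy)

theorem SmoothNear.exists_isOpen {f : E → F} {x : E} (h : SmoothNear f x) :
    ∃ U, IsOpen U ∧ x ∈ U ∧ ContDiffOn ℝ ∞ f U := by
  obtain ⟨U, hU, ho, hx⟩ := eventually_nhds_iff.1 h
  exact ⟨U, ho, hx, fun y hy => (hU y hy).contDiffWithinAt⟩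

/-- A smooth map with invertible derivative is a local diffeomorphism. -/
theorem SmoothNear.exists_openPartialHomeomorph [CompleteSpace E] {f : E → F} {x : E}
    (h : SmoothNear f x) (f' : E ≃L[ℝ] F) (hf' : HasFDerivAt f (f' : E →L[ℝ] F) x) :
    ∃ e : OpenPartialHomeomorph E F, (∀ y, e y = f y) ∧ x ∈ e.source ∧
      ContDiffOn ℝ ∞ e e.source ∧ ContDiffOn ℝ ∞ e.symm e.target := by
  let e₀ := h.contDiffAt.toOpenPartialHomeomorph f hf' (by simp)
  have he₀ : ∀ y, e₀ y = f y := fun y => rfl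
  have hx₀ : x ∈ e₀.source := h.contDiffAt.mem_toOpenPartialHomeomorph_source hf' (by simp)
  obtain ⟨U, hUo, hxU, hU⟩ := h.exists_isOpen
  -- The derivative stays invertible near `x`. After restriction to such points the inverse is
  -- smooth on the whole target and not only at `f x`.
  have hev : ∀ᶠ y in 𝓝 x, fderiv ℝ f y ∈ range ((↑) : (E ≃L[ℝ] F) → E →L[ℝ] F) := by
    refine h.smooth_fderiv.continuousAt.eventually (ContinuousLinearEquiv.isOpen.mem_nhds ?_)
    exact ⟨f', hf'.fderiv.symm⟩
  obtain ⟨V, hV, hVo, hxV⟩ := eventually_nhds_iff.1 hev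
  let e := e₀.restrOpen (U ∩ V) (hUo.inter hVo)
  have hes : e.source = e₀.source ∩ (U ∩ V) := e₀.restrOpen_source _ (hUo.inter hVo)
  refine ⟨e, fun y => he₀ y, by rw [hes]; exact ⟨hx₀, hxU, hxV⟩, ?_, ?_⟩
  · refine hU.mono ?_
    rw [hes]
    exact fun y hy => hy.2.1
  · intro z hz
    have hz' := e.map_target hz
    rw [hes] at hz'
    obtain ⟨g, hg⟩ := hV _ hz'.2.2
    have hsm : ContDiffAt ℝ ∞ f (e.symm z) := hU.contDiffAt (hUo.mem_nhds hz'.2.1)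
    refine (e.contDiffAt_symm hz (f₀' := g) ?_ hsm).contDiffWithinAt
    rw [hg]
    exact (hsm.differentiableAt (by simp)).hasFDerivAt

end SmoothNear

end PoissonGeom

end

/-! ### Smooth local flows of vector fields. -/

noncomputable section

open scoped Manifold ContDiff Topology
open Filter Set

namespace PoissonGeom

section Flow

universe u

variable {E : Type u} [NormedAddCommGroup E] [NormedSpace ℝ E]

/-- A map that is smooth near a point has the same germ as a globally smooth map. -/
theorem SmoothNear.exists_contDiff [FiniteDimensional ℝ E] {F : Type*} [NormedAddCommGroup F]
    [NormedSpace ℝ F] {X : E → F} {m : E} (h : SmoothNear X m) :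
    ∃ Y : E → F, ContDiff ℝ ∞ Y ∧ Y =ᶠ[𝓝 m] X := by
  obtain ⟨U, hUo, hmU, hU⟩ := h.exists_isOpen
  obtain ⟨ε, hε, hball⟩ := Metric.isOpen_iff.1 hUo m hmU
  let f : ContDiffBump m := ⟨ε / 4, ε / 2, by positivity, by linarith⟩
  refine ⟨fun x => f x • X x, contDiff_iff_contDiffAt.2 fun x => ?_, ?_⟩
  · by_cases hx : x ∈ Metric.ball m ε
    · exact f.contDiffAt.smul (hU.contDiffAt (hUo.mem_nhds (hball hx)))
    · refine (contDiffAt_const (c := (0 : F))).congr_of_eventuallyEq ?_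
      have : ∀ᶠ y in 𝓝 x, ε / 2 < dist y m := by
        refine (continuous_id.dist continuous_const).continuousAt.eventually_const_lt ?_
        simp only [Metric.mem_ball, not_lt] at hx
        simp only [id]
        linarith
      filter_upwards [this] with y hy
      rw [f.zero_of_le_dist hy.le, zero_smul]
  · filter_upwards [f.eventuallyEq_one] with y hy
    simp [hy]

/-- The interval that parametrises the curves. -/
abbrev FlowInterval : Type := Icc (-1 : ℝ) 1

theorem neg_one_le_one_real : (-1 : ℝ) ≤ 1 := by norm_num

/-- The primitive, vanishing at `0`, of a curve on `[-1, 1]`. -/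
def primitiveCLM (E : Type u) [NormedAddCommGroup E] [NormedSpace ℝ E] [CompleteSpace E] :
    C(FlowInterval, E) →L[ℝ] C(FlowInterval, E) :=
  LinearMap.mkContinuous
    { toFun := fun f => ⟨fun t => ∫ s in (0 : ℝ)..t, IccExtend neg_one_le_one_real f s,
        (intervalIntegral.continuous_primitive
          (fun a b => (f.continuous.Icc_extend' (h := neg_one_le_one_real)).intervalIntegrable a b)
          0).comp continuous_subtype_val⟩
      map_add' := fun f g => by
        ext t
        simp only [ContinuousMap.coe_mk, ContinuousMap.add_apply]
        rw [← intervalIntegral.integral_add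
          ((f.continuous.Icc_extend' (h := neg_one_le_one_real)).intervalIntegrable _ _)
          ((g.continuous.Icc_extend' (h := neg_one_le_one_real)).intervalIntegrable _ _)]
        rfl
      map_smul' := fun c f => by
        ext t
        simp only [ContinuousMap.coe_mk, ContinuousMap.smul_apply, RingHom.id_apply]
        rw [← intervalIntegral.integral_smul]
        rfl } 1
    (fun f => by
      rw [one_mul, ContinuousMap.norm_le _ (norm_nonneg _)]
      intro t
      have h1 : ‖∫ s in (0 : ℝ)..t, IccExtend neg_one_le_one_real f s‖ ≤ ‖f‖ * |(t : ℝ) - 0| :=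
        intervalIntegral.norm_integral_le_of_norm_le_const fun s _ => f.norm_coe_le_norm _
      refine h1.trans (mul_le_of_le_one_right (norm_nonneg _) ?_)
      rw [sub_zero]
      exact abs_le.2 ⟨t.2.1, t.2.2⟩)

theorem primitiveCLM_apply [CompleteSpace E] (f : C(FlowInterval, E)) (t : FlowInterval) :
    primitiveCLM E f t = ∫ s in (0 : ℝ)..t, IccExtend neg_one_le_one_real f s := rfl

/-- The curve `t ↦ γ (c * t)`. -/
def scaleCurve (γ : C(FlowInterval, E)) (c : FlowInterval) : C(FlowInterval, E) :=
  γ.comp ⟨fun t => ⟨c * t, by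
    have := abs_le.2 ⟨c.2.1, c.2.2⟩
    have := abs_le.2 ⟨t.2.1, t.2.2⟩
    have h : |(c : ℝ) * t| ≤ 1 := by rw [abs_mul]; exact mul_le_one₀ ‹_› (abs_nonneg _) ‹_›
    exact abs_le.1 h⟩, by fun_prop⟩

theorem IccExtend_of_abs_le {α : Type*} {f : FlowInterval → α} {s : ℝ} (hs : |s| ≤ 1) :
    IccExtend neg_one_le_one_real f s = f ⟨s, abs_le.1 hs⟩ :=
  IccExtend_of_mem _ _ (abs_le.1 hs)

/-- Substitution in the integral. It shows that a rescaled solution of the integral equation solves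
the equation with rescaled time parameter. -/
theorem primitiveCLM_scaleCurve [CompleteSpace E] (X : C(E, E)) (γ : C(FlowInterval, E))
    (c : FlowInterval) :
    (c : ℝ) • primitiveCLM E (X.comp (scaleCurve γ c)) =
      scaleCurve (primitiveCLM E (X.comp γ)) c := by
  ext t
  have hc := abs_le.2 ⟨c.2.1, c.2.2⟩
  have ht := abs_le.2 ⟨t.2.1, t.2.2⟩
  simp only [ContinuousMap.smul_apply, primitiveCLM_apply, scaleCurve, ContinuousMap.comp_apply,
    ContinuousMap.coe_mk]
  have h1 := intervalIntegral.smul_integral_comp_mul_left (a := 0) (b := t)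
    (f := IccExtend neg_one_le_one_real (X.comp γ)) (c : ℝ)
  rw [mul_zero] at h1
  rw [← h1]
  congr 1
  refine intervalIntegral.integral_congr fun s hs => ?_
  have hs1 : |s| ≤ 1 := by
    have h0 := abs_le.1 ht
    rcases le_total 0 (t : ℝ) with h | h
    · rw [uIcc_of_le h] at hs
      exact abs_le.2 ⟨by linarith [hs.1], by linarith [hs.2, h0.2]⟩
    · rw [uIcc_of_ge h] at hs
      exact abs_le.2 ⟨by linarith [hs.1, h0.1], by linarith [hs.2]⟩
  have hcs : |(c : ℝ) * s| ≤ 1 := by rw [abs_mul]; exact mul_le_one₀ hc (abs_nonneg _) hs1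
  simp only [IccExtend_of_abs_le hs1, IccExtend_of_abs_le hcs]
  rfl

/-- Existence of a smooth local solution operator for an ordinary differential equation, on the
level of curves. -/
theorem exists_smooth_integral_curves [CompleteSpace E] (X : C(E, E)) (hX : ContDiff ℝ ∞ X)
    (m : E) :
    ∃ Γ : ℝ × E → C(FlowInterval, E), SmoothNear Γ (0, m) ∧
      (∀ᶠ p in 𝓝 ((0, m) : ℝ × E),
        Γ p = ContinuousMap.const _ p.2 + p.1 • primitiveCLM E (X.comp (Γ p))) ∧
      ∀ᶠ p in 𝓝 ((0, m) : ℝ × E), ∀ c : FlowInterval, Γ (c * p.1, p.2) = scaleCurve (Γ p) c := by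
  let K : E →L[ℝ] C(FlowInterval, E) := ContinuousLinearMap.const ℝ FlowInterval
  -- The second component vanishes at `((τ, x), γ)` exactly if `γ = x + τ ∫ X(γ)`, so that `γ t` is
  -- the point reached from `x` at time `τ t`. At `τ = 0` and the constant curve `m` the integral
  -- term does not contribute to the derivative in `γ`, which is the identity; hence the inverse
  -- function theorem applies.
  let T : (ℝ × E) × C(FlowInterval, E) → (ℝ × E) × C(FlowInterval, E) := fun p =>
    (p.1, p.2 - (K p.1.2 + p.1.1 • primitiveCLM E (X.comp p.2)))
  have hN : ContDiff ℝ ∞ (fun γ : C(FlowInterval, E) => primitiveCLM E (X.comp γ)) :=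
    (primitiveCLM E).contDiff.comp (contDiff_postcomp X hX)
  have hT : ContDiff ℝ ∞ T := by
    refine contDiff_fst.prodMk (contDiff_snd.sub ((K.contDiff.comp
      (contDiff_snd.comp contDiff_fst)).add
      ((contDiff_fst.comp contDiff_fst).smul (hN.comp contDiff_snd))))
  let v := primitiveCLM E (X.comp (K m))
  let A : ℝ × E →L[ℝ] C(FlowInterval, E) :=
    K.comp (ContinuousLinearMap.snd ℝ ℝ E) + (ContinuousLinearMap.fst ℝ ℝ E).smulRight v
  let T' : ((ℝ × E) × C(FlowInterval, E)) ≃L[ℝ] ((ℝ × E) × C(FlowInterval, E)) :=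
    ContinuousLinearEquiv.equivOfInverse
      ((ContinuousLinearMap.fst ℝ _ _).prod
        (ContinuousLinearMap.snd ℝ _ _ - A.comp (ContinuousLinearMap.fst ℝ _ _)))
      ((ContinuousLinearMap.fst ℝ _ _).prod
        (ContinuousLinearMap.snd ℝ _ _ + A.comp (ContinuousLinearMap.fst ℝ _ _)))
      (fun p => by ext1 <;> simp) (fun p => by ext1 <;> simp)
  have hT' : HasFDerivAt T (T' : ((ℝ × E) × C(FlowInterval, E)) →L[ℝ] _) ((0, m), K m) := by
    have h1 : HasFDerivAt (fun p : (ℝ × E) × C(FlowInterval, E) => p.1.1)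
        ((ContinuousLinearMap.fst ℝ ℝ E).comp (ContinuousLinearMap.fst ℝ _ _)) ((0, m), K m) :=
      ContinuousLinearMap.hasFDerivAt
        ((ContinuousLinearMap.fst ℝ ℝ E).comp
          (ContinuousLinearMap.fst ℝ (ℝ × E) C(FlowInterval, E)))
    have h2 : HasFDerivAt (fun p : (ℝ × E) × C(FlowInterval, E) => K p.1.2)
        (K.comp ((ContinuousLinearMap.snd ℝ ℝ E).comp (ContinuousLinearMap.fst ℝ _ _)))
        ((0, m), K m) :=
      ContinuousLinearMap.hasFDerivAt
        (K.comp ((ContinuousLinearMap.snd ℝ ℝ E).comp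
          (ContinuousLinearMap.fst ℝ (ℝ × E) C(FlowInterval, E))))
    have h3 := ((hN.comp (contDiff_snd (E := ℝ × E))).differentiable (by simp)
      ((0, m), K m)).hasFDerivAt
    have h4 := (hasFDerivAt_fst (𝕜 := ℝ) (p := (((0, m), K m) : (ℝ × E) × C(FlowInterval, E)))).prodMk
      ((hasFDerivAt_snd (𝕜 := ℝ) (p := (((0, m), K m) : (ℝ × E) × C(FlowInterval, E)))).sub
        (h2.add (h1.smul h3)))
    refine h4.congr_fderiv ?_
    ext1
    · ext1
      · ext <;> simp [T', A, v]
      · ext <;> simp [T', A, v]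
    · ext <;> simp [T', A, v]
  obtain ⟨e, heT, hes, -, hsymm⟩ :=
    (smoothNear_of_contDiff hT ((0, m), K m)).exists_openPartialHomeomorph T' hT'
  have hbase : e ((0, m), K m) = ((0, m), 0) := by rw [heT]; simp [T, K]
  have htarget : ((0, m), 0) ∈ e.target := hbase ▸ e.map_source hes
  have hsymm0 : e.symm ((0, m), 0) = ((0, m), K m) := by rw [← hbase, e.left_inv hes]
  let ι : ℝ × E → (ℝ × E) × C(FlowInterval, E) := fun p => (p, 0)
  have hι : ContDiff ℝ ∞ ι := contDiff_id.prodMk contDiff_const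
  have hevt : ∀ᶠ p in 𝓝 ((0, m) : ℝ × E), ι p ∈ e.target :=
    hι.continuous.continuousAt.eventually (e.open_target.mem_nhds htarget)
  have hΓ : SmoothNear (fun p => (e.symm (ι p)).2) (0, m) :=
    SmoothNear.comp_contDiff contDiff_snd
      (SmoothNear.comp (x := ((0, m) : ℝ × E)) (f := ι)
        (smoothNear_of_contDiffOn hsymm e.open_target htarget) (smoothNear_of_contDiff hι _))
  have hfst : ∀ p, ι p ∈ e.target → (e.symm (ι p)).1 = p := fun p hp => by
    have := e.right_inv hp
    rw [heT] at this
    exact congrArg Prod.fst this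
  have hsnd : ∀ p, ι p ∈ e.target → (e.symm (ι p)).2 =
      K p.2 + p.1 • primitiveCLM E (X.comp (e.symm (ι p)).2) := fun p hp => by
    have := e.right_inv hp
    rw [heT] at this
    have h2 := congrArg Prod.snd this
    simp only [T, ι, hfst p hp] at h2
    rw [show (p, (0 : C(FlowInterval, E))) = ι p from rfl] at h2
    exact sub_eq_zero.1 h2
  refine ⟨fun p => (e.symm (ι p)).2, hΓ, ?_, ?_⟩
  · filter_upwards [hevt] with p hp using hsnd p hp
  -- The rescaled curve solves the equation for the parameter `c * p.1`. It is no farther from the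
  -- constant curve `K m` than the original one, so it lies in the domain where `T` is injective and
  -- must be the chosen solution.
  · obtain ⟨ε, hε, hball⟩ := Metric.isOpen_iff.1 e.open_source _ hes
    have h1 : ∀ᶠ p in 𝓝 ((0, m) : ℝ × E), (e.symm (ι p)).2 ∈ Metric.ball (K m) ε := by
      refine hΓ.continuousAt.eventually (Metric.isOpen_ball.mem_nhds ?_)
      simp only [ι, hsymm0]
      exact Metric.mem_ball_self hε
    filter_upwards [hevt, h1, Metric.ball_mem_nhds _ hε] with p hp hp1 hp2 c
    have hγ : scaleCurve (e.symm (ι p)).2 c ∈ Metric.ball (K m) ε := by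
      rw [Metric.mem_ball, dist_eq_norm] at hp1 ⊢
      refine lt_of_le_of_lt ((ContinuousMap.norm_le _ (norm_nonneg _)).2 fun t => ?_) hp1
      exact ContinuousMap.norm_coe_le_norm ((e.symm (ι p)).2 - K m) _
    have hcp : ((c : ℝ) * p.1, p.2) ∈ Metric.ball ((0, m) : ℝ × E) ε := by
      rw [Metric.mem_ball, Prod.dist_eq, max_lt_iff] at hp2 ⊢
      refine ⟨lt_of_le_of_lt ?_ hp2.1, hp2.2⟩
      simp only [dist_zero_right, norm_mul]
      exact mul_le_of_le_one_left (norm_nonneg _) (abs_le.2 ⟨c.2.1, c.2.2⟩)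
    have hsrc : (((c : ℝ) * p.1, p.2), scaleCurve (e.symm (ι p)).2 c) ∈ e.source := by
      apply hball
      rw [Metric.mem_ball, Prod.dist_eq, max_lt_iff]
      exact ⟨hcp, hγ⟩
    have himg : e (((c : ℝ) * p.1, p.2), scaleCurve (e.symm (ι p)).2 c) = ι (c * p.1, p.2) := by
      rw [heT]
      simp only [T, ι]
      congr 1
      rw [sub_eq_zero, mul_comm, mul_smul, primitiveCLM_scaleCurve]
      conv_lhs => rw [hsnd p hp]
      ext t
      simp [scaleCurve, K, ι]
    rw [← himg, e.left_inv hsrc]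

/-- Smooth local flow of a vector field. -/
theorem exists_smooth_flow [FiniteDimensional ℝ E] {X : E → E} {m : E} (h : SmoothNear X m) :
    ∃ Φ : ℝ × E → E, SmoothNear Φ (0, m) ∧ (∀ᶠ x in 𝓝 m, Φ (0, x) = x) ∧
      ∀ᶠ p in 𝓝 ((0, m) : ℝ × E), HasDerivAt (fun t => Φ (t, p.2)) (X (Φ p)) p.1 := by
  have : CompleteSpace E := FiniteDimensional.complete ℝ E
  -- A globally defined field can be composed with every curve, so it acts on the whole curve space.
  obtain ⟨Y, hY, hYX⟩ := h.exists_contDiff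
  obtain ⟨Γ, hΓ, hint, hscale⟩ := exists_smooth_integral_curves ⟨Y, hY.continuous⟩ hY m
  let one : FlowInterval := ⟨1, by norm_num⟩
  obtain ⟨δ, hδ, hev⟩ := Metric.eventually_nhds_iff_ball.1 (hint.and hscale)
  have hmem : ∀ {t : ℝ} {x : E}, |t| < δ → x ∈ Metric.ball m δ →
      (t, x) ∈ Metric.ball ((0, m) : ℝ × E) δ := fun {t x} ht hx => by
    rw [Metric.mem_ball, Prod.dist_eq, max_lt_iff]
    exact ⟨by simpa using ht, hx⟩
  have hδ2 : |δ / 2| < δ := by rw [abs_of_pos (by positivity)]; linarith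
  -- The flow at time `s` is the curve with parameter `s` evaluated at `1`. Rescaling expresses it
  -- through the single curve with parameter `δ / 2`, so that `s` occurs only as a limit of
  -- integration and the fundamental theorem of calculus gives the derivative.
  have key : ∀ x ∈ Metric.ball m δ, ∀ s : ℝ, |s| ≤ δ / 2 → Γ (s, x) one =
      x + (δ / 2) • ∫ σ in (0 : ℝ)..(s / (δ / 2)),
        Y (IccExtend neg_one_le_one_real (Γ (δ / 2, x)) σ) := by
    intro x hx s hs
    have hc : |s / (δ / 2)| ≤ 1 := by
      rw [abs_div, abs_of_pos (show 0 < δ / 2 by positivity), div_le_one (by positivity)]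
      exact hs
    have h1 := (hev _ (hmem hδ2 hx)).2 ⟨s / (δ / 2), abs_le.1 hc⟩
    simp only at h1
    rw [div_mul_cancel₀ _ (by positivity)] at h1
    rw [h1, scaleCurve]
    simp only [ContinuousMap.comp_apply, ContinuousMap.coe_mk, one, mul_one]
    conv_lhs => rw [(hev _ (hmem hδ2 hx)).1]
    rfl
  refine ⟨fun p => Γ p one, SmoothNear.comp_contDiff
    (ContinuousMap.evalCLM ℝ one : C(FlowInterval, E) →L[ℝ] E).contDiff hΓ, ?_, ?_⟩
  · filter_upwards [Metric.ball_mem_nhds m hδ] with x hx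
    rw [key x hx 0 (by simp; positivity)]
    simp
  · have hcont : ContinuousAt (fun p => Γ p one) (0, m) :=
      (ContinuousMap.evalCLM ℝ one : C(FlowInterval, E) →L[ℝ] E).continuous.continuousAt.comp
        hΓ.continuousAt
    have hm0 : Γ (0, m) one = m := by
      rw [key m (Metric.mem_ball_self hδ) 0 (by simp; positivity)]
      simp
    have hYX' : ∀ᶠ p in 𝓝 ((0, m) : ℝ × E), Y (Γ p one) = X (Γ p one) := by
      refine hcont.eventually (p := fun y => Y y = X y) ?_
      simp only [hm0]
      exact hYX
    filter_upwards [hYX', Metric.ball_mem_nhds ((0, m) : ℝ × E) (half_pos hδ)] with p hp hp2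
    obtain ⟨t, x⟩ := p
    rw [Metric.mem_ball, Prod.dist_eq, max_lt_iff] at hp2
    have hx : x ∈ Metric.ball m δ := Metric.ball_subset_ball (by linarith) hp2.2
    have ht : |t| < δ / 2 := by simpa using hp2.1
    rw [← hp]
    have hev' : (fun s => Γ (s, x) one) =ᶠ[𝓝 t] fun s => x + (δ / 2) •
        ∫ σ in (0 : ℝ)..(s / (δ / 2)), Y (IccExtend neg_one_le_one_real (Γ (δ / 2, x)) σ) := by
      filter_upwards [(continuous_abs.tendsto t).eventually_lt_const ht] with s hs
      exact key x hx s hs.le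
    refine HasDerivAt.congr_of_eventuallyEq ?_ hev'
    have hcY : Continuous fun σ => Y (IccExtend neg_one_le_one_real (Γ (δ / 2, x)) σ) :=
      hY.continuous.comp ((Γ (δ / 2, x)).continuous.Icc_extend')
    have hd := (hcY.integral_hasStrictDerivAt 0 (t / (δ / 2))).hasDerivAt
    have hd2 := hd.scomp t ((hasDerivAt_id t).div_const (δ / 2))
    have hd3 := (hd2.const_smul (δ / 2)).const_add x
    refine hd3.congr_deriv ?_
    have hc : |t / (δ / 2)| ≤ 1 := by
      rw [abs_div, abs_of_pos (show 0 < δ / 2 by positivity), div_le_one (by positivity)]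
      exact ht.le
    rw [smul_smul, mul_one_div_cancel (by positivity), one_smul, IccExtend_of_abs_le hc]
    have h1 := (hev _ (hmem hδ2 hx)).2 ⟨t / (δ / 2), abs_le.1 hc⟩
    simp only at h1
    rw [div_mul_cancel₀ _ (by positivity)] at h1
    simp only [h1, scaleCurve, ContinuousMap.comp_apply, ContinuousMap.coe_mk, one, mul_one]

end Flow

end PoissonGeom

end

/-! ### Retractions along a vector field onto a hypersurface. -/

noncomputable section

open scoped Manifold ContDiff Topology
open Filter Set

namespace PoissonGeom

section Retraction

universe u

variable {E : Type u} [NormedAddCommGroup E] [NormedSpace ℝ E]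

/-- `Φ` is a smooth local flow of the vector field `X` near `m`. -/
structure IsLocalFlow (X : E → E) (m : E) (Φ : ℝ × E → E) : Prop where
  smooth : SmoothNear Φ (0, m)
  zero : ∀ᶠ x in 𝓝 m, Φ (0, x) = x
  hasDerivAt : ∀ᶠ p in 𝓝 ((0, m) : ℝ × E), HasDerivAt (fun t => Φ (t, p.2)) (X (Φ p)) p.1

theorem IsLocalFlow.tendsto {X : E → E} {m : E} {Φ : ℝ × E → E} (h : IsLocalFlow X m Φ) :
    Tendsto Φ (𝓝 (0, m)) (𝓝 m) := by
  have := h.smooth.continuousAt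
  rwa [ContinuousAt, h.zero.self_of_nhds] at this

/-- A function with constant derivative `c` along `X` grows by `c * t` along the flow. -/
theorem IsLocalFlow.apply_eq_add {X : E → E} {m : E} {Φ : ℝ × E → E} (h : IsLocalFlow X m Φ)
    {u : E → ℝ} (hu : SmoothNear u m) {c : ℝ} (hc : ∀ᶠ x in 𝓝 m, fderiv ℝ u x (X x) = c) :
    ∀ᶠ p in 𝓝 ((0, m) : ℝ × E), u (Φ p) = u p.2 + c * p.1 := by
  have h0 : ∀ᶠ p in 𝓝 ((0, m) : ℝ × E), Φ (0, p.2) = p.2 :=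
    (continuous_snd.tendsto ((0, m) : ℝ × E)).eventually h.zero
  obtain ⟨δ, hδ, hball⟩ := Metric.eventually_nhds_iff_ball.1
    (h0.and (h.hasDerivAt.and ((h.tendsto.eventually hu).and (h.tendsto.eventually hc))))
  filter_upwards [Metric.ball_mem_nhds _ hδ] with ⟨t, x⟩ hp
  have hmem : ∀ s ∈ Metric.ball (0 : ℝ) δ, (s, x) ∈ Metric.ball ((0, m) : ℝ × E) δ := by
    intro s hs
    rw [Metric.mem_ball, Prod.dist_eq, max_lt_iff] at hp ⊢
    exact ⟨hs, hp.2⟩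
  have hder : ∀ s ∈ Metric.ball (0 : ℝ) δ,
      HasDerivWithinAt (fun s => u (Φ (s, x)) - c * s) 0 (Metric.ball 0 δ) s := by
    intro s hs
    obtain ⟨-, h1, h2, h3⟩ := hball _ (hmem s hs)
    have h4 : HasDerivAt (fun s => u (Φ (s, x))) (fderiv ℝ u (Φ (s, x)) (X (Φ (s, x)))) s :=
      (h2.differentiableAt (by simp)).hasFDerivAt.comp_hasDerivAt s h1
    rw [h3] at h4
    have h5 := h4.sub ((hasDerivAt_id s).const_mul c)
    simp only [mul_one, sub_self] at h5
    exact h5.hasDerivWithinAt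
  have ht : t ∈ Metric.ball (0 : ℝ) δ := by
    rw [Metric.mem_ball, Prod.dist_eq, max_lt_iff] at hp
    exact hp.1
  have := (convex_ball (0 : ℝ) δ).norm_image_sub_le_of_norm_hasDerivWithin_le (C := 0) hder
    (fun _ _ => by simp) (Metric.mem_ball_self hδ) ht
  simp only [zero_mul, norm_le_zero_iff] at this
  have h6 : Φ (0, x) = x := (hball _ hp).1
  simp only [h6] at this
  simp only
  linarith

/-- As functions of the first time both sides are integral curves of `X` with the same value at `0`,
and `X` is Lipschitz near `m`. -/
theorem IsLocalFlow.group {X : E → E} {m : E} {Φ : ℝ × E → E} (h : IsLocalFlow X m Φ)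
    (hX : SmoothNear X m) :
    ∀ᶠ p in 𝓝 ((0, 0, m) : ℝ × ℝ × E), Φ (p.1, Φ p.2) = Φ (p.1 + p.2.1, p.2.2) := by
  obtain ⟨K, s, hs, hK⟩ :=
    (hX.contDiffAt.of_le (m := 1) (by simp)).exists_lipschitzOnWith
  have h0 : ∀ᶠ p in 𝓝 ((0, m) : ℝ × E), Φ (0, p.2) = p.2 :=
    (continuous_snd.tendsto ((0, m) : ℝ × E)).eventually h.zero
  obtain ⟨δ, hδ, hball⟩ := Metric.eventually_nhds_iff_ball.1
    (h0.and (h.hasDerivAt.and (h.tendsto.eventually hs)))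
  have hev : ∀ᶠ p in 𝓝 ((0, m) : ℝ × E), Φ p ∈ Metric.ball m δ :=
    h.tendsto.eventually (Metric.ball_mem_nhds m hδ)
  obtain ⟨ε, hε, hball'⟩ := Metric.eventually_nhds_iff_ball.1 hev
  -- The bound `ε` keeps `Φ (r, x)` in the ball of radius `δ`; the bound `δ / 2` on both times keeps
  -- their sum below `δ`.
  let η := min ε (δ / 2)
  have hη : 0 < η := lt_min hε (by positivity)
  have hη1 : η ≤ ε := min_le_left _ _
  have hη2 : η ≤ δ / 2 := min_le_right _ _
  filter_upwards [Metric.ball_mem_nhds _ hη] with ⟨t, r, x⟩ hp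
  rw [Metric.mem_ball, Prod.dist_eq, max_lt_iff, Prod.dist_eq, max_lt_iff] at hp
  obtain ⟨ht, hr, hx⟩ := hp
  simp only [dist_zero_right, Real.norm_eq_abs] at ht hr hx
  have hΦ : Φ (r, x) ∈ Metric.ball m δ := hball' _ (by
    rw [Metric.mem_ball, Prod.dist_eq, max_lt_iff]
    exact ⟨by simp only [dist_zero_right, Real.norm_eq_abs]; linarith,
      lt_of_lt_of_le hx hη1⟩)
  have hm1 : ∀ σ ∈ Ioo (-η) η, (σ, Φ (r, x)) ∈ Metric.ball ((0, m) : ℝ × E) δ := by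
    intro σ hσ
    have := abs_lt.2 ⟨hσ.1, hσ.2⟩
    rw [Metric.mem_ball, Prod.dist_eq, max_lt_iff]
    exact ⟨by simp only [dist_zero_right, Real.norm_eq_abs]; linarith, hΦ⟩
  have hm2 : ∀ σ ∈ Ioo (-η) η, (σ + r, x) ∈ Metric.ball ((0, m) : ℝ × E) δ := by
    intro σ hσ
    have h1 := abs_lt.2 ⟨hσ.1, hσ.2⟩
    have h2 := abs_add_le σ r
    rw [Metric.mem_ball, Prod.dist_eq, max_lt_iff]
    refine ⟨by simp only [dist_zero_right, Real.norm_eq_abs]; linarith, ?_⟩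
    simp only
    linarith
  have := ODE_solution_unique_of_mem_Ioo (v := fun _ => X) (s := fun _ => s) (K := K)
    (f := fun σ => Φ (σ, Φ (r, x))) (g := fun σ => Φ (σ + r, x)) (a := -η) (b := η) (t₀ := 0)
    (fun _ _ => hK) ⟨by linarith, hη⟩
    (fun σ hσ => ⟨(hball _ (hm1 σ hσ)).2.1, (hball _ (hm1 σ hσ)).2.2⟩)
    (fun σ hσ => ⟨by
      have := (hball _ (hm2 σ hσ)).2.1
      exact this.comp_add_const σ r, (hball _ (hm2 σ hσ)).2.2⟩)
    (by simpa using (hball (0, Φ (r, x)) (hm1 0 ⟨by linarith, hη⟩)).1)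
  exact this (abs_lt.1 ht)

/-- This differentiates maps that flow each point for a time depending on the point, at those points
where that time is zero. -/
theorem IsLocalFlow.fderiv_zero {X : E → E} {m : E} {Φ : ℝ × E → E} (h : IsLocalFlow X m Φ) :
    ∀ᶠ x in 𝓝 m, ∀ (τ : ℝ) (v : E), fderiv ℝ Φ (0, x) (τ, v) = τ • X x + v := by
  have hι : Tendsto (fun x : E => ((0 : ℝ), x)) (𝓝 m) (𝓝 (0, m)) :=
    (Continuous.prodMk_right (0 : ℝ)).tendsto m
  filter_upwards [hι.eventually h.smooth, hι.eventually h.hasDerivAt, h.zero,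
    eventually_eventually_nhds.2 h.zero] with x h1 h2 h3 h4 τ v
  have hd := (h1.differentiableAt (by simp)).hasFDerivAt
  have e1 : fderiv ℝ Φ (0, x) (1, 0) = X x := by
    have := hd.comp_hasDerivAt (0 : ℝ) ((hasDerivAt_id (0 : ℝ)).prodMk (hasDerivAt_const 0 x))
    rw [h3] at h2
    exact this.unique h2
  have e2 : fderiv ℝ Φ (0, x) (0, v) = v := by
    have hc := hd.comp (f := fun y : E => ((0 : ℝ), y)) x
      ((hasFDerivAt_const (0 : ℝ) x).prodMk (hasFDerivAt_id x))
    have hc2 : HasFDerivAt (Φ ∘ fun y : E => ((0 : ℝ), y)) (ContinuousLinearMap.id ℝ E) x :=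
      (hasFDerivAt_id x).congr_of_eventuallyEq h4
    simpa using congrArg (fun L : E →L[ℝ] E => L v) (hc.unique hc2)
  have : ((τ, v) : ℝ × E) = τ • (1, 0) + (0, v) := by simp
  rw [this, map_add, map_smul, e1, e2]

/-- `π` is, near `m`, a smooth retraction along the vector field `X` onto the hypersurface
`P = P m`; the function `P` satisfies `X P = 1`. -/
structure IsRetraction (X : E → E) (P : E → ℝ) (m : E) (π : E → E) : Prop where
  smooth : SmoothNear π m
  base : π m = m
  deriv_field : ∀ᶠ x in 𝓝 m, fderiv ℝ π x (X x) = 0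
  level : ∀ᶠ x in 𝓝 m, P (π x) = P m
  fixed : ∀ᶠ x in 𝓝 m, P x = P m → π x = x
  deriv_of_level : ∀ᶠ x in 𝓝 m, P x = P m → ∀ v, fderiv ℝ π x v = v - fderiv ℝ P x v • X x
  invariant : ∀ u : E → ℝ, SmoothNear u m → (∀ᶠ x in 𝓝 m, fderiv ℝ u x (X x) = 0) →
    ∀ᶠ x in 𝓝 m, u (π x) = u x
  exists_inverse : ∃ Ψ : ℝ × E → E, SmoothNear Ψ (0, m) ∧
    ∀ᶠ x in 𝓝 m, Ψ (P x - P m, π x) = x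

theorem exists_isLocalFlow [FiniteDimensional ℝ E] {X : E → E} {m : E} (h : SmoothNear X m) :
    ∃ Φ, IsLocalFlow X m Φ := by
  obtain ⟨Φ, h1, h2, h3⟩ := exists_smooth_flow h
  exact ⟨Φ, h1, h2, h3⟩

/-- Each point `x` flows for the time `P m - P x`. As `X P = 1`, it arrives on the level of `P m`,
and points on the same integral curve arrive at the same place. Functions constant along `X` are
then determined by their restriction to the level, and `(P x - P m, π x)` recovers `x` by flowing
back. -/
theorem exists_isRetraction [FiniteDimensional ℝ E] {X : E → E} {P : E → ℝ} {m : E}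
    (hX : SmoothNear X m) (hP : SmoothNear P m) (hXP : ∀ᶠ x in 𝓝 m, fderiv ℝ P x (X x) = 1) :
    ∃ π, IsRetraction X P m π := by
  obtain ⟨Φ, h⟩ := exists_isLocalFlow hX
  let κ : E → ℝ × E := fun x => (P m - P x, x)
  have hκ : SmoothNear κ m := ((smoothNear_const (P m) m).sub hP).prodMk (smoothNear_id m)
  have hκm : κ m = (0, m) := by simp [κ]
  have hκt : Tendsto κ (𝓝 m) (𝓝 (0, m)) := hκm ▸ hκ.continuousAt
  have hπm : Φ (κ m) = m := by rw [hκm]; exact h.zero.self_of_nhds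
  have hPt : Tendsto P (𝓝 m) (𝓝 (P m)) := hP.continuousAt
  have hπ : SmoothNear (fun x => Φ (κ x)) m :=
    SmoothNear.comp (g := Φ) (f := κ) (hκm ▸ h.smooth) hκ
  have hflow := h.apply_eq_add hP hXP
  refine ⟨fun x => Φ (κ x), ⟨hπ, hπm, ?_, ?_, ?_, ?_, ?_, ?_⟩⟩
  · have hg : Tendsto (fun p : ℝ × E => ((P m - P p.2 - p.1, p.1, p.2) : ℝ × ℝ × E))
        (𝓝 (0, m)) (𝓝 (0, 0, m)) := by
      have h2 : Tendsto (fun p : ℝ × E => P m - P p.2 - p.1) (𝓝 (0, m)) (𝓝 (P m - P m - 0)) :=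
        ((tendsto_const_nhds.sub (hPt.comp (continuous_snd.tendsto (0, m)))).sub
          (continuous_fst.tendsto _))
      rw [sub_self, sub_zero] at h2
      exact h2.prodMk_nhds ((continuous_fst.tendsto _).prodMk_nhds (continuous_snd.tendsto _))
    -- After flowing for time `t` the remaining time is shorter by `t`, so the group property makes
    -- the retraction constant along the flow.
    have key : ∀ᶠ p in 𝓝 ((0, m) : ℝ × E), Φ (κ (Φ p)) = Φ (κ p.2) := by
      filter_upwards [hg.eventually (h.group hX), hflow] with p hp1 hp2
      simp only [κ, hp2, one_mul]
      rw [← sub_sub, hp1]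
      simp
    have hι : Tendsto (fun x : E => ((0 : ℝ), x)) (𝓝 m) (𝓝 (0, m)) :=
      (Continuous.prodMk_right (0 : ℝ)).tendsto m
    filter_upwards [hι.eventually (eventually_eventually_nhds.2 key), hπ,
      hι.eventually h.hasDerivAt, h.zero] with x h1 h2 h3 h4
    have hd := (h2.differentiableAt (by simp)).hasFDerivAt
    simp only [h4] at h3
    rw [← h4] at hd
    have hd2 := hd.comp_hasDerivAt (0 : ℝ) h3
    have hconst : (fun t : ℝ => Φ (κ (Φ (t, x)))) =ᶠ[𝓝 0] fun _ => Φ (κ x) :=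
      ((Continuous.prodMk_left x).tendsto (0 : ℝ)).eventually h1
    have := hd2.unique ((hasDerivAt_const (0 : ℝ) (Φ (κ x))).congr_of_eventuallyEq hconst)
    rwa [h4] at this
  · filter_upwards [hκt.eventually hflow] with x hx
    simp only [hx, κ, one_mul]
    ring
  · filter_upwards [h.zero] with x hx hPx
    simp [κ, hPx, hx]
  · filter_upwards [h.fderiv_zero, hκt.eventually h.smooth, hP] with x h1 h2 h3 hPx v
    have hκx : κ x = (0, x) := by simp [κ, hPx]
    have hdP := (h3.differentiableAt (by simp)).hasFDerivAt
    have hdκ : HasFDerivAt κ ((-(fderiv ℝ P x)).prod (ContinuousLinearMap.id ℝ E)) x :=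
      (hdP.const_sub (P m)).prodMk (hasFDerivAt_id x)
    have hd := (h2.differentiableAt (by simp)).hasFDerivAt.comp x hdκ
    have := hd.fderiv
    rw [show (fun x => Φ (κ x)) = Φ ∘ κ from rfl, this]
    simp only [hκx, ContinuousLinearMap.comp_apply, ContinuousLinearMap.prod_apply, h1,
      neg_apply, ContinuousLinearMap.id_apply, neg_smul]
    abel
  · intro u hu huX
    filter_upwards [hκt.eventually (h.apply_eq_add hu huX)] with x hx
    simp [hx, κ]
  · refine ⟨Φ, h.smooth, ?_⟩
    have hg : Tendsto (fun x : E => ((P x - P m, P m - P x, x) : ℝ × ℝ × E))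
        (𝓝 m) (𝓝 (0, 0, m)) := by
      refine Tendsto.prodMk_nhds ?_ hκt
      simpa using hPt.sub_const (P m)
    filter_upwards [hg.eventually (h.group hX), h.zero] with x hx hx0
    simp only [κ, hx]
    simp [hx0]

/-- Straightening of a vector field `X` that is transversal to a level of `h`: a function `w` with
`X w = 1` that vanishes on the level of `h`. -/
theorem exists_time_function [FiniteDimensional ℝ E] {X : E → E} {h : E → ℝ} {m : E}
    (hX : SmoothNear X m) (hh : SmoothNear h m) (hne : fderiv ℝ h m (X m) ≠ 0) :
    ∃ w : E → ℝ, SmoothNear w m ∧ w m = 0 ∧ (∀ᶠ x in 𝓝 m, fderiv ℝ w x (X x) = 1) ∧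
      ∀ᶠ x in 𝓝 m, w x = 0 → h x = h m ∧ ∀ v, fderiv ℝ h x v = 0 → fderiv ℝ w x v = 0 := by
  have : CompleteSpace E := FiniteDimensional.complete ℝ E
  obtain ⟨Φ, hΦ⟩ := exists_isLocalFlow hX
  let ν : ℝ × E → ℝ × E := fun p => (-p.1, p.2)
  have hν : ContDiff ℝ ∞ ν := contDiff_fst.neg.prodMk contDiff_snd
  have hν0 : ν (0, m) = (0, m) := by simp [ν]
  have hνt : Tendsto ν (𝓝 (0, m)) (𝓝 (0, m)) := by
    have := hν.continuous.tendsto (0, m)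
    rwa [hν0] at this
  -- With `T (τ, x) = (0, x)` the point reached from `x` at time `-τ` lies on the level of `h`. The
  -- derivative of the first component in `τ` is `-X h`, which is nonzero at `m`; the function `w`
  -- is the `τ` found by the inverse function theorem.
  let T : ℝ × E → ℝ × E := fun p => (h (Φ (ν p)) - h m, p.2)
  have hΦm : Φ (0, m) = m := hΦ.zero.self_of_nhds
  have hT1 : SmoothNear (fun p => h (Φ (ν p))) (0, m) := by
    refine SmoothNear.comp (g := h) (f := fun p => Φ (ν p)) ?_
      (SmoothNear.comp (g := Φ) (f := ν) ?_ (smoothNear_of_contDiff hν _))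
    · rw [hν0, hΦm]; exact hh
    · rw [hν0]; exact hΦ.smooth
  have hT : SmoothNear T (0, m) :=
    (hT1.sub (smoothNear_const _ _)).prodMk (smoothNear_of_contDiff contDiff_snd _)
  have hder : ∀ᶠ x in 𝓝 m, ∀ (τ : ℝ) (v : E),
      fderiv ℝ (fun p => h (Φ (ν p))) (0, x) (τ, v) =
        fderiv ℝ h x v - τ * fderiv ℝ h x (X x) := by
    have hι : Tendsto (fun x : E => ((0 : ℝ), x)) (𝓝 m) (𝓝 (0, m)) :=
      (Continuous.prodMk_right (0 : ℝ)).tendsto m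
    filter_upwards [hΦ.fderiv_zero, hι.eventually hΦ.smooth, hΦ.zero, hh] with x h1 h2 h3 h4 τ v
    have hdν : HasFDerivAt ν ((-(ContinuousLinearMap.fst ℝ ℝ E)).prod
        (ContinuousLinearMap.snd ℝ ℝ E)) (0, x) := hasFDerivAt_fst.neg.prodMk hasFDerivAt_snd
    have hνx : ν (0, x) = (0, x) := by simp [ν]
    have hdh := (h4.differentiableAt (by simp)).hasFDerivAt
    have hdΦ := (h2.differentiableAt (by simp)).hasFDerivAt
    rw [← hνx] at hdΦ
    have hd1 := hdΦ.comp _ hdν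
    have h5 : (Φ ∘ ν) (0, x) = x := by simp [hνx, h3]
    rw [← h5] at hdh
    have hd2 := (hdh.comp _ hd1).fderiv
    rw [show (fun p => h (Φ (ν p))) = h ∘ (Φ ∘ ν) from rfl, hd2, h5, hνx]
    simp only [ContinuousLinearMap.comp_apply, ContinuousLinearMap.prod_apply, h1,
      neg_apply, ContinuousLinearMap.coe_fst', ContinuousLinearMap.coe_snd',
      neg_smul, map_add, map_neg, map_smul, smul_eq_mul]
    ring
  set c := fderiv ℝ h m (X m) with hc
  let D := fderiv ℝ h m
  let T' : (ℝ × E) ≃L[ℝ] (ℝ × E) := ContinuousLinearEquiv.equivOfInverse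
    ((D.comp (ContinuousLinearMap.snd ℝ ℝ E) - c • ContinuousLinearMap.fst ℝ ℝ E).prod
      (ContinuousLinearMap.snd ℝ ℝ E))
    ((c⁻¹ • (D.comp (ContinuousLinearMap.snd ℝ ℝ E) - ContinuousLinearMap.fst ℝ ℝ E)).prod
      (ContinuousLinearMap.snd ℝ ℝ E))
    (fun p => by ext1 <;> simp [hne]) (fun p => by ext1 <;> simp [hne])
  have hT' : HasFDerivAt T (T' : (ℝ × E) →L[ℝ] ℝ × E) (0, m) := by
    have h1 := (hT1.differentiableAt.hasFDerivAt.sub_const (h m)).prodMk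
      (hasFDerivAt_snd (𝕜 := ℝ) (p := ((0, m) : ℝ × E)))
    refine h1.congr_fderiv ?_
    refine ContinuousLinearMap.ext fun ⟨τ, v⟩ => ?_
    have h2 := hder.self_of_nhds τ v
    refine Prod.ext ?_ ?_
    · simp only [ContinuousLinearMap.prod_apply, h2]
      simp [T', D, hc, mul_comm]
    · simp [T']
  obtain ⟨e, heT, hes, -, hsymm⟩ := hT.exists_openPartialHomeomorph T' hT'
  have hT0 : e (0, m) = (0, m) := by rw [heT]; simp [T, hν0, hΦm]
  have htarget : (0, m) ∈ e.target := hT0 ▸ e.map_source hes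
  have hsymm0 : e.symm (0, m) = (0, m) := by
    conv_lhs => rw [← hT0]
    exact e.left_inv hes
  let ι : E → ℝ × E := fun x => (0, x)
  have hι : ContDiff ℝ ∞ ι := contDiff_const.prodMk contDiff_id
  have hιt : Tendsto ι (𝓝 m) (𝓝 (0, m)) := hι.continuous.tendsto m
  let w : E → ℝ := fun x => (e.symm (ι x)).1
  have hw : SmoothNear w m := SmoothNear.comp_contDiff contDiff_fst
    (SmoothNear.comp (x := m) (f := ι) (smoothNear_of_contDiffOn hsymm e.open_target htarget)
      (smoothNear_of_contDiff hι _))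
  have hwm : w m = 0 := by simp only [w, ι, hsymm0]
  have hevt : ∀ᶠ x in 𝓝 m, ι x ∈ e.target :=
    hιt.eventually (e.open_target.mem_nhds htarget)
  have hsol : ∀ᶠ x in 𝓝 m, e.symm (ι x) = (w x, x) ∧ h (Φ (ν (w x, x))) = h m := by
    filter_upwards [hevt] with x hx
    have h1 := e.right_inv hx
    rw [heT] at h1
    have h2 : (e.symm (ι x)).2 = x := congrArg Prod.snd h1
    have h3 : e.symm (ι x) = (w x, x) := Prod.ext rfl h2
    refine ⟨h3, ?_⟩
    rw [h3] at h1
    exact sub_eq_zero.1 (congrArg Prod.fst h1)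
  have huniq : ∀ᶠ p in 𝓝 ((0, m) : ℝ × E), h (Φ (ν p)) = h m → w p.2 = p.1 := by
    filter_upwards [e.open_source.mem_nhds hes] with p hp hpz
    have h1 : e p = ι p.2 := by rw [heT]; simp [T, ι, hpz]
    simp only [w, ← h1, e.left_inv hp]
  refine ⟨w, hw, hwm, ?_, ?_⟩
  · have hwt : Tendsto w (𝓝 m) (𝓝 0) := hwm ▸ hw.continuousAt
    have hg1 : Tendsto (fun p : ℝ × E => ((-w p.2 - p.1, p.1, p.2) : ℝ × ℝ × E))
        (𝓝 (0, m)) (𝓝 (0, 0, m)) := by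
      have h2 := ((hwt.comp (continuous_snd.tendsto ((0, m) : ℝ × E))).neg).sub
        (continuous_fst.tendsto ((0, m) : ℝ × E))
      simp only [neg_zero, sub_zero] at h2
      exact h2.prodMk_nhds ((continuous_fst.tendsto _).prodMk_nhds (continuous_snd.tendsto _))
    have hg2 : Tendsto (fun p : ℝ × E => ((w p.2 + p.1, Φ p) : ℝ × E))
        (𝓝 (0, m)) (𝓝 (0, m)) := by
      have h2 := (hwt.comp (continuous_snd.tendsto ((0, m) : ℝ × E))).add
        (continuous_fst.tendsto ((0, m) : ℝ × E))
      simp only [add_zero] at h2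
      exact h2.prodMk_nhds hΦ.tendsto
    -- Flowing back from `Φ (t, x)` for time `w x + t` reaches the same point of the level as
    -- flowing back from `x` for time `w x`; uniqueness of the solution then gives the value of `w`.
    have key : ∀ᶠ p in 𝓝 ((0, m) : ℝ × E), w (Φ p) = w p.2 + p.1 := by
      filter_upwards [hg1.eventually (hΦ.group hX), hg2.eventually huniq,
        (continuous_snd.tendsto ((0, m) : ℝ × E)).eventually hsol] with p h1 h2 h3
      refine h2 ?_
      rw [← h3.2]
      simp only [ν] at h1 ⊢
      rw [neg_add, ← sub_eq_add_neg, h1]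
      simp
    have hιt : Tendsto (fun x : E => ((0 : ℝ), x)) (𝓝 m) (𝓝 (0, m)) :=
      (Continuous.prodMk_right (0 : ℝ)).tendsto m
    filter_upwards [hιt.eventually (eventually_eventually_nhds.2 key), hw,
      hιt.eventually hΦ.hasDerivAt, hΦ.zero] with x h1 h2 h3 h4
    have hd := (h2.differentiableAt (by simp)).hasFDerivAt
    simp only [h4] at h3
    rw [← h4] at hd
    have hd2 := hd.comp_hasDerivAt (0 : ℝ) h3
    have hconst : (fun t : ℝ => w (Φ (t, x))) =ᶠ[𝓝 0] fun t => w x + t :=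
      ((Continuous.prodMk_left x).tendsto (0 : ℝ)).eventually h1
    have := hd2.unique (((hasDerivAt_id (0 : ℝ)).const_add (w x)).congr_of_eventuallyEq hconst)
    rwa [h4] at this
  · have hne' : ∀ᶠ x in 𝓝 m, fderiv ℝ h x (X x) ≠ 0 :=
      (hh.smooth_fderiv.clm_apply hX).continuousAt.eventually_ne hne
    have hιt : Tendsto (fun x : E => ((0 : ℝ), x)) (𝓝 m) (𝓝 (0, m)) :=
      (Continuous.prodMk_right (0 : ℝ)).tendsto m
    filter_upwards [hsol, eventually_eventually_nhds.2 hsol, hΦ.zero, hne', hw, hder,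
      hιt.eventually hT1] with x h1 h2 h3 h4 h5 h6 h7 hwx
    constructor
    · have := h1.2
      simpa [hwx, ν, h3] using this
    -- Differentiating `h (Φ (-w, ·)) = h m` where `w = 0` gives `dh v = dw v * X h`, and `X h` is
    -- nonzero.
    · intro v hv
      have hdw := (h5.differentiableAt (by simp)).hasFDerivAt
      have hdκ := hdw.prodMk (hasFDerivAt_id (𝕜 := ℝ) x)
      have hdT := (h7.differentiableAt (by simp)).hasFDerivAt
      have hx0 : (w x, id x) = ((0 : ℝ), x) := by simp [hwx]
      rw [← hx0] at hdT
      have hd := hdT.comp (f := fun y => (w y, id y)) x hdκ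
      have hc0 : ((fun p => h (Φ (ν p))) ∘ fun y => (w y, id y)) =ᶠ[𝓝 x] fun _ => h m := by
        filter_upwards [h2] with y hy using hy.2
      have h8 := hd.unique ((hasFDerivAt_const (h m) x).congr_of_eventuallyEq hc0)
      have h9 := congrArg (fun L : E →L[ℝ] ℝ => L v) h8
      simp only [ContinuousLinearMap.comp_apply, ContinuousLinearMap.prod_apply, hx0, h6, hv,
        ContinuousLinearMap.id_apply, zero_apply, zero_sub, neg_eq_zero,
        mul_eq_zero] at h9
      exact h9.resolve_right h4

end Retraction

end PoissonGeom

end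

/-! ### Local Poisson geometry: brackets, retractions and conjugate functions. -/

noncomputable section

open scoped Manifold ContDiff Topology
open Filter Set

namespace PoissonGeom

universe u

section PoissonModel

variable {E : Type u} [NormedAddCommGroup E] [NormedSpace ℝ E]

/-- The bracket of two functions on a normed space defined by a tensor `E* → E`. -/
def sharpBracket (S : E → (E →L[ℝ] ℝ) →L[ℝ] E) (a b : E → ℝ) (x : E) : ℝ :=
  fderiv ℝ b x (S x (fderiv ℝ a x))

/-- A smooth Poisson structure on a normed space. -/
structure PoissonModel (E : Type u) [NormedAddCommGroup E] [NormedSpace ℝ E] where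
  /-- the Poisson tensor `E* → E` at a point -/
  sharp : E → (E →L[ℝ] ℝ) →L[ℝ] E
  smooth : ContDiff ℝ ∞ sharp
  skew : ∀ (x : E) (α β : E →L[ℝ] ℝ), β (sharp x α) = - α (sharp x β)
  jacobi : ∀ (x : E) (a b c : E → ℝ), SmoothNear a x → SmoothNear b x → SmoothNear c x →
    sharpBracket sharp a (sharpBracket sharp b c) x +
      sharpBracket sharp b (sharpBracket sharp c a) x +
      sharpBracket sharp c (sharpBracket sharp a b) x = 0

namespace PoissonModel

variable (D : PoissonModel E)

/-- The Poisson bracket. -/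
def br (a b : E → ℝ) (x : E) : ℝ := fderiv ℝ b x (D.sharp x (fderiv ℝ a x))

/-- The Hamiltonian vector field. -/
def ham (a : E → ℝ) (x : E) : E := D.sharp x (fderiv ℝ a x)

theorem br_eq (a b : E → ℝ) (x : E) : D.br a b x = fderiv ℝ b x (D.ham a x) := rfl

theorem br_skew (a b : E → ℝ) (x : E) : D.br a b x = - D.br b a x := D.skew _ _ _

theorem br_self (a : E → ℝ) (x : E) : D.br a a x = 0 := by
  have := D.br_skew a a x
  linarith

variable {D} {a b c : E → ℝ} {x : E}

theorem ham_smooth (ha : SmoothNear a x) : SmoothNear (D.ham a) x :=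
  (smoothNear_of_contDiff D.smooth x).clm_apply ha.smooth_fderiv

theorem br_smooth (ha : SmoothNear a x) (hb : SmoothNear b x) : SmoothNear (D.br a b) x :=
  hb.smooth_fderiv.clm_apply (ham_smooth ha)

theorem br_congr {a' b' : E → ℝ} (ha : a =ᶠ[𝓝 x] a') (hb : b =ᶠ[𝓝 x] b') :
    D.br a b x = D.br a' b' x := by
  simp only [br, ha.fderiv_eq, hb.fderiv_eq]

theorem br_eq_zero_of_const {c : ℝ} (hb : ∀ᶠ y in 𝓝 x, b y = c) : D.br a b x = 0 := by
  have : b =ᶠ[𝓝 x] fun _ => c := hb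
  rw [br_congr (EventuallyEq.refl _ a) this]
  simp [br]

/-- In this form the Jacobi identity says that `D.ham a` is a derivation of the bracket, so terms
with a locally constant inner bracket drop out. -/
theorem br_jacobi (ha : SmoothNear a x) (hb : SmoothNear b x) (hc : SmoothNear c x) :
    D.br a (D.br b c) x = D.br (D.br a b) c x + D.br b (D.br a c) x := by
  have h1 : D.br a (D.br b c) x + D.br b (D.br c a) x + D.br c (D.br a b) x = 0 :=
    D.jacobi x a b c ha hb hc
  have h2 : D.br b (D.br c a) x = - D.br b (D.br a c) x := by
    have : D.br c a = fun y => - D.br a c y := funext fun y => D.br_skew c a y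
    rw [this]
    simp only [br_eq D b, fderiv_fun_neg, neg_apply]
  rw [D.br_skew c] at h1
  linarith

theorem br_mul_right (hb : SmoothNear b x) (hc : SmoothNear c x) :
    D.br a (fun y => b y * c y) x = b x * D.br a c x + c x * D.br a b x := by
  simp only [br_eq, fderiv_fun_mul hb.differentiableAt hc.differentiableAt,
    add_apply, smul_apply, smul_eq_mul]

theorem br_mul_left (hb : SmoothNear b x) (hc : SmoothNear c x) :
    D.br (fun y => b y * c y) a x = b x * D.br c a x + c x * D.br b a x := by
  rw [D.br_skew, br_mul_right hb hc, D.br_skew c, D.br_skew b]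
  ring

theorem br_sub_right (hb : SmoothNear b x) (hc : SmoothNear c x) :
    D.br a (fun y => b y - c y) x = D.br a b x - D.br a c x := by
  simp only [br_eq, fderiv_fun_sub hb.differentiableAt hc.differentiableAt, sub_apply]

theorem br_sub_left (hb : SmoothNear b x) (hc : SmoothNear c x) :
    D.br (fun y => b y - c y) a x = D.br b a x - D.br c a x := by
  rw [D.br_skew, br_sub_right hb hc, D.br_skew b, D.br_skew c]
  ring

theorem br_neg_right : D.br a (fun y => - b y) x = - D.br a b x := by
  simp only [br_eq, fderiv_fun_neg, neg_apply]

theorem br_inv_right (hb : SmoothNear b x) (h0 : b x ≠ 0) :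
    D.br a (fun y => (b y)⁻¹) x = - (b x ^ 2)⁻¹ * D.br a b x := by
  have h : HasFDerivAt (fun y => (b y)⁻¹) ((-(b x ^ 2)⁻¹) • fderiv ℝ b x) x :=
    (hasDerivAt_inv h0).comp_hasFDerivAt x hb.differentiableAt.hasFDerivAt
  simp only [br_eq, h.fderiv, smul_apply, smul_eq_mul]

section Retraction

variable {Q P : E → ℝ} {m : E} {π : E → E}

theorem tendsto_retraction (h : IsRetraction (D.ham Q) P m π) : Tendsto π (𝓝 m) (𝓝 m) := by
  have := h.smooth.continuousAt
  rwa [ContinuousAt, h.base] at this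

theorem smooth_comp_retraction {F : Type*} [NormedAddCommGroup F] [NormedSpace ℝ F]
    (h : IsRetraction (D.ham Q) P m π) {u : E → F}
    (hu : SmoothNear u m) : SmoothNear (fun x => u (π x)) m :=
  SmoothNear.comp (g := u) (f := π) (h.base.symm ▸ hu) h.smooth

theorem br_comp_retraction (h : IsRetraction (D.ham Q) P m π) {u : E → ℝ}
    (hu : SmoothNear u m) : ∀ᶠ x in 𝓝 m, D.br Q (fun x => u (π x)) x = 0 := by
  filter_upwards [h.deriv_field, h.smooth, (tendsto_retraction h).eventually hu] with x h1 h2 h3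
  have := (h3.differentiableAt (by simp)).hasFDerivAt.comp x
    (h2.differentiableAt (by simp)).hasFDerivAt
  rw [br_eq, show (fun x => u (π x)) = u ∘ π from rfl, this.fderiv, ContinuousLinearMap.comp_apply, h1, map_zero]

/-- The derivative of `u ∘ π` on the hypersurface `P = P m`. -/
theorem fderiv_comp_retraction (h : IsRetraction (D.ham Q) P m π) {u : E → ℝ}
    (hu : SmoothNear u m) : ∀ᶠ x in 𝓝 m, P x = P m →
      fderiv ℝ (fun x => u (π x)) x = fderiv ℝ u x - D.br Q u x • fderiv ℝ P x := by
  filter_upwards [h.deriv_of_level, h.fixed, h.smooth, (tendsto_retraction h).eventually hu]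
    with x h1 h2 h3 h4 hx
  have := (h4.differentiableAt (by simp)).hasFDerivAt.comp x
    (h3.differentiableAt (by simp)).hasFDerivAt
  rw [show (fun x => u (π x)) = u ∘ π from rfl, this.fderiv, h2 hx]
  ext v
  simp only [ContinuousLinearMap.comp_apply, h1 hx, map_sub, map_smul, sub_apply, smul_apply,
    smul_eq_mul, br_eq]
  ring

/-- If `y` commutes with `P` and its bracket with `Q` is constant, then the Hamiltonian vector
field of `y` commutes with composition with the retraction along `Q`. -/
theorem br_comp_retraction_of_const (h : IsRetraction (D.ham Q) P m π) (hQ : SmoothNear Q m)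
    {y u : E → ℝ} (hy : SmoothNear y m) (hu : SmoothNear u m) {c : ℝ}
    (hyQ : ∀ᶠ x in 𝓝 m, D.br y Q x = c) (hyP : ∀ᶠ x in 𝓝 m, D.br y P x = 0) :
    ∀ᶠ x in 𝓝 m, D.br y (fun x => u (π x)) x = D.br y u (π x) := by
  have huπ := smooth_comp_retraction h hu
  -- By Jacobi the bracket `{y, u ∘ π}` is constant along `D.ham Q`, so it is determined on the
  -- level of `P`. There `d(u ∘ π)` differs from `du` by a multiple of `dP`, which vanishes on
  -- `D.ham y`.
  have hinv : ∀ᶠ x in 𝓝 m, D.br Q (D.br y (fun x => u (π x))) x = 0 := by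
    filter_upwards [hQ.eventually, hy.eventually, huπ.eventually,
      eventually_eventually_nhds.2 (br_comp_retraction h hu),
      eventually_eventually_nhds.2 hyQ] with x h1 h2 h3 h4 h5
    rw [br_jacobi h1 h2 h3, br_eq_zero_of_const h4, add_zero, D.br_skew]
    rw [br_eq_zero_of_const (c := -c), neg_zero]
    filter_upwards [h5] with z hz
    rw [D.br_skew, hz]
  filter_upwards [h.invariant _ (br_smooth hy huπ) hinv, h.level,
    (tendsto_retraction h).eventually (fderiv_comp_retraction h hu),
    (tendsto_retraction h).eventually hyP] with x h1 h2 h3 h4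
  rw [← h1, br_eq, h3 h2]
  simp only [sub_apply, smul_apply, smul_eq_mul, ← br_eq, h4]
  ring

/-- For functions that commute with `P`, composition with the retraction along `Q` preserves the
bracket. -/
theorem br_comp_comp_retraction (h : IsRetraction (D.ham Q) P m π) (hQ : SmoothNear Q m)
    {u w : E → ℝ} (hu : SmoothNear u m) (hw : SmoothNear w m)
    (huP : ∀ᶠ x in 𝓝 m, D.br u P x = 0) (hwP : ∀ᶠ x in 𝓝 m, D.br w P x = 0) :
    ∀ᶠ x in 𝓝 m, D.br (fun x => u (π x)) (fun x => w (π x)) x = D.br u w (π x) := by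
  have huπ := smooth_comp_retraction h hu
  have hwπ := smooth_comp_retraction h hw
  have hinv : ∀ᶠ x in 𝓝 m, D.br Q (D.br (fun x => u (π x)) (fun x => w (π x))) x = 0 := by
    filter_upwards [hQ.eventually, huπ.eventually, hwπ.eventually,
      eventually_eventually_nhds.2 (br_comp_retraction h hu),
      eventually_eventually_nhds.2 (br_comp_retraction h hw)] with x h1 h2 h3 h4 h5
    rw [br_jacobi h1 h2 h3, br_eq_zero_of_const h5, add_zero, D.br_skew, br_eq_zero_of_const h4,
      neg_zero]
  filter_upwards [h.invariant _ (br_smooth huπ hwπ) hinv, h.level,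
    (tendsto_retraction h).eventually (fderiv_comp_retraction h hu),
    (tendsto_retraction h).eventually (fderiv_comp_retraction h hw),
    (tendsto_retraction h).eventually huP, (tendsto_retraction h).eventually hwP]
    with x h1 h2 h3 h4 h5 h6
  rw [← h1, br, h3 h2, h4 h2]
  -- On the level, the differentials of `u ∘ π` and `w ∘ π` differ from `du` and `dw` by multiples
  -- of `dP`. These contribute only brackets of `P` with `u`, `w` or itself, which all vanish.
  have h7 := D.br_self P (π x)
  have h8 := D.br_skew w P (π x)
  rw [h6] at h8
  simp only [br] at h5 h7 h8 ⊢
  simp only [sub_apply, smul_apply, smul_eq_mul, map_sub, map_smul, h5, h7]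
  linear_combination -(fderiv ℝ u (π x)) ((D.sharp (π x)) (fderiv ℝ Q (π x))) * h8

/-- Correction of a function `h` to a function that commutes with the functions `a i`, where the
`a i` are conjugate to functions `u i`. -/
theorem exists_commuting_correction [FiniteDimensional ℝ E] {ι : Type*} [DecidableEq ι]
    (s : Finset ι) (a u : ι → E → ℝ) (ha : ∀ i ∈ s, SmoothNear (a i) m)
    (hu : ∀ i ∈ s, SmoothNear (u i) m)
    (hau : ∀ i ∈ s, ∀ j ∈ s, ∀ᶠ x in 𝓝 m, D.br (a i) (u j) x = if i = j then 1 else 0)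
    (haa : ∀ i ∈ s, ∀ j ∈ s, ∃ c, ∀ᶠ x in 𝓝 m, D.br (a i) (a j) x = c)
    (C : (E → ℝ) → Prop) (hC : ∀ i ∈ s, ∀ π, IsRetraction (D.ham (a i)) (u i) m π →
      ∀ h, C h → C (fun x => h (π x)))
    (h : E → ℝ) (hh : SmoothNear h m) (hCh : C h) (h0 : ∀ i ∈ s, D.br (a i) h m = 0) :
    ∃ k : E → ℝ, C k ∧ SmoothNear k m ∧ (∀ i ∈ s, ∀ᶠ x in 𝓝 m, D.br (a i) k x = 0) ∧
      fderiv ℝ k m = fderiv ℝ h m ∧ k m = h m := by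
  -- The commuting relations are obtained one by one, composing each time with the retraction along
  -- `a j` onto a level of `u j`. Earlier relations survive because `{a i, a j}` is constant and `{a
  -- i, u j} = 0`; the predicate `C` carries along any property stable under these retractions.
  suffices H : ∀ t : Finset ι, t ⊆ s → ∃ k : E → ℝ, C k ∧ SmoothNear k m ∧
      (∀ i ∈ t, ∀ᶠ x in 𝓝 m, D.br (a i) k x = 0) ∧ fderiv ℝ k m = fderiv ℝ h m ∧ k m = h m from
    H s subset_rfl
  intro t
  induction t using Finset.induction_on with
  | empty => exact fun _ => ⟨h, hCh, hh, by simp, rfl, rfl⟩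
  | insert j t hj ih =>
    intro hjt
    have hjs : j ∈ s := hjt (Finset.mem_insert_self _ _)
    obtain ⟨k, hCk, hk, hkt, hdk, hkm⟩ := ih fun i hi => hjt (Finset.mem_insert_of_mem hi)
    obtain ⟨π, hπ⟩ := exists_isRetraction (ham_smooth (D := D) (ha j hjs)) (hu j hjs)
      (by filter_upwards [hau j hjs j hjs] with x hx; simpa [br_eq] using hx)
    refine ⟨fun x => k (π x), hC j hjs π hπ k hCk, smooth_comp_retraction hπ hk, ?_, ?_, ?_⟩
    · intro i hi
      rcases Finset.mem_insert.1 hi with rfl | hi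
      · exact br_comp_retraction hπ hk
      · have his : i ∈ s := hjt (Finset.mem_insert_of_mem hi)
        obtain ⟨c, hc⟩ := haa i his j hjs
        have hij : i ≠ j := fun hij => hj (hij ▸ hi)
        have hu0 := hau i his j hjs
        simp only [hij, if_false] at hu0
        filter_upwards [br_comp_retraction_of_const hπ (ha j hjs) (ha i his) hk hc hu0,
          (tendsto_retraction hπ).eventually (hkt i hi)] with x h1 h2
        rw [h1, h2]
    -- The retraction changes the differential at `m` by a multiple of `{a j, k}(m)`, which is zero.
    · rw [(fderiv_comp_retraction hπ hk).self_of_nhds rfl, hdk]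
      have : D.br (a j) k m = 0 := by rw [br, hdk]; exact h0 j hjs
      rw [this, zero_smul, sub_zero]
    · simp only [hπ.base, hkm]

/-- Functions with pairwise constant brackets and independent Hamiltonian vector fields have
conjugate functions. -/
theorem exists_dual_functions [FiniteDimensional ℝ E] {ι : Type*} [DecidableEq ι]
    (s : Finset ι) (a : ι → E → ℝ) (ha : ∀ i, SmoothNear (a i) m)
    (haa : ∀ i j, ∃ c, ∀ᶠ x in 𝓝 m, D.br (a i) (a j) x = c)
    (hind : LinearIndependent ℝ fun i => D.ham (a i) m) :
    ∃ u : ι → E → ℝ, (∀ i ∈ s, SmoothNear (u i) m) ∧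
      ∀ i ∈ s, ∀ j ∈ s, ∀ᶠ x in 𝓝 m, D.br (a i) (u j) x = if i = j then 1 else 0 := by
  induction s using Finset.induction_on with
  | empty => exact ⟨fun _ _ => 0, by simp, by simp⟩
  | insert k s hk ih =>
    obtain ⟨u, hu, hau⟩ := ih
    -- The candidate for the new dual function starts from a linear functional that has the right
    -- values at `m`.
    obtain ⟨L, hLs, hLk⟩ : ∃ L : E →L[ℝ] ℝ, (∀ i ∈ s, L (D.ham (a i) m) = 0) ∧
        L (D.ham (a k) m) = 1 := by
      have hnot : D.ham (a k) m ∉ Submodule.span ℝ ((fun i => D.ham (a i) m) '' s) :=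
        hind.notMem_span_image (by simpa using hk)
      obtain ⟨f, hf, hf0⟩ := Submodule.exists_le_ker_of_notMem hnot
      refine ⟨(f (D.ham (a k) m))⁻¹ • LinearMap.toContinuousLinearMap f, fun i hi => ?_, ?_⟩
      · have : f (D.ham (a i) m) = 0 :=
          hf0 (Submodule.subset_span ⟨i, by simpa using hi, rfl⟩)
        simp [this]
      · simp [hf]
    obtain ⟨h, -, hh, hah, hdh, -⟩ := exists_commuting_correction (D := D) s a u
      (fun i _ => ha i) hu hau (fun i _ j _ => haa i j) (fun _ => True) (fun _ _ _ _ _ _ => trivial)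
      L (smoothNear_of_contDiff L.contDiff m) trivial
      (fun i hi => by rw [br_eq, ContinuousLinearMap.fderiv]; exact hLs i hi)
    rw [ContinuousLinearMap.fderiv] at hdh
    -- The corrected `h` commutes with the earlier `a i`, but its bracket with `a k` equals 1 only
    -- at `m`. The time function along `D.ham (a k)`, measured from the level of `h`, has bracket 1
    -- throughout.
    obtain ⟨w, hw, hwm, hkw, hwh⟩ := exists_time_function (ham_smooth (D := D) (ha k)) hh
      (by rw [hdh, hLk]; exact one_ne_zero)
    obtain ⟨π, hπ⟩ := exists_isRetraction (ham_smooth (D := D) (ha k)) hw hkw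
    have hkw' : ∀ᶠ x in 𝓝 m, D.br (a k) w x = 1 := hkw
    -- By Jacobi this bracket is constant along `D.ham (a k)`, so it suffices to look at the level
    -- `w = 0`. There `D.ham (a i)` annihilates `h`, hence also `w`.
    have hiw : ∀ i ∈ s, ∀ᶠ x in 𝓝 m, D.br (a i) w x = 0 := by
      intro i hi
      obtain ⟨c, hc⟩ := haa i k
      have hinv : ∀ᶠ x in 𝓝 m, D.br (a k) (D.br (a i) w) x = 0 := by
        filter_upwards [(ha k).eventually, (ha i).eventually, hw.eventually,
          eventually_eventually_nhds.2 hkw', eventually_eventually_nhds.2 hc] with x h1 h2 h3 h4 h5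
        rw [br_jacobi h1 h2 h3, br_eq_zero_of_const h4, add_zero, D.br_skew]
        rw [br_eq_zero_of_const (c := -c), neg_zero]
        filter_upwards [h5] with z hz
        rw [D.br_skew, hz]
      filter_upwards [hπ.invariant _ (br_smooth (ha i) hw) hinv, hπ.level,
        (tendsto_retraction hπ).eventually hwh,
        (tendsto_retraction hπ).eventually (hah i hi)] with x h1 h2 h3 h4
      rw [← h1]
      exact (h3 (h2.trans hwm)).2 _ h4
    -- The earlier dual functions are composed with the retraction along `a k`, which makes them
    -- commute with `a k` and keeps their brackets with the other `a i`.
    refine ⟨fun j => if j = k then w else fun x => u j (π x), fun i hi => ?_, fun i hi j hj => ?_⟩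
    · by_cases hik : i = k
      · simpa [hik] using hw
      · simp only [hik, if_false]
        exact smooth_comp_retraction hπ (hu i (Finset.mem_of_mem_insert_of_ne hi hik))
    · by_cases hjk : j = k
      · simp only [hjk, if_true]
        by_cases hik : i = k
        · simpa [hik, br_eq] using hkw
        · simpa [hik] using hiw i (Finset.mem_of_mem_insert_of_ne hi hik)
      · have hjs := Finset.mem_of_mem_insert_of_ne hj hjk
        simp only [hjk, if_false]
        by_cases hik : i = k
        · subst hik
          simpa [Ne.symm hjk] using br_comp_retraction hπ (hu j hjs)
        · have his := Finset.mem_of_mem_insert_of_ne hi hik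
          obtain ⟨c, hc⟩ := haa i k
          filter_upwards [br_comp_retraction_of_const hπ (ha k) (ha i) (hu j hjs) hc (hiw i his),
            (tendsto_retraction hπ).eventually (hau i his j hjs)] with x h1 h2
          rw [h1, h2]

end Retraction

end PoissonModel

end PoissonModel

end PoissonGeom

end

/-! ### Basic functions and fields that preserve the foliation. -/

noncomputable section

open scoped Manifold ContDiff Topology
open Filter Set

namespace PoissonGeom

universe u

theorem fderiv_pi_apply {E : Type*} [NormedAddCommGroup E] [NormedSpace ℝ E] {κ : Type*}
    [Fintype κ] {b : E → κ → ℝ} {x : E} (hb : DifferentiableAt ℝ b x) (v : E) (i : κ) :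
    fderiv ℝ b x v i = fderiv ℝ (fun y => b y i) x v := by
  rw [(hasFDerivAt_pi'.1 hb.hasFDerivAt i).fderiv]
  rfl

/-- A smooth Poisson structure on a normed space with an integrable system, i.e. with a submersion
whose components are in involution. -/
structure FoliatedModel (E : Type u) [NormedAddCommGroup E] [NormedSpace ℝ E] (ι : Type)
    [Fintype ι] extends PoissonModel E where
  /-- the submersion -/
  F : E → ι → ℝ
  smooth_F : ContDiff ℝ ∞ F
  surj : ∀ x, Function.Surjective (fderiv ℝ F x)
  invol : ∀ i j x, toPoissonModel.br (fun y => F y i) (fun y => F y j) x = 0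

namespace FoliatedModel

variable {E : Type u} [NormedAddCommGroup E] [NormedSpace ℝ E] {ι : Type} [Fintype ι]
  (D : FoliatedModel E ι)
  {V W : Type*} [NormedAddCommGroup V] [NormedSpace ℝ V] [NormedAddCommGroup W] [NormedSpace ℝ W]

/-- `b` is smooth and locally constant along the leaves near `x`. -/
def IsBasic (b : E → W) (x : E) : Prop :=
  SmoothNear b x ∧ ∀ᶠ y in 𝓝 x, ∀ v, fderiv ℝ D.F y v = 0 → fderiv ℝ b y v = 0

variable {D} {x m : E}

theorem IsBasic.eventually {b : E → W} (h : D.IsBasic b x) : ∀ᶠ y in 𝓝 x, D.IsBasic b y := by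
  filter_upwards [h.1.eventually, eventually_eventually_nhds.2 h.2] with y h1 h2 using ⟨h1, h2⟩

theorem IsBasic.congr {b b' : E → W} (h : D.IsBasic b x) (hb : b' =ᶠ[𝓝 x] b) :
    D.IsBasic b' x := by
  refine ⟨h.1.congr hb, ?_⟩
  filter_upwards [h.2, eventually_eventually_nhds.2 hb] with y h1 h2 v hv
  rw [Filter.EventuallyEq.fderiv_eq h2]
  exact h1 v hv

theorem IsBasic.comp {b : E → V} {g : V → W} (hg : SmoothNear g (b x)) (hb : D.IsBasic b x) :
    D.IsBasic (fun y => g (b y)) x := by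
  refine ⟨SmoothNear.comp (g := g) (f := b) hg hb.1, ?_⟩
  filter_upwards [hb.1, hb.2, hb.1.continuousAt.eventually hg] with y h1 h2 h3 v hv
  have := (h3.differentiableAt (by simp)).hasFDerivAt.comp y
    (h1.differentiableAt (by simp)).hasFDerivAt
  rw [show (fun y => g (b y)) = g ∘ b from rfl, this.fderiv, ContinuousLinearMap.comp_apply,
    h2 v hv, map_zero]

theorem IsBasic.prodMk {b : E → V} {c : E → W} (hb : D.IsBasic b x) (hc : D.IsBasic c x) :
    D.IsBasic (fun y => (b y, c y)) x := by
  refine ⟨hb.1.prodMk hc.1, ?_⟩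
  filter_upwards [hb.1, hb.2, hc.1, hc.2] with y h1 h2 h3 h4 v hv
  rw [((h1.differentiableAt (by simp)).hasFDerivAt.prodMk
    (h3.differentiableAt (by simp)).hasFDerivAt).fderiv]
  simp [h2 v hv, h4 v hv]

theorem isBasic_const (c : W) : D.IsBasic (fun _ => c) x :=
  ⟨smoothNear_const c x, Eventually.of_forall fun y v _ => by simp⟩

theorem IsBasic.mul {b c : E → ℝ} (hb : D.IsBasic b x) (hc : D.IsBasic c x) :
    D.IsBasic (fun y => b y * c y) x :=
  IsBasic.comp (g := fun p : ℝ × ℝ => p.1 * p.2)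
    (smoothNear_of_contDiff (contDiff_fst.mul contDiff_snd) _) (hb.prodMk hc)

theorem IsBasic.sub {b c : E → ℝ} (hb : D.IsBasic b x) (hc : D.IsBasic c x) :
    D.IsBasic (fun y => b y - c y) x :=
  IsBasic.comp (g := fun p : ℝ × ℝ => p.1 - p.2)
    (smoothNear_of_contDiff (contDiff_fst.sub contDiff_snd) _) (hb.prodMk hc)

theorem IsBasic.inv {b : E → ℝ} (hb : D.IsBasic b x) (h0 : b x ≠ 0) :
    D.IsBasic (fun y => (b y)⁻¹) x :=
  IsBasic.comp (g := fun t : ℝ => t⁻¹) ((smoothNear_id _).inv h0) hb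

theorem isBasic_pi {κ : Type*} [Fintype κ] {b : E → κ → ℝ} :
    D.IsBasic b x ↔ ∀ i, D.IsBasic (fun y => b y i) x := by
  constructor
  · exact fun h i => IsBasic.comp (g := fun z : κ → ℝ => z i)
      (smoothNear_of_contDiff (contDiff_apply ℝ ℝ i) _) h
  · intro h
    refine ⟨smoothNear_pi.2 fun i => (h i).1, ?_⟩
    filter_upwards [eventually_all.2 fun i => (h i).1, eventually_all.2 fun i => (h i).2]
      with y h1 h2 v hv
    ext i
    rw [fderiv_pi_apply (differentiableAt_pi.2 fun i => (h1 i).differentiableAt (by simp))]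
    exact h2 i v hv

theorem isBasic_F : D.IsBasic D.F x :=
  ⟨smoothNear_of_contDiff D.smooth_F x, Eventually.of_forall fun _ _ h => h⟩

theorem isBasic_F_apply (i : ι) : D.IsBasic (fun y => D.F y i) x := isBasic_pi.1 isBasic_F i

/-- A basic function is locally a smooth function of the integrable system. -/
theorem IsBasic.exists_factor [FiniteDimensional ℝ E] {b : E → W} (h : D.IsBasic b x) :
    ∃ β : (ι → ℝ) → W, SmoothNear β (D.F x) ∧ ∀ᶠ y in 𝓝 x, b y = β (D.F y) := by
  have : CompleteSpace E := FiniteDimensional.complete ℝ E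
  let L := fderiv ℝ D.F x
  let N := LinearMap.ker (L : E →ₗ[ℝ] ι → ℝ)
  obtain ⟨R, hR⟩ : ∃ R : E →L[ℝ] N, ∀ v : N, R v = v := by
    obtain ⟨f, hf⟩ := N.exists_isCompl
    exact ⟨LinearMap.toContinuousLinearMap (N.projectionOnto f hf),
      fun v => Submodule.projectionOnto_apply_left hf v⟩
  have : CompleteSpace N := FiniteDimensional.complete ℝ N
  have hinj : LinearMap.ker (L.prod R : E →ₗ[ℝ] (ι → ℝ) × N) = ⊥ := by
    rw [LinearMap.ker_eq_bot']
    intro v hv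
    have h1 : L v = 0 := congrArg Prod.fst hv
    have h2 : R v = 0 := congrArg Prod.snd hv
    have h3 := hR ⟨v, h1⟩
    rw [h2] at h3
    exact (congrArg Subtype.val h3).symm
  have hsurj : LinearMap.range (L.prod R : E →ₗ[ℝ] (ι → ℝ) × N) = ⊤ := by
    rw [LinearMap.range_eq_top]
    rintro ⟨z, k⟩
    obtain ⟨v, hv⟩ := D.surj x z
    refine ⟨v - R v + k, ?_⟩
    have h1 : ∀ w : N, L w = 0 := fun w => w.2
    refine Prod.ext ?_ ?_
    · simp [h1, L, hv]
    · simp [hR]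
  let T' : E ≃L[ℝ] (ι → ℝ) × N := ContinuousLinearEquiv.ofBijective (L.prod R) hinj hsurj
  -- Together with a projection onto the kernel of `dF`, the submersion `F` becomes a local
  -- diffeomorphism.
  let T : E → (ι → ℝ) × N := fun y => (D.F y, R y)
  have hT : ContDiff ℝ ∞ T := D.smooth_F.prodMk R.contDiff
  have hT' : HasFDerivAt T (T' : E →L[ℝ] (ι → ℝ) × N) x := by
    have := ((D.smooth_F.differentiable (by simp)) x).hasFDerivAt.prodMk (R.hasFDerivAt (x := x))
    exact this
  obtain ⟨e, heT, hes, -, hsymm⟩ :=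
    (smoothNear_of_contDiff hT x).exists_openPartialHomeomorph T' hT'
  have hex : e x = (D.F x, R x) := heT x
  have htarget : (D.F x, R x) ∈ e.target := hex ▸ e.map_source hes
  have hsx : e.symm (D.F x, R x) = x := by rw [← hex, e.left_inv hes]
  have hct : Tendsto e.symm (𝓝 (D.F x, R x)) (𝓝 x) := by
    have := (e.continuousAt_symm htarget)
    rwa [ContinuousAt, hsx] at this
  have hsm := smoothNear_of_contDiffOn hsymm e.open_target htarget
  obtain ⟨ε, hε, hball⟩ := Metric.eventually_nhds_iff_ball.1
    ((e.open_target.eventually_mem htarget).and (hsm.and ((hct.eventually h.1).and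
      (hct.eventually h.2))))
  -- In the coordinates `(z, k)` a change of `k` moves along a leaf, so `b` does not depend on `k`.
  have hconst : ∀ z ∈ Metric.ball (D.F x) ε, ∀ k ∈ Metric.ball (R x) ε,
      b (e.symm (z, k)) = b (e.symm (z, R x)) := by
    intro z hz k hk
    have hder : ∀ k ∈ Metric.ball (R x) ε, HasFDerivWithinAt (fun k => b (e.symm (z, k)))
        (0 : N →L[ℝ] W) (Metric.ball (R x) ε) k := by
      intro k hk
      have hzk : (z, k) ∈ Metric.ball (D.F x, R x) ε := by
        rw [← ball_prod_same]; exact ⟨hz, hk⟩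
      obtain ⟨h1, h2, h3, h4⟩ := hball _ hzk
      have hd1 := (h2.differentiableAt (by simp)).hasFDerivAt
      have hd2 := hd1.comp k ((hasFDerivAt_const z k).prodMk (hasFDerivAt_id k))
      have hd3 := (h3.differentiableAt (by simp)).hasFDerivAt.comp k hd2
      refine (hd3.congr_fderiv ?_).hasFDerivWithinAt
      ext κ
      simp only [ContinuousLinearMap.comp_apply, ContinuousLinearMap.prod_apply, zero_apply,
        ContinuousLinearMap.id_apply]
      apply h4
      have hd4 := ((D.smooth_F.differentiable (by simp)) (e.symm (z, k))).hasFDerivAt.comp k hd2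
      have hev : (D.F ∘ (e.symm ∘ fun k => (z, id k))) =ᶠ[𝓝 k] fun _ => z := by
        have hop : ∀ᶠ k' in 𝓝 k, (z, k') ∈ e.target :=
          (Continuous.prodMk_right z).continuousAt.eventually (e.open_target.mem_nhds h1)
        filter_upwards [hop] with k' hk'
        have := e.right_inv hk'
        rw [heT] at this
        exact congrArg Prod.fst this
      have h5 := hd4.unique ((hasFDerivAt_const z k).congr_of_eventuallyEq hev)
      simpa using congrArg (fun L : N →L[ℝ] ι → ℝ => L κ) h5
    have := (convex_ball (R x) ε).norm_image_sub_le_of_norm_hasFDerivWithin_le (C := 0) hder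
      (fun _ _ => by simp) (Metric.mem_ball_self hε) hk
    rw [zero_mul, norm_le_zero_iff, sub_eq_zero] at this
    exact this
  refine ⟨fun z => b (e.symm (z, R x)), ?_, ?_⟩
  · refine SmoothNear.comp (g := b) (f := fun z => e.symm (z, R x)) ?_
      (SmoothNear.comp (g := e.symm) (f := fun z => (z, R x)) hsm
        (smoothNear_of_contDiff (contDiff_id.prodMk contDiff_const) _))
    rw [hsx]
    exact h.1
  · have hTc : Tendsto T (𝓝 x) (𝓝 (D.F x, R x)) := hT.continuous.tendsto x
    filter_upwards [hTc.eventually (Metric.ball_mem_nhds _ hε), e.open_source.mem_nhds hes]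
      with y hy hys
    rw [← Metric.mem_ball, ← ball_prod_same] at hy
    rw [← hconst _ hy.1 _ hy.2, show (D.F y, R y) = e y from (heT y).symm, e.left_inv hys]

/-- By involution the Hamiltonian vectors of the components of `F` are tangent to the leaves.
Skewness moves the general covector `ℓ ∘ dF` into the other slot, where this applies. -/
theorem fderiv_F_sharp (x : E) (ℓ : (ι → ℝ) →L[ℝ] ℝ) :
    fderiv ℝ D.F x (D.sharp x (ℓ.comp (fderiv ℝ D.F x))) = 0 := by
  have hd := (D.smooth_F.differentiable (by simp)) x
  have hcomp : ∀ i, fderiv ℝ (fun y => D.F y i) x =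
      (ContinuousLinearMap.proj i).comp (fderiv ℝ D.F x) := fun i => by
    ext v
    rw [← fderiv_pi_apply hd]
    rfl
  have h1 : ∀ i, fderiv ℝ D.F x (D.sharp x (fderiv ℝ (fun y => D.F y i) x)) = 0 := by
    intro i
    ext j
    have := D.invol i j x
    rw [PoissonModel.br, hcomp j] at this
    exact this
  ext i
  have h2 := D.skew x (ℓ.comp (fderiv ℝ D.F x)) (fderiv ℝ (fun y => D.F y i) x)
  rw [ContinuousLinearMap.comp_apply, h1 i, map_zero, neg_zero, hcomp i] at h2
  exact h2

theorem IsBasic.exists_fderiv [FiniteDimensional ℝ E] {b : E → ℝ} (h : D.IsBasic b x) :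
    ∃ ℓ : (ι → ℝ) →L[ℝ] ℝ, fderiv ℝ b x = ℓ.comp (fderiv ℝ D.F x) := by
  obtain ⟨β, hβ, hb⟩ := h.exists_factor
  refine ⟨fderiv ℝ β (D.F x), ?_⟩
  rw [Filter.EventuallyEq.fderiv_eq (f := fun y => β (D.F y)) hb]
  exact (hβ.differentiableAt.hasFDerivAt.comp x
    ((D.smooth_F.differentiable (by simp)) x).hasFDerivAt).fderiv

/-- Basic functions are in involution. -/
theorem IsBasic.br_eq_zero [FiniteDimensional ℝ E] {b c : E → ℝ} (hb : D.IsBasic b x)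
    (hc : D.IsBasic c x) : D.br b c x = 0 := by
  obtain ⟨ℓ, hℓ⟩ := hb.exists_fderiv
  obtain ⟨ℓ', hℓ'⟩ := hc.exists_fderiv
  rw [PoissonModel.br, hℓ, hℓ', ContinuousLinearMap.comp_apply, fderiv_F_sharp, map_zero]

variable (D) in
/-- The Hamiltonian vector field of `q` preserves, infinitesimally at `x`, the foliation. -/
def PreservesBasic (q : E → ℝ) (x : E) : Prop :=
  ∀ b : E → ℝ, D.IsBasic b x → ∀ v, fderiv ℝ D.F x v = 0 → fderiv ℝ (D.br q b) x v = 0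

theorem isBasic_br {q b : E → ℝ} (hq : SmoothNear q m) (hqB : ∀ᶠ x in 𝓝 m, D.PreservesBasic q x)
    (hb : D.IsBasic b m) : D.IsBasic (D.br q b) m := by
  refine ⟨PoissonModel.br_smooth hq hb.1, ?_⟩
  filter_upwards [hqB, hb.eventually] with x h1 h2 using h1 b h2

theorem fderiv_F_apply (x v : E) (i : ι) :
    fderiv ℝ D.F x v i = fderiv ℝ (fun y => D.F y i) x v :=
  fderiv_pi_apply ((D.smooth_F.differentiable (by simp)) x) v i

/-- If `b = β ∘ F`, then `{q, b}` is `dβ(F)` applied to the vector of brackets `{q, F i}`. Both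
factors have zero derivative along the leaf at `x`, so testing the components of `F` suffices. -/
theorem preservesBasic_of_forall [FiniteDimensional ℝ E] {q : E → ℝ} (hq : SmoothNear q x)
    (h : ∀ i v, fderiv ℝ D.F x v = 0 → fderiv ℝ (D.br q (fun y => D.F y i)) x v = 0) :
    D.PreservesBasic q x := by
  intro b hb v hv
  obtain ⟨β, hβ, hbβ⟩ := hb.exists_factor
  let w : E → ι → ℝ := fun y => fderiv ℝ D.F y (D.ham q y)
  have hF := smoothNear_of_contDiff D.smooth_F x
  have hw : SmoothNear w x := hF.smooth_fderiv.clm_apply (PoissonModel.ham_smooth hq)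
  have hwv : fderiv ℝ w x v = 0 := by
    ext i
    rw [fderiv_pi_apply hw.differentiableAt]
    rw [show (fun y => w y i) = D.br q (fun y => D.F y i) from
      funext fun y => fderiv_F_apply y _ i]
    exact h i v hv
  have hβF : SmoothNear (fun y => fderiv ℝ β (D.F y)) x :=
    SmoothNear.comp (g := fderiv ℝ β) (f := D.F) hβ.smooth_fderiv hF
  have hev : D.br q b =ᶠ[𝓝 x] fun y => fderiv ℝ β (D.F y) (w y) := by
    filter_upwards [eventually_eventually_nhds.2 hbβ, hF.continuousAt.eventually hβ]
      with y h1 h2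
    rw [PoissonModel.br_eq, Filter.EventuallyEq.fderiv_eq (f := fun y => β (D.F y)) h1]
    have := (h2.differentiableAt (by simp)).hasFDerivAt.comp y
      ((D.smooth_F.differentiable (by simp)) y).hasFDerivAt
    rw [show (fun y => β (D.F y)) = β ∘ D.F from rfl, this.fderiv]
    rfl
  rw [hev.fderiv_eq, (hβF.differentiableAt.hasFDerivAt.clm_apply
    hw.differentiableAt.hasFDerivAt).fderiv]
  have hβv : fderiv ℝ (fun y => fderiv ℝ β (D.F y)) x v = 0 := by
    have := hβ.smooth_fderiv.differentiableAt.hasFDerivAt.comp x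
      ((D.smooth_F.differentiable (by simp)) x).hasFDerivAt
    rw [show (fun y => fderiv ℝ β (D.F y)) = fderiv ℝ β ∘ D.F from rfl, this.fderiv,
      ContinuousLinearMap.comp_apply, hv, map_zero]
  simp [hwv, hβv]

section Retraction

variable [FiniteDimensional ℝ E] {Q P : E → ℝ} {π : E → E}

/-- A submersion is open; this transports statements that hold near `m` to the local leaf space. -/
theorem map_nhds_F (x : E) : map D.F (𝓝 x) = 𝓝 (D.F x) := by
  have : CompleteSpace E := FiniteDimensional.complete ℝ E
  exact (D.smooth_F.contDiffAt.hasStrictFDerivAt (by simp)).map_nhds_eq_of_surj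
    (LinearMap.range_eq_top.2 (D.surj x))

/-- A retraction along a Hamiltonian vector field that preserves the foliation induces a retraction
of the local leaf space. -/
theorem exists_leaf_retraction (h : IsRetraction (D.ham Q) P m π) (hQ : SmoothNear Q m)
    (hQB : ∀ᶠ x in 𝓝 m, D.PreservesBasic Q x) (hP : D.IsBasic P m)
    (hQP : ∀ᶠ x in 𝓝 m, D.br Q P x = 1) :
    ∃ (Y : (ι → ℝ) → ι → ℝ) (β : (ι → ℝ) → ℝ) (ρ : (ι → ℝ) → ι → ℝ),
      IsRetraction Y β (D.F m) ρ ∧ (∀ᶠ x in 𝓝 m, P x = β (D.F x)) ∧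
      ∀ᶠ x in 𝓝 m, D.F (π x) = ρ (D.F x) := by
  -- The brackets `{Q, F i}` are basic, so the Hamiltonian field of `Q` descends to a field on the
  -- leaf space. The function `P` descends to `β`, and the relation `{Q, P} = 1` descends as well.
  have hY : ∀ i, ∃ Yi : (ι → ℝ) → ℝ, SmoothNear Yi (D.F m) ∧
      ∀ᶠ x in 𝓝 m, D.br Q (fun y => D.F y i) x = Yi (D.F x) := fun i =>
    (isBasic_br hQ hQB (isBasic_F_apply i)).exists_factor
  choose Y hYs hYF using hY
  obtain ⟨β, hβ, hPβ⟩ := hP.exists_factor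
  let Y' : (ι → ℝ) → ι → ℝ := fun z i => Y i z
  have hY' : SmoothNear Y' (D.F m) := smoothNear_pi.2 hYs
  have hYF' : ∀ᶠ x in 𝓝 m, fderiv ℝ D.F x (D.ham Q x) = Y' (D.F x) := by
    filter_upwards [eventually_all.2 hYF] with x hx
    ext i
    rw [fderiv_F_apply]
    exact hx i
  have hF := smoothNear_of_contDiff D.smooth_F m
  have hdF : ∀ y, HasFDerivAt D.F (fderiv ℝ D.F y) y := fun y =>
    ((D.smooth_F.differentiable (by simp)) y).hasFDerivAt
  have hYβ : ∀ᶠ z in 𝓝 (D.F m), fderiv ℝ β z (Y' z) = 1 := by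
    rw [← map_nhds_F, eventually_map]
    filter_upwards [hYF', hQP, eventually_eventually_nhds.2 hPβ, hF.continuousAt.eventually hβ]
      with x h1 h2 h3 h4
    rw [← h1, ← h2, PoissonModel.br_eq,
      Filter.EventuallyEq.fderiv_eq (f := fun y => β (D.F y)) h3,
      show (fun y => β (D.F y)) = β ∘ D.F from rfl,
      ((h4.differentiableAt (by simp)).hasFDerivAt.comp x (hdF x)).fderiv]
    rfl
  obtain ⟨ρ, hρ⟩ := exists_isRetraction hY' hβ hYβ
  refine ⟨Y', β, ρ, hρ, hPβ, ?_⟩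
  have hρt : Tendsto ρ (𝓝 (D.F m)) (𝓝 (D.F m)) := by
    have := hρ.smooth.continuousAt
    rwa [ContinuousAt, hρ.base] at this
  -- The map `ρ ∘ F` is constant along the Hamiltonian field of `Q`, so `π` leaves it unchanged. As
  -- `F (π x)` lies on the level of `β`, it is fixed by `ρ`.
  have hinv : ∀ i, ∀ᶠ x in 𝓝 m, ρ (D.F (π x)) i = ρ (D.F x) i := by
    intro i
    refine h.invariant (fun x => ρ (D.F x) i) ?_ ?_
    · exact smoothNear_pi.1 (SmoothNear.comp (g := ρ) (f := D.F) hρ.smooth hF) i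
    · filter_upwards [hYF', hF.continuousAt.eventually hρ.deriv_field,
        hF.continuousAt.eventually hρ.smooth] with x h1 h2 h3
      have := (h3.differentiableAt (by simp)).hasFDerivAt.comp x (hdF x)
      have h5 := (hasFDerivAt_pi'.1 this i).fderiv
      rw [show (fun x => ρ (D.F x) i) = fun x => (ρ ∘ D.F) x i from rfl, h5]
      simp only [ContinuousLinearMap.comp_apply, h1, h2]
      rfl
  have hπt := PoissonModel.tendsto_retraction h
  filter_upwards [eventually_all.2 hinv, h.level, hπt.eventually hPβ,
    hπt.eventually (hF.continuousAt.eventually hρ.fixed)] with x h1 h2 h3 h4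
  have h5 : β (D.F (π x)) = β (D.F m) := by rw [← h3, h2, hPβ.self_of_nhds]
  rw [← funext h1, h4 h5]

/-- The retraction `π` covers the retraction `ρ` of the leaf space, so `b ∘ π` is again a function
of `F`. -/
theorem IsBasic.comp_retraction {b : E → W} (hb : D.IsBasic b m)
    (h : IsRetraction (D.ham Q) P m π) (hQ : SmoothNear Q m)
    (hQB : ∀ᶠ x in 𝓝 m, D.PreservesBasic Q x) (hP : D.IsBasic P m)
    (hQP : ∀ᶠ x in 𝓝 m, D.br Q P x = 1) : D.IsBasic (fun x => b (π x)) m := by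
  obtain ⟨Y, β, ρ, hρ, -, hFρ⟩ := exists_leaf_retraction h hQ hQB hP hQP
  obtain ⟨γ, hγ, hbγ⟩ := hb.exists_factor
  have h1 : D.IsBasic (fun x => γ (ρ (D.F x))) m :=
    IsBasic.comp (g := γ) (hρ.base.symm ▸ hγ) (IsBasic.comp (g := ρ) hρ.smooth isBasic_F)
  refine h1.congr ?_
  filter_upwards [(PoissonModel.tendsto_retraction h).eventually hbγ, hFρ] with x h2 h3
  rw [h2, h3]

/-- Near `m` one has `F = Ψ (P - P m, F ∘ π)`. The function `q ∘ π` commutes with `P`, and its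
bracket with `F i ∘ π` is `{q, F i} ∘ π`, which is basic. By the chain rule the brackets of `q ∘ π`
with the components of `F` are basic. -/
theorem preservesBasic_comp_retraction {q : E → ℝ} (hq : SmoothNear q m)
    (hqB : ∀ᶠ x in 𝓝 m, D.PreservesBasic q x) (hqP : ∀ᶠ x in 𝓝 m, D.br q P x = 0)
    (h : IsRetraction (D.ham Q) P m π) (hQ : SmoothNear Q m)
    (hQB : ∀ᶠ x in 𝓝 m, D.PreservesBasic Q x) (hP : D.IsBasic P m)
    (hQP : ∀ᶠ x in 𝓝 m, D.br Q P x = 1) :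
    ∀ᶠ x in 𝓝 m, D.PreservesBasic (fun x => q (π x)) x := by
  obtain ⟨Y, β, ρ, hρ, hPβ, hFρ⟩ := exists_leaf_retraction h hQ hQB hP hQP
  obtain ⟨Ψ, hΨ, hΨF⟩ := hρ.exists_inverse
  have hF := smoothNear_of_contDiff D.smooth_F m
  have hqπ := PoissonModel.smooth_comp_retraction h hq
  have hFπ : D.IsBasic (fun x => D.F (π x)) m := isBasic_F.comp_retraction h hQ hQB hP hQP
  let κ : E → ℝ × (ι → ℝ) := fun x => (P x - P m, D.F (π x))
  have hκ : D.IsBasic κ m := (hP.sub (isBasic_const (P m))).prodMk hFπ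
  have hκm : κ m = (0, D.F m) := by simp [κ, h.base]
  have hκt : Tendsto κ (𝓝 m) (𝓝 (0, D.F m)) := hκm ▸ hκ.1.continuousAt
  have hFΨ : ∀ᶠ x in 𝓝 m, D.F x = Ψ (κ x) := by
    filter_upwards [hF.continuousAt.eventually hΨF, hPβ, hFρ] with x h1 h2 h3
    simp only [κ]
    rw [h2, h3, hPβ.self_of_nhds, h1]
  have hbrP : ∀ᶠ x in 𝓝 m, D.br (fun x => q (π x)) P x = 0 := by
    have h1 : ∀ᶠ x in 𝓝 m, D.br P Q x = -1 := by
      filter_upwards [hQP] with x hx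
      rw [D.br_skew, hx]
    filter_upwards [PoissonModel.br_comp_retraction_of_const h hQ hP.1 hq h1
      (Eventually.of_forall fun x => D.br_self P x),
      (PoissonModel.tendsto_retraction h).eventually hqP] with x h2 h3
    rw [D.br_skew, h2, D.br_skew, h3]
    simp
  have hbrF : ∀ i, ∀ᶠ x in 𝓝 m, D.br (fun x => q (π x)) (fun x => D.F (π x) i) x =
      D.br q (fun y => D.F y i) (π x) := fun i =>
    PoissonModel.br_comp_comp_retraction h hQ hq (isBasic_F_apply (D := D) i).1 hqP (by
      filter_upwards [hP.eventually] with x hx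
      exact (isBasic_F_apply i).br_eq_zero hx)
  let w : E → ι → ℝ := fun x i => D.br q (fun y => D.F y i) (π x)
  have hw : D.IsBasic w m := isBasic_pi.2 fun i =>
    (isBasic_br hq hqB (isBasic_F_apply i)).comp_retraction h hQ hQB hP hQP
  have hwF : ∀ᶠ x in 𝓝 m, fderiv ℝ D.F x (D.ham (fun x => q (π x)) x) =
      fderiv ℝ Ψ (κ x) (0, w x) := by
    filter_upwards [eventually_eventually_nhds.2 hFΨ, hbrP, eventually_all.2 hbrF,
      hκt.eventually hΨ, hP.1, hFπ.1] with x h1 h2 h3 h4 h5 h6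
    have hd1 := ((h5.differentiableAt (by simp)).hasFDerivAt.sub_const (P m)).prodMk
      (h6.differentiableAt (by simp)).hasFDerivAt
    have hd2 := ((h4.differentiableAt (by simp)).hasFDerivAt.comp x hd1).fderiv
    rw [Filter.EventuallyEq.fderiv_eq (f := Ψ ∘ κ) h1, hd2, ContinuousLinearMap.comp_apply]
    congr 1
    refine Prod.ext h2 ?_
    ext i
    have h7 : fderiv ℝ (fun x => D.F (π x)) x (D.ham (fun x => q (π x)) x) i =
        D.br (fun x => q (π x)) (fun x => D.F (π x) i) x := by
      rw [fderiv_pi_apply (h6.differentiableAt (by simp))]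
      rfl
    exact h7.trans (h3 i)
  have hbasic : D.IsBasic (fun x => fderiv ℝ Ψ (κ x) (0, w x)) m := by
    have h1 : D.IsBasic (fun x => (fderiv ℝ Ψ (κ x), w x)) m :=
      (IsBasic.comp (g := fderiv ℝ Ψ) (hκm.symm ▸ hΨ.smooth_fderiv) hκ).prodMk hw
    refine IsBasic.comp (b := fun x => (fderiv ℝ Ψ (κ x), w x))
      (g := fun p : ((ℝ × (ι → ℝ)) →L[ℝ] (ι → ℝ)) × (ι → ℝ) => p.1 (0, p.2)) ?_ h1
    exact smoothNear_of_contDiff (contDiff_fst.clm_apply (contDiff_const.prodMk contDiff_snd)) _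
  have hbasic' : ∀ i, D.IsBasic (D.br (fun x => q (π x)) (fun y => D.F y i)) m := fun i => by
    refine (isBasic_pi.1 hbasic i).congr ?_
    filter_upwards [hwF] with x hx
    rw [← hx, fderiv_F_apply]
    rfl
  filter_upwards [hqπ.eventually, eventually_all.2 fun i => (hbasic' i).2] with x h1 h2
  exact preservesBasic_of_forall h1 h2

end Retraction

end FoliatedModel

end PoissonGeom

end

/-! ### Smoothness of integrals over a compact group. -/

noncomputable section

open scoped Manifold ContDiff Topology
open Filter Set MeasureTheory

set_option linter.unusedSectionVars false

namespace PoissonGeom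

universe u

section ParametricIntegral

variable {d : ℕ} {G : Type*} [TopologicalSpace G] [ChartedSpace (EuclideanSpace ℝ (Fin d)) G]
  [IsManifold (𝓡 d) ∞ G]
  {E : Type u} [NormedAddCommGroup E] [NormedSpace ℝ E]

/-- A family of maps `E → W`, parametrised by a manifold, that is jointly smooth. -/
abbrev JointlySmoothOn {W : Type*} [NormedAddCommGroup W] [NormedSpace ℝ W] (d : ℕ)
    {G : Type*} [TopologicalSpace G] [ChartedSpace (EuclideanSpace ℝ (Fin d)) G]
    (H : G × E → W) (U : Set E) : Prop :=
  ContMDiffOn ((𝓡 d).prod 𝓘(ℝ, E)) 𝓘(ℝ, W) ∞ H (univ ×ˢ U)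

variable {W : Type u} [NormedAddCommGroup W] [NormedSpace ℝ W] {H : G × E → W} {U : Set E}

theorem JointlySmoothOn.contMDiffAt (hH : JointlySmoothOn d H U) (hU : IsOpen U) {p : G × E}
    (hp : p.2 ∈ U) : ContMDiffAt ((𝓡 d).prod 𝓘(ℝ, E)) 𝓘(ℝ, W) ∞ H p :=
  ContMDiffOn.contMDiffAt hH ((isOpen_univ.prod hU).mem_nhds ⟨mem_univ _, hp⟩)

theorem JointlySmoothOn.contDiffOn (hH : JointlySmoothOn d H U) (g : G) :
    ContDiffOn ℝ ∞ (fun x => H (g, x)) U := by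
  rw [← contMDiffOn_iff_contDiffOn]
  exact hH.comp (contMDiff_const.prodMk contMDiff_id).contMDiffOn fun x hx => ⟨mem_univ _, hx⟩

theorem JointlySmoothOn.continuous (hH : JointlySmoothOn d H U) {x : E} (hx : x ∈ U) :
    Continuous fun g => H (g, x) := by
  have := hH.continuousOn.comp (Continuous.prodMk_left x).continuousOn (s := univ)
    fun g _ => (⟨mem_univ g, hx⟩ : (g, x) ∈ univ ×ˢ U)
  exact continuousOn_univ.1 this

/-- This stability makes induction on the order of differentiability possible for the parametric
integral. -/
theorem JointlySmoothOn.fderiv_snd (hH : JointlySmoothOn d H U) (hU : IsOpen U) :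
    JointlySmoothOn d (fun p : G × E => fderiv ℝ (fun x => H (p.1, x)) p.2) U := by
  rintro p ⟨-, hp⟩
  refine ContMDiffAt.contMDiffWithinAt ?_
  have h1 : ContMDiffAt (((𝓡 d).prod 𝓘(ℝ, E)).prod 𝓘(ℝ, E)) 𝓘(ℝ, W) ∞
      (Function.uncurry fun (p : G × E) (x : E) => H (p.1, x)) (p, p.2) := by
    have h2 : ContMDiff (((𝓡 d).prod 𝓘(ℝ, E)).prod 𝓘(ℝ, E)) ((𝓡 d).prod 𝓘(ℝ, E)) ∞
        (fun q : (G × E) × E => (q.1.1, q.2)) :=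
      (contMDiff_fst.comp contMDiff_fst).prodMk contMDiff_snd
    exact ContMDiffAt.comp (p, p.2) (hH.contMDiffAt hU hp) h2.contMDiffAt
  have h3 := ContMDiffAt.mfderiv (fun (p : G × E) (x : E) => H (p.1, x)) Prod.snd h1
    (m := ∞) contMDiffAt_snd (by simp)
  have h4 := inTangentCoordinates_model_space (I := 𝓘(ℝ, E)) (I' := 𝓘(ℝ, W)) (Prod.snd : G × E → E)
    (fun p : G × E => H (p.1, p.2)) (fun p => fderiv ℝ (fun x => H (p.1, x)) p.2) p
  rw [← h4]
  simpa only [mfderiv_eq_fderiv] using h3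

variable [CompactSpace G] [T2Space G] [MeasurableSpace G] [BorelSpace G] (μ : Measure G)
  [IsFiniteMeasure μ]

theorem integrable_of_continuous {W : Type*} [NormedAddCommGroup W] {f : G → W}
    (hf : Continuous f) : Integrable f μ := by
  exact hf.integrable_of_hasCompactSupport (HasCompactSupport.of_compactSpace f)

variable [FiniteDimensional ℝ E] [CompleteSpace W]

/-- The derivative in the second variable is bounded on the compact product of `G` with a closed
ball, and a constant is integrable for a finite measure; dominated differentiation applies. -/
theorem JointlySmoothOn.hasFDerivAt_integral (hH : JointlySmoothOn d H U) (hU : IsOpen U)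
    {x : E} (hx : x ∈ U) :
    HasFDerivAt (fun x => ∫ g, H (g, x) ∂μ)
      (∫ g, fderiv ℝ (fun x => H (g, x)) x ∂μ) x := by
  obtain ⟨ε, hε, hball⟩ := Metric.nhds_basis_closedBall.mem_iff.1 (hU.mem_nhds hx)
  have hd := hH.fderiv_snd hU
  have hK : IsCompact ((univ : Set G) ×ˢ Metric.closedBall x ε) :=
    isCompact_univ.prod (isCompact_closedBall x ε)
  obtain ⟨C, hC⟩ := hK.exists_bound_of_continuousOn
    (hd.continuousOn.mono (prod_mono subset_rfl hball))
  refine hasFDerivAt_integral_of_dominated_of_fderiv_le (μ := μ) (s := Metric.ball x ε)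
    (F := fun x g => H (g, x)) (F' := fun x g => fderiv ℝ (fun x => H (g, x)) x)
    (bound := fun _ => C)
    (Metric.ball_mem_nhds x hε) ?_ ?_ ?_ ?_ ?_ ?_
  · filter_upwards [hU.mem_nhds hx] with y hy
    exact (integrable_of_continuous μ (hH.continuous hy)).aestronglyMeasurable
  · exact integrable_of_continuous μ (hH.continuous hx)
  · exact (integrable_of_continuous μ (hd.continuous hx)).aestronglyMeasurable
  · exact Eventually.of_forall fun g y hy =>
      hC (g, y) ⟨mem_univ _, Metric.ball_subset_closedBall hy⟩
  · exact integrable_const C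
  · refine Eventually.of_forall fun g y hy => ?_
    have hyU : y ∈ U := hball (Metric.ball_subset_closedBall hy)
    exact (((hH.contDiffOn g).contDiffAt (hU.mem_nhds hyU)).differentiableAt (by simp)).hasFDerivAt

theorem JointlySmoothOn.contDiffOn_nat_integral (k : ℕ) : ∀ {W : Type u} [NormedAddCommGroup W]
    [NormedSpace ℝ W] [CompleteSpace W] {H : G × E → W}, JointlySmoothOn d H U → IsOpen U →
    ContDiffOn ℝ k (fun x => ∫ g, H (g, x) ∂μ) U := by
  induction k with
  | zero =>
    intro W _ _ _ H hH hU
    exact contDiffOn_zero.2 fun x hx =>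
      (hH.hasFDerivAt_integral μ hU hx).continuousAt.continuousWithinAt
  | succ k ih =>
    intro W _ _ _ H hH hU
    rw [Nat.cast_succ, contDiffOn_succ_iff_fderiv_of_isOpen (n := k) hU]
    refine ⟨fun x hx => (hH.hasFDerivAt_integral μ hU hx).differentiableAt.differentiableWithinAt,
      by simp, ?_⟩
    refine (ih (hH.fderiv_snd hU) hU).congr fun x hx => ?_
    exact (hH.hasFDerivAt_integral μ hU hx).fderiv

theorem JointlySmoothOn.contDiffOn_integral (hH : JointlySmoothOn d H U) (hU : IsOpen U) :
    ContDiffOn ℝ ∞ (fun x => ∫ g, H (g, x) ∂μ) U :=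
  contDiffOn_infty.2 fun k => contDiffOn_nat_integral μ k hH hU

end ParametricIntegral

/-! ### Local actions and averages over the group. -/

/-- A smooth local action of `G` near a fixed point `m`, by maps that preserve the Poisson structure
and the foliation, and whose derivative at `m` is the identity on the tangent space of the
symplectic leaf. -/
structure LocalAction {E : Type} [NormedAddCommGroup E] [NormedSpace ℝ E] {ι : Type} [Fintype ι]
    (D : FoliatedModel E ι) (d : ℕ) (G : Type*) [Group G] [TopologicalSpace G]
    [ChartedSpace (EuclideanSpace ℝ (Fin d)) G] (m : E) where
  /-- the domain of the action -/
  U : Set E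
  isOpen : IsOpen U
  mem : m ∈ U
  /-- the action -/
  act : G → E → E
  smooth : JointlySmoothOn d (Function.uncurry act) U
  maps : ∀ g, ∀ x ∈ U, act g x ∈ U
  one : ∀ x ∈ U, act 1 x = x
  mul : ∀ g h, ∀ x ∈ U, act (g * h) x = act g (act h x)
  poisson : ∀ g, ∀ x ∈ U, ∀ α : E →L[ℝ] ℝ,
    fderiv ℝ (act g) x (D.sharp x (α.comp (fderiv ℝ (act g) x))) = D.sharp (act g x) α
  foliation : ∀ g, ∀ x ∈ U, ∀ v, fderiv ℝ D.F x v = 0 →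
    fderiv ℝ D.F (act g x) (fderiv ℝ (act g) x v) = 0
  base : ∀ g, act g m = m
  fixed : ∀ g α, fderiv ℝ (act g) m (D.sharp m α) = D.sharp m α

namespace LocalAction

variable {E : Type} [NormedAddCommGroup E] [NormedSpace ℝ E] {ι : Type} [Fintype ι]
  {D : FoliatedModel E ι} {d : ℕ} {G : Type*} [Group G] [TopologicalSpace G]
  [ChartedSpace (EuclideanSpace ℝ (Fin d)) G] [LieGroup (𝓡 d) ∞ G] {m : E}
  (A : LocalAction D d G m)

theorem contDiffAt (g : G) {x : E} (hx : x ∈ A.U) : ContDiffAt ℝ ∞ (A.act g) x :=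
  (A.smooth.contDiffOn g).contDiffAt (A.isOpen.mem_nhds hx)

theorem smoothNear (g : G) {x : E} (hx : x ∈ A.U) : SmoothNear (A.act g) x :=
  smoothNear_of_contDiffOn (A.smooth.contDiffOn g) A.isOpen hx

theorem differentiableAt (g : G) {x : E} (hx : x ∈ A.U) : DifferentiableAt ℝ (A.act g) x :=
  (A.contDiffAt g hx).differentiableAt (by simp)

theorem eventually_mem {x : E} (hx : x ∈ A.U) : ∀ᶠ y in 𝓝 x, y ∈ A.U := A.isOpen.eventually_mem hx

theorem act_inv_act (g : G) {x : E} (hx : x ∈ A.U) : A.act g⁻¹ (A.act g x) = x := by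
  rw [← A.mul _ _ x hx, inv_mul_cancel, A.one x hx]

theorem continuousAt_uncurry (g : G) {x : E} (hx : x ∈ A.U) :
    ContinuousAt (Function.uncurry A.act) (g, x) :=
  (A.smooth.contMDiffAt A.isOpen (p := (g, x)) hx).continuousAt

/-- Since `m` is fixed and `G` is compact, the tube lemma keeps entire orbits of nearby points near
`m`. -/
theorem eventually_forall_act [CompactSpace G] {p : E → Prop} (hp : ∀ᶠ x in 𝓝 m, p x) :
    ∀ᶠ x in 𝓝 m, x ∈ A.U ∧ ∀ g, p (A.act g x) := by
  refine (A.eventually_mem A.mem).and ?_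
  have := isCompact_univ.eventually_forall_of_forall_eventually (x₀ := m) (K := (univ : Set G))
    (P := fun x g => p (A.act g x)) fun g _ => by
      have h1 := (A.continuousAt_uncurry g A.mem).comp_of_eq
        (continuous_swap (X := E) (Y := G)).continuousAt (x := (m, g)) rfl
      have h2 : (Function.uncurry A.act ∘ Prod.swap) (m, g) = m := A.base g
      rw [ContinuousAt, h2] at h1
      exact h1.eventually hp
  filter_upwards [this] with x hx g using hx g (mem_univ g)

/-- `y` is invariant near `m`. -/
def Invariant (y : E → ℝ) : Prop := ∀ᶠ x in 𝓝 m, ∀ g, y (A.act g x) = y x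

theorem br_comp_act (g : G) {x : E} (hx : x ∈ A.U) {a b : E → ℝ}
    (ha : DifferentiableAt ℝ a (A.act g x)) (hb : DifferentiableAt ℝ b (A.act g x)) :
    D.br (fun y => a (A.act g y)) (fun y => b (A.act g y)) x = D.br a b (A.act g x) := by
  have hd := (A.differentiableAt g hx).hasFDerivAt
  have h1 := (ha.hasFDerivAt.comp x hd).fderiv
  have h2 := (hb.hasFDerivAt.comp x hd).fderiv
  rw [PoissonModel.br, show (fun y => a (A.act g y)) = a ∘ A.act g from rfl, h1,
    show (fun y => b (A.act g y)) = b ∘ A.act g from rfl, h2, ContinuousLinearMap.comp_apply,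
    A.poisson g x hx]
  rfl

theorem fderiv_act_ham {y : E → ℝ} (hy : SmoothNear y m) (hyA : A.Invariant y)
    [CompactSpace G] : ∀ᶠ x in 𝓝 m, ∀ g,
      fderiv ℝ (A.act g) x (D.ham y x) = D.ham y (A.act g x) := by
  filter_upwards [A.eventually_forall_act hy, eventually_eventually_nhds.2 hyA] with x hx hxA g
  have hd := (A.differentiableAt g hx.1).hasFDerivAt
  have h1 := (((hx.2 g).differentiableAt (by simp)).hasFDerivAt.comp x hd).fderiv
  have h2 : (y ∘ A.act g) =ᶠ[𝓝 x] y := by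
    filter_upwards [hxA] with z hz using hz g
  rw [h2.fderiv_eq] at h1
  rw [PoissonModel.ham, h1, A.poisson g x hx.1]
  rfl

theorem isBasic_comp_act {W : Type*} [NormedAddCommGroup W] [NormedSpace ℝ W] (g : G) {x : E}
    (hx : x ∈ A.U) {b : E → W} (hb : D.IsBasic b (A.act g x)) :
    D.IsBasic (fun y => b (A.act g y)) x := by
  have hs := A.smoothNear g hx
  refine ⟨SmoothNear.comp (g := b) (f := A.act g) hb.1 hs, ?_⟩
  filter_upwards [A.eventually_mem hx, hs.continuousAt.eventually hb.1,
    hs.continuousAt.eventually hb.2] with y h1 h2 h3 v hv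
  have := (h2.differentiableAt (by simp)).hasFDerivAt.comp y
    (A.differentiableAt g h1).hasFDerivAt
  rw [show (fun y => b (A.act g y)) = b ∘ A.act g from rfl, this.fderiv]
  exact h3 _ (A.foliation g y h1 v hv)

/-- As `g` is a Poisson map, `{q ∘ g, b} = {q, b ∘ g⁻¹} ∘ g`. Both composition with `g⁻¹` and
composition with `g` preserve basic functions. -/
theorem preservesBasic_comp_act (g : G) {x : E} (hx : x ∈ A.U) {q : E → ℝ}
    (hqs : SmoothNear q (A.act g x)) (hq : D.PreservesBasic q (A.act g x)) :
    D.PreservesBasic (fun y => q (A.act g y)) x := by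
  intro b hb v hv
  have hx' := A.maps g x hx
  let b' : E → ℝ := fun y => b (A.act g⁻¹ y)
  have hb' : D.IsBasic b' (A.act g x) :=
    A.isBasic_comp_act g⁻¹ hx' ((A.act_inv_act g hx).symm ▸ hb)
  have hc := (A.smoothNear g hx).continuousAt
  have hev : D.br (fun y => q (A.act g y)) b =ᶠ[𝓝 x] fun y => D.br q b' (A.act g y) := by
    filter_upwards [A.eventually_mem hx, hc.eventually hqs, hc.eventually hb'.1]
      with y h1 h2 h3
    rw [← A.br_comp_act g h1 (h2.differentiableAt (by simp)) (h3.differentiableAt (by simp))]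
    refine PoissonModel.br_congr (EventuallyEq.refl _ _) ?_
    filter_upwards [A.eventually_mem h1] with z hz
    simp only [b', A.act_inv_act g hz]
  have hd := ((PoissonModel.br_smooth (D := D.toPoissonModel) hqs hb'.1).differentiableAt.hasFDerivAt.comp x
    (A.differentiableAt g hx).hasFDerivAt)
  rw [hev.fderiv_eq, show (fun y => D.br q b' (A.act g y)) = D.br q b' ∘ A.act g from rfl,
    hd.fderiv]
  exact hq b' hb' _ (A.foliation g x hx v hv)

variable [CompactSpace G] [T2Space G] [MeasurableSpace G] [BorelSpace G] (μ : Measure G)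
  [IsProbabilityMeasure μ]
  {V W : Type} [NormedAddCommGroup V] [NormedSpace ℝ V] [NormedAddCommGroup W] [NormedSpace ℝ W]
  [CompleteSpace W]

/-- The weighted average of `h` over the group. -/
def weightedAvg (C : G → V →L[ℝ] W) (h : E → V) (x : E) : W :=
  ∫ g, C g (h (A.act g⁻¹ x)) ∂μ

/-- The average of `h` over the group. -/
def avg (h : E → ℝ) (x : E) : ℝ := ∫ g, h (A.act g⁻¹ x) ∂μ

theorem jointlySmoothOn_comp_act {h : E → V} {N : Set E} (hN : N ⊆ A.U)
    (hh : ∀ x ∈ N, ∀ g, ContDiffAt ℝ ∞ h (A.act g x)) :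
    JointlySmoothOn d (fun p : G × E => h (A.act p.1⁻¹ p.2)) N := by
  rintro ⟨g, x⟩ ⟨-, hx⟩
  refine ContMDiffAt.contMDiffWithinAt ?_
  have h1 : ContMDiffAt ((𝓡 d).prod 𝓘(ℝ, E)) ((𝓡 d).prod 𝓘(ℝ, E)) ∞
      (fun p : G × E => (p.1⁻¹, p.2)) (g, x) :=
    (((contMDiff_inv (𝓡 d) ∞).comp contMDiff_fst).prodMk contMDiff_snd).contMDiffAt
  have h2 : ContMDiffAt ((𝓡 d).prod 𝓘(ℝ, E)) 𝓘(ℝ, E) ∞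
      (fun p : G × E => A.act p.1⁻¹ p.2) (g, x) :=
    ContMDiffAt.comp (g := Function.uncurry A.act) (g, x)
      (A.smooth.contMDiffAt A.isOpen (hN hx)) h1
  exact ContMDiffAt.comp (g := h) (g, x) (hh x hx g⁻¹).contMDiffAt h2

theorem jointlySmoothOn_weighted {C : G → V →L[ℝ] W}
    (hC : ContMDiff (𝓡 d) 𝓘(ℝ, V →L[ℝ] W) ∞ C) {h : E → V} {N : Set E} (hN : N ⊆ A.U)
    (hh : ∀ x ∈ N, ∀ g, ContDiffAt ℝ ∞ h (A.act g x)) :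
    JointlySmoothOn d (fun p : G × E => C p.1 (h (A.act p.1⁻¹ p.2))) N :=
  ContMDiffOn.clm_apply (hC.comp contMDiff_fst).contMDiffOn (A.jointlySmoothOn_comp_act hN hh)

theorem exists_smooth_domain {h : E → V} (hh : SmoothNear h m) : ∃ N : Set E, IsOpen N ∧ m ∈ N ∧
    N ⊆ A.U ∧ ∀ x ∈ N, ∀ g, ContDiffAt ℝ ∞ h (A.act g x) := by
  obtain ⟨N, hN, hNo, hm⟩ := eventually_nhds_iff.1 (A.eventually_forall_act hh)
  exact ⟨N, hNo, hm, fun x hx => (hN x hx).1, fun x hx => (hN x hx).2⟩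

variable [FiniteDimensional ℝ E]

theorem weightedAvg_smooth {C : G → V →L[ℝ] W} (hC : ContMDiff (𝓡 d) 𝓘(ℝ, V →L[ℝ] W) ∞ C)
    {h : E → V} (hh : SmoothNear h m) : SmoothNear (A.weightedAvg μ C h) m := by
  obtain ⟨N, hNo, hm, hNU, hN⟩ := A.exists_smooth_domain hh
  exact smoothNear_of_contDiffOn
    ((A.jointlySmoothOn_weighted hC hNU hN).contDiffOn_integral μ hNo) hNo hm

theorem fderiv_weightedAvg {C : G → V →L[ℝ] W} (hC : ContMDiff (𝓡 d) 𝓘(ℝ, V →L[ℝ] W) ∞ C)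
    {h : E → V} (hh : SmoothNear h m) : ∀ᶠ x in 𝓝 m, ∀ v, fderiv ℝ (A.weightedAvg μ C h) x v =
      ∫ g, C g (fderiv ℝ h (A.act g⁻¹ x) (fderiv ℝ (A.act g⁻¹) x v)) ∂μ := by
  obtain ⟨N, hNo, hm, hNU, hN⟩ := A.exists_smooth_domain hh
  filter_upwards [hNo.mem_nhds hm] with x hx v
  have hJ := A.jointlySmoothOn_weighted hC hNU hN
  have h1 := (hJ.hasFDerivAt_integral μ hNo hx).fderiv
  rw [show A.weightedAvg μ C h = fun x => ∫ g, C g (h (A.act g⁻¹ x)) ∂μ from rfl, h1,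
    ContinuousLinearMap.integral_apply
      (integrable_of_continuous μ ((hJ.fderiv_snd hNo).continuous hx))]
  congr 1
  ext1 g
  have hd := ((hN x hx g⁻¹).differentiableAt (by simp)).hasFDerivAt.comp x
    (A.differentiableAt g⁻¹ (hNU hx)).hasFDerivAt
  have hd2 := ((C g).hasFDerivAt.comp x hd).fderiv
  rw [show (fun x => C g (h (A.act g⁻¹ x))) = C g ∘ (h ∘ A.act g⁻¹) from rfl, hd2]
  rfl

theorem weightedAvg_foliation {C : G → V →L[ℝ] W} (hC : ContMDiff (𝓡 d) 𝓘(ℝ, V →L[ℝ] W) ∞ C)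
    {h : E → V} (hh : D.IsBasic h m) : D.IsBasic (A.weightedAvg μ C h) m := by
  refine ⟨A.weightedAvg_smooth μ hC hh.1, ?_⟩
  filter_upwards [A.fderiv_weightedAvg μ hC hh.1, A.eventually_forall_act hh.2] with x h1 h2 v hv
  rw [h1]
  simp [h2.2 _ _ (A.foliation _ x h2.1 v hv)]

/-- The Hamiltonian field of an invariant function is equivariant, so differentiation along it
passes to every translate of `h` under the integral. Constant derivatives therefore remain constant.
-/
theorem weightedAvg_ham {C : G → V →L[ℝ] W} (hC : ContMDiff (𝓡 d) 𝓘(ℝ, V →L[ℝ] W) ∞ C)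
    {h : E → V} (hh : SmoothNear h m) {y : E → ℝ} (hy : SmoothNear y m) (hyA : A.Invariant y)
    {c : V} (hc : ∀ᶠ x in 𝓝 m, fderiv ℝ h x (D.ham y x) = c) :
    ∀ᶠ x in 𝓝 m, fderiv ℝ (A.weightedAvg μ C h) x (D.ham y x) = ∫ g, C g c ∂μ := by
  filter_upwards [A.fderiv_weightedAvg μ hC hh, A.eventually_forall_act hc,
    A.fderiv_act_ham hy hyA] with x h1 h2 h3
  rw [h1]
  simp only [h3, h2.2]

theorem avg_eq_weightedAvg (h : E → ℝ) :
    A.avg μ h = A.weightedAvg μ (fun _ => ContinuousLinearMap.id ℝ ℝ) h := rfl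

theorem avg_smooth {h : E → ℝ} (hh : SmoothNear h m) : SmoothNear (A.avg μ h) m := by
  rw [avg_eq_weightedAvg]
  exact A.weightedAvg_smooth μ contMDiff_const hh

theorem avg_isBasic {h : E → ℝ} (hh : D.IsBasic h m) : D.IsBasic (A.avg μ h) m := by
  rw [avg_eq_weightedAvg]
  exact A.weightedAvg_foliation μ contMDiff_const hh

theorem avg_invariant [μ.IsMulLeftInvariant] (h : E → ℝ) : A.Invariant (A.avg μ h) := by
  have : IsTopologicalGroup G := topologicalGroup_of_lieGroup (𝓡 d) ∞
  filter_upwards [A.eventually_mem A.mem] with x hx k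
  have h1 := integral_mul_left_eq_self (μ := μ) (fun g => h (A.act g⁻¹ x)) k⁻¹
  rw [avg, avg, ← h1]
  congr 1
  ext1 g
  rw [mul_inv_rev, inv_inv, A.mul _ _ x hx]

theorem avg_br {h : E → ℝ} (hh : SmoothNear h m) {y : E → ℝ} (hy : SmoothNear y m)
    (hyA : A.Invariant y) {c : ℝ} (hc : ∀ᶠ x in 𝓝 m, D.br y h x = c) :
    ∀ᶠ x in 𝓝 m, D.br y (A.avg μ h) x = c := by
  have := A.weightedAvg_ham μ (C := fun _ => ContinuousLinearMap.id ℝ ℝ) contMDiff_const hh hy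
    hyA hc
  filter_upwards [this] with x hx
  rw [PoissonModel.br_eq, avg_eq_weightedAvg, hx]
  simp

/-- The derivative of the action at `m` fixes all Hamiltonian vectors there. Hence averaging does
not destroy the normalisation of a bracket at `m`, even when `y` is not invariant. -/
theorem avg_br_base {h : E → ℝ} (hh : SmoothNear h m) (y : E → ℝ) :
    D.br y (A.avg μ h) m = D.br y h m := by
  have h1 := (A.fderiv_weightedAvg μ (C := fun _ => ContinuousLinearMap.id ℝ ℝ)
    contMDiff_const hh).self_of_nhds (D.ham y m)
  rw [PoissonModel.br_eq, avg_eq_weightedAvg, h1]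
  simp only [A.base, PoissonModel.ham, A.fixed]
  simp [PoissonModel.br]

/-- The bracket with a basic `b` may be taken under the integral, and so may its derivative along a
leaf. Every translate of `h` preserves the foliation, so the integrand vanishes. -/
theorem avg_preservesBasic {h : E → ℝ} (hh : SmoothNear h m)
    (hB : ∀ᶠ x in 𝓝 m, D.PreservesBasic h x) :
    ∀ᶠ x in 𝓝 m, D.PreservesBasic (A.avg μ h) x := by
  obtain ⟨N, hN, hNo, hm⟩ := eventually_nhds_iff.1
    (A.eventually_forall_act (hh.eventually.and hB))
  filter_upwards [hNo.mem_nhds hm] with x hx b hb v hv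
  obtain ⟨N₁, hN₁o, hxN₁, hbN₁⟩ := hb.1.exists_isOpen
  let N₂ := N ∩ N₁
  have hN₂o : IsOpen N₂ := hNo.inter hN₁o
  have hxN₂ : x ∈ N₂ := ⟨hx, hxN₁⟩
  have hJ : JointlySmoothOn d (fun p : G × E => h (A.act p.1⁻¹ p.2)) N₂ :=
    A.jointlySmoothOn_comp_act (fun y hy => (hN y hy.1).1)
      fun y hy g => ((hN y hy.1).2 g).1.contDiffAt
  have hham : ContDiffOn ℝ ∞ (D.ham b) N₂ := fun y hy =>
    (PoissonModel.ham_smooth (D := D.toPoissonModel)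
      (smoothNear_of_contDiffOn hbN₁ hN₁o hy.2)).contDiffAt.contDiffWithinAt
  let K : G × E → ℝ := fun p => fderiv ℝ (fun y => h (A.act p.1⁻¹ y)) p.2 (D.ham b p.2)
  have hK : JointlySmoothOn d K N₂ := by
    have h2 : JointlySmoothOn d (fun p : G × E => D.ham b p.2) N₂ :=
      (contMDiffOn_iff_contDiffOn.2 hham).comp contMDiffOn_snd fun p hp => hp.2
    exact ContMDiffOn.clm_apply (hJ.fderiv_snd hN₂o) h2
  have hKbr : ∀ g y, K (g, y) = - D.br (fun y => h (A.act g⁻¹ y)) b y := fun g y => by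
    rw [D.br_skew, neg_neg]
    rfl
  have hev : D.br (A.avg μ h) b =ᶠ[𝓝 x] fun y => - ∫ g, K (g, y) ∂μ := by
    filter_upwards [hN₂o.mem_nhds hxN₂] with y hy
    rw [D.br_skew, PoissonModel.br_eq, show A.avg μ h = fun x => ∫ g, h (A.act g⁻¹ x) ∂μ from rfl,
      (hJ.hasFDerivAt_integral μ hN₂o hy).fderiv, ContinuousLinearMap.integral_apply
      (integrable_of_continuous μ ((hJ.fderiv_snd hN₂o).continuous hy))]
  rw [hev.fderiv_eq, ((hK.hasFDerivAt_integral μ hN₂o hxN₂).fun_neg).fderiv, neg_apply,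
    ContinuousLinearMap.integral_apply
      (integrable_of_continuous μ ((hK.fderiv_snd hN₂o).continuous hxN₂))]
  have hzero : ∀ g, fderiv ℝ (fun y => K (g, y)) x v = 0 := by
    intro g
    simp only [hKbr, fderiv_fun_neg, neg_apply]
    obtain ⟨hxU, h3⟩ := hN x hx
    rw [A.preservesBasic_comp_act g⁻¹ hxU (h3 g⁻¹).1 (h3 g⁻¹).2 b hb v hv, neg_zero]
  simp [hzero]

end LocalAction

end PoissonGeom

end

/-! ### Completion of commuting functions to canonical coordinates. -/

noncomputable section

open scoped Manifold ContDiff Topology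
open Filter Set

namespace PoissonGeom

universe u

namespace PoissonModel

variable {E : Type u} [NormedAddCommGroup E] [NormedSpace ℝ E] {D : PoissonModel E} {m : E}

/-- Commuting functions with independent Hamiltonian vector fields are part of a system of canonical
coordinates. -/
theorem exists_conjugate_functions [FiniteDimensional ℝ E] {κ : Type*} [Fintype κ] [DecidableEq κ]
    (φ : κ → E → ℝ) (hφ : ∀ i, SmoothNear (φ i) m)
    (hφφ : ∀ i j, ∀ᶠ x in 𝓝 m, D.br (φ i) (φ j) x = 0)
    (hind : LinearIndependent ℝ fun i => D.ham (φ i) m) :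
    ∃ q : κ → E → ℝ, (∀ i, SmoothNear (q i) m) ∧
      (∀ i j, ∀ᶠ x in 𝓝 m, D.br (q i) (φ j) x = if i = j then 1 else 0) ∧
      ∀ i j, ∀ᶠ x in 𝓝 m, D.br (q i) (q j) x = 0 := by
  suffices H : ∀ t : Finset κ, ∃ q : κ → E → ℝ, (∀ i ∈ t, SmoothNear (q i) m) ∧
      (∀ i ∈ t, ∀ j, ∀ᶠ x in 𝓝 m, D.br (q i) (φ j) x = if i = j then 1 else 0) ∧
      ∀ i ∈ t, ∀ j ∈ t, ∀ᶠ x in 𝓝 m, D.br (q i) (q j) x = 0 by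
    obtain ⟨q, h1, h2, h3⟩ := H Finset.univ
    exact ⟨q, fun i => h1 i (Finset.mem_univ i), fun i => h2 i (Finset.mem_univ i),
      fun i j => h3 i (Finset.mem_univ i) j (Finset.mem_univ j)⟩
  intro t
  induction t using Finset.induction_on with
  | empty => exact ⟨fun _ _ => 0, by simp, by simp, by simp⟩
  | insert k t hk ih =>
    obtain ⟨q, hq, hqφ, hqq⟩ := ih
    -- The brackets among the `φ i` and the `q i` already found are constant, so the joint family
    -- has dual functions. Up to sign, the one dual to `φ k` is the next conjugate function: it
    -- commutes with the other `φ j` and with the earlier `q i`.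
    let a : κ ⊕ t → E → ℝ := Sum.elim φ fun i => q i
    have ha : ∀ i, SmoothNear (a i) m := by
      rintro (i | i)
      exacts [hφ i, hq i i.2]
    have haa : ∀ i j, ∃ c, ∀ᶠ x in 𝓝 m, D.br (a i) (a j) x = c := by
      rintro (i | i) (j | j)
      · exact ⟨0, hφφ i j⟩
      · refine ⟨-(if (j : κ) = i then 1 else 0), ?_⟩
        filter_upwards [hqφ j j.2 i] with x hx
        rw [D.br_skew, show D.br (a (Sum.inr j)) (a (Sum.inl i)) x = _ from hx]
      · exact ⟨_, hqφ i i.2 j⟩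
      · exact ⟨0, hqq i i.2 j j.2⟩
    have hai : LinearIndependent ℝ fun i => D.ham (a i) m := by
      rw [Fintype.linearIndependent_iff] at hind ⊢
      intro g hg
      simp only [Fintype.sum_sum_type] at hg
      -- Applying `dφ i` to a linear relation kills all Hamiltonian vectors of the `φ j` and
      -- isolates the coefficient at `q i`.
      have hr : ∀ i : t, g (Sum.inr i) = 0 := by
        intro i
        have h1 := congrArg (fderiv ℝ (φ i) m) hg
        have h2 : ∀ j, fderiv ℝ (φ i) m (D.ham (a (Sum.inl j)) m) = 0 := fun j =>
          (hφφ j i).self_of_nhds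
        have h3 : ∀ j : t, fderiv ℝ (φ i) m (D.ham (a (Sum.inr j)) m) =
            if j = i then 1 else 0 := fun j => by
          rw [show fderiv ℝ (φ i) m (D.ham (a (Sum.inr j)) m) = _ from
            (hqφ j j.2 i).self_of_nhds]
          exact if_congr Subtype.ext_iff.symm rfl rfl
        rw [map_add, map_sum, map_sum, map_zero] at h1
        simp only [map_smul, h2, h3, smul_eq_mul, mul_zero, Finset.sum_const_zero, zero_add,
          mul_ite, mul_one, Finset.sum_ite_eq', Finset.mem_univ, if_true] at h1
        exact h1
      have hl := hind (fun i => g (Sum.inl i)) (by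
        simp only [hr, zero_smul, Finset.sum_const_zero, add_zero] at hg
        exact hg)
      rintro (i | i)
      exacts [hl i, hr i]
    obtain ⟨u, hu, hau⟩ := exists_dual_functions Finset.univ a ha haa hai
    let v : E → ℝ := fun x => - u (Sum.inl k) x
    have hv : SmoothNear v m := (hu _ (Finset.mem_univ _)).neg
    have hvφ : ∀ j, ∀ᶠ x in 𝓝 m, D.br v (φ j) x = if k = j then 1 else 0 := by
      intro j
      filter_upwards [hau (Sum.inl j) (Finset.mem_univ _) (Sum.inl k) (Finset.mem_univ _)]
        with x hx
      rw [D.br_skew, br_neg_right, neg_neg, show D.br (φ j) (u (Sum.inl k)) x = _ from hx]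
      simp [eq_comm]
    have hqv : ∀ i ∈ t, ∀ᶠ x in 𝓝 m, D.br (q i) v x = 0 := by
      intro i hi
      filter_upwards [hau (Sum.inr ⟨i, hi⟩) (Finset.mem_univ _) (Sum.inl k) (Finset.mem_univ _)]
        with x hx
      rw [br_neg_right, show D.br (q i) (u (Sum.inl k)) x = _ from hx]
      simp
    have hne : ∀ i ∈ t, i ≠ k := fun i hi h => hk (h ▸ hi)
    refine ⟨Function.update q k v, ?_, ?_, ?_⟩
    · intro i hi
      rcases Finset.mem_insert.1 hi with rfl | hi
      · simpa using hv
      · simpa [hne i hi] using hq i hi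
    · intro i hi j
      rcases Finset.mem_insert.1 hi with rfl | hi
      · simpa using hvφ j
      · simpa [hne i hi] using hqφ i hi j
    · intro i hi j hj
      rcases Finset.mem_insert.1 hi with rfl | hi' <;> rcases Finset.mem_insert.1 hj with rfl | hj'
      · exact Eventually.of_forall fun x => D.br_self _ x
      · simp only [Function.update_self, Function.update_of_ne (hne j hj')]
        filter_upwards [hqv j hj'] with x hx
        rw [D.br_skew, hx, neg_zero]
      · simpa [hne i hi'] using hqv i hi'
      · simpa [hne i hi', hne j hj'] using hqq i hi' j hj'

end PoissonModel

end PoissonGeom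

end

/-! ### Invariant canonical families. -/

noncomputable section

open scoped Manifold ContDiff Topology
open Filter Set MeasureTheory

set_option linter.unusedSectionVars false

namespace PoissonGeom

namespace FoliatedModel

universe u

variable {E : Type u} [NormedAddCommGroup E] [NormedSpace ℝ E] [FiniteDimensional ℝ E]
  {ι : Type} [Fintype ι] {D : FoliatedModel E ι} {m : E}

open PoissonModel

/-- Basic functions commute, so in the bracket with a basic function the factor `a` passes outside.
-/
theorem preservesBasic_mul {a q : E → ℝ} (ha : D.IsBasic a m) (hq : SmoothNear q m)
    (hqB : ∀ᶠ x in 𝓝 m, D.PreservesBasic q x) :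
    ∀ᶠ x in 𝓝 m, D.PreservesBasic (fun y => q y * a y) x := by
  filter_upwards [ha.eventually, hq.eventually, eventually_eventually_nhds.2 hqB] with x h1 h2 h3
  intro b hb v hv
  have hev : D.br (fun y => q y * a y) b =ᶠ[𝓝 x] fun y => a y * D.br q b y := by
    filter_upwards [h1.eventually, h2.eventually, hb.eventually] with y h4 h5 h6
    rw [br_mul_left h5 h4.1, h4.br_eq_zero h6, mul_zero, zero_add]
  rw [hev.fderiv_eq]
  exact (h1.mul (isBasic_br h2 h3 hb)).2.self_of_nhds v hv

theorem preservesBasic_sub {a q : E → ℝ} (ha : SmoothNear a m)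
    (haB : ∀ᶠ x in 𝓝 m, D.PreservesBasic a x) (hq : SmoothNear q m)
    (hqB : ∀ᶠ x in 𝓝 m, D.PreservesBasic q x) :
    ∀ᶠ x in 𝓝 m, D.PreservesBasic (fun y => a y - q y) x := by
  filter_upwards [ha.eventually, hq.eventually, eventually_eventually_nhds.2 hqB,
    eventually_eventually_nhds.2 haB] with x h1 h2 h3 h4
  intro b hb v hv
  have hev : D.br (fun y => a y - q y) b =ᶠ[𝓝 x] fun y => D.br a b y - D.br q b y := by
    filter_upwards [h1.eventually, h2.eventually] with y h4 h5
    rw [br_sub_left h4 h5]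
  rw [hev.fderiv_eq]
  exact ((isBasic_br h1 h4 hb).sub (isBasic_br h2 h3 hb)).2.self_of_nhds v hv

/-- Canonically conjugate functions `p`, `q` near `m` with `p` constant along the leaves and with
`q` generating flows that preserve the foliation. -/
structure IsCanonicalFamily (D : FoliatedModel E ι) (m : E) {κ : Type*} [DecidableEq κ]
    (p q : κ → E → ℝ) : Prop where
  basic : ∀ i, D.IsBasic (p i) m
  smooth : ∀ i, SmoothNear (q i) m
  preserves : ∀ i, ∀ᶠ x in 𝓝 m, D.PreservesBasic (q i) x
  br_qp : ∀ i j, ∀ᶠ x in 𝓝 m, D.br (q i) (p j) x = if i = j then 1 else 0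
  br_qq : ∀ i j, ∀ᶠ x in 𝓝 m, D.br (q i) (q j) x = 0

variable {κ : Type*} [DecidableEq κ] {p q : κ → E → ℝ}

/-- Modification of the remaining functions `q j` when `p k` is replaced by `P`. -/
theorem IsCanonicalFamily.exists_adjusted (h : D.IsCanonicalFamily m p q) (k : κ) {P : E → ℝ}
    (hP : D.IsBasic P m) (hkP : D.br (q k) P m ≠ 0) :
    ∃ r : κ → E → ℝ, (∀ i, SmoothNear (r i) m) ∧
      (∀ i, ∀ᶠ x in 𝓝 m, D.PreservesBasic (r i) x) ∧
      (∀ i, ∀ᶠ x in 𝓝 m, D.br (r i) P x = 0) ∧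
      (∀ i j, j ≠ k → ∀ᶠ x in 𝓝 m, D.br (r i) (p j) x = if i = j then 1 else 0) ∧
      (∀ i j, ∀ᶠ x in 𝓝 m, D.br (r i) (r j) x = 0) ∧
      ∀ i j, (∀ᶠ x in 𝓝 m, D.br (q i) P x = 0) → ∀ᶠ x in 𝓝 m, D.br (q i) (r j) x = 0 := by
  have hc : ∀ j, D.IsBasic (D.br (q j) P) m := fun j =>
    isBasic_br (h.smooth j) (h.preserves j) hP
  have hck := (hc k).1.continuousAt.eventually_ne hkP
  -- The quotient is chosen so that `q j - q k * e j` commutes with `P`. It is basic, so the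
  -- corrected functions still preserve the foliation. For `j = k` it equals 1 near `m`, so the
  -- function `r k` is zero there.
  let e : κ → E → ℝ := fun j x => D.br (q j) P x * (D.br (q k) P x)⁻¹
  have he : ∀ j, D.IsBasic (e j) m := fun j => (hc j).mul ((hc k).inv hkP)
  have heQ : ∀ j, SmoothNear (fun x => q k x * e j x) m := fun j => (h.smooth k).mul (he j).1
  let r : κ → E → ℝ := fun j x => q j x - q k x * e j x
  have hr : ∀ j, SmoothNear (r j) m := fun j => (h.smooth j).sub (heQ j)
  have hrl : ∀ j b, ∀ᶠ x in 𝓝 m,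
      D.br (r j) b x = D.br (q j) b x - (q k x * D.br (e j) b x + e j x * D.br (q k) b x) := by
    intro j b
    filter_upwards [(h.smooth j).eventually, (h.smooth k).eventually, (he j).eventually,
      (heQ j).eventually] with x h1 h2 h3 h4
    rw [br_sub_left h1 h4, br_mul_left h2 h3.1]
  have hrr : ∀ j b, ∀ᶠ x in 𝓝 m,
      D.br b (r j) x = D.br b (q j) x - (q k x * D.br b (e j) x + e j x * D.br b (q k) x) := by
    intro j b
    filter_upwards [hrl j b] with x h1
    rw [D.br_skew, h1, D.br_skew b (q j), D.br_skew b (e j), D.br_skew b (q k)]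
    ring
  have hrP : ∀ i, ∀ᶠ x in 𝓝 m, D.br (r i) P x = 0 := by
    intro i
    filter_upwards [hrl i P, (he i).eventually, hP.eventually, hck] with x h1 h2 h3 h4
    rw [h1, h2.br_eq_zero h3]
    simp only [e]
    field_simp
    ring
  refine ⟨r, hr, ?_, hrP, ?_, ?_, ?_⟩
  · exact fun i => preservesBasic_sub (h.smooth i) (h.preserves i) (heQ i)
      (preservesBasic_mul (he i) (h.smooth k) (h.preserves k))
  · intro i j hj
    filter_upwards [hrl i (p j), (he i).eventually, (h.basic j).eventually, h.br_qp k j,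
      h.br_qp i j] with x h1 h2 h3 h4 h5
    rw [h1, h2.br_eq_zero h3, h4, h5]
    simp [hj.symm]
  · intro i j
    -- Expanding `{r i, r j}` leaves `q k * B` with `B` basic. By Jacobi this commutes with `P`,
    -- whereas its bracket with `P` is `{q k, P} * B`; hence `B = 0`.
    let B : E → ℝ := fun x => D.br (q j) (e i) x - D.br (q i) (e j) x
      + e i x * D.br (q k) (e j) x - e j x * D.br (q k) (e i) x
    have hqe : ∀ i j, D.IsBasic (D.br (q i) (e j)) m := fun i j =>
      isBasic_br (h.smooth i) (h.preserves i) (he j)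
    have hB : D.IsBasic B m := by
      have h1 := ((hqe j i).sub (hqe i j)).sub
        (((he j).mul (hqe k i)).sub ((he i).mul (hqe k j)))
      refine h1.congr (Eventually.of_forall fun x => ?_)
      simp only [B]
      ring
    have hrrB : ∀ᶠ x in 𝓝 m, D.br (r i) (r j) x = q k x * B x := by
      filter_upwards [hrl i (r j), hrr j (q i), hrr j (e i), hrr j (q k), h.br_qq i j,
        h.br_qq i k, h.br_qq k j, (he i).eventually, (he j).eventually] with x h1 h2 h3 h4 h5 h6 h7
        h8 h9
      rw [h1, h2, h3, h4, h5, h6, h7, D.br_self, h8.br_eq_zero h9, D.br_skew (e i) (q j),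
        D.br_skew (e i) (q k)]
      simp only [B]
      ring
    have hrrP : ∀ᶠ x in 𝓝 m, D.br (D.br (r i) (r j)) P x = 0 := by
      filter_upwards [(hr i).eventually, (hr j).eventually, hP.eventually,
        eventually_eventually_nhds.2 (hrP i), eventually_eventually_nhds.2 (hrP j)]
        with x h1 h2 h3 h4 h5
      have := br_jacobi (D := D.toPoissonModel) h1 h2 h3.1
      rw [br_eq_zero_of_const h5, br_eq_zero_of_const h4, add_zero] at this
      exact this.symm
    filter_upwards [hrrB, hrrP, eventually_eventually_nhds.2 hrrB, (h.smooth k).eventually,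
      hB.eventually, hP.eventually, hck] with x h1 h2 h3 h4 h5 h6 h7
    have h8 := PoissonModel.br_congr (D := D.toPoissonModel) h3 (EventuallyEq.refl _ P)
    rw [h2, br_mul_left h4 h5.1, h5.br_eq_zero h6, mul_zero, zero_add] at h8
    rw [h1, (mul_eq_zero.1 h8.symm).resolve_right h7, mul_zero]
  · intro i j hi
    -- If `q i` commutes with `P`, then by Jacobi it commutes with every `{q j, P}`, and thus with
    -- their quotients.
    have hie : ∀ᶠ x in 𝓝 m, D.br (q i) (e j) x = 0 := by
      have h1 : ∀ j, ∀ᶠ x in 𝓝 m, D.br (q i) (D.br (q j) P) x = 0 := by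
        intro j
        filter_upwards [(h.smooth i).eventually, (h.smooth j).eventually, hP.eventually,
          eventually_eventually_nhds.2 hi, eventually_eventually_nhds.2 (h.br_qq i j)]
          with x h1 h2 h3 h4 h5
        rw [br_jacobi h1 h2 h3.1, br_eq_zero_of_const h4, D.br_skew, br_eq_zero_of_const h5]
        simp
      filter_upwards [h1 j, h1 k, (hc j).eventually, (hc k).eventually, hck] with x h2 h3 h4 h5 h6
      rw [br_mul_right h4.1 (h5.1.inv h6), br_inv_right h5.1 h6, h2, h3]
      simp
    filter_upwards [hrr j (q i), hie, h.br_qq i j, h.br_qq i k] with x h1 h2 h3 h4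
    rw [h1, h2, h3, h4]
    simp

end FoliatedModel

namespace LocalAction

open PoissonModel FoliatedModel

variable {E : Type} [NormedAddCommGroup E] [NormedSpace ℝ E] [FiniteDimensional ℝ E]
  {ι : Type} [Fintype ι]
  {D : FoliatedModel E ι} {d : ℕ} {G : Type*} [Group G] [TopologicalSpace G]
  [ChartedSpace (EuclideanSpace ℝ (Fin d)) G] [LieGroup (𝓡 d) ∞ G] {m : E}
  (A : LocalAction D d G m)
  [CompactSpace G] [T2Space G] [MeasurableSpace G] [BorelSpace G]
  {κ : Type*} [DecidableEq κ] {p q : κ → E → ℝ}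

/-- Replacement of a conjugate pair by an invariant conjugate pair. -/
theorem exists_invariant_pair (μ : Measure G) [IsProbabilityMeasure μ] [μ.IsMulLeftInvariant]
    (h : D.IsCanonicalFamily m p q) {t : Finset κ}
    (hp : ∀ i ∈ t, A.Invariant (p i)) (hq : ∀ i ∈ t, A.Invariant (q i)) {k : κ} (hk : k ∉ t) :
    ∃ P Q : E → ℝ, D.IsBasic P m ∧ SmoothNear Q m ∧ (∀ᶠ x in 𝓝 m, D.PreservesBasic Q x) ∧
      A.Invariant P ∧ A.Invariant Q ∧ (∀ᶠ x in 𝓝 m, D.br Q P x = 1) ∧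
      (∀ i ∈ t, ∀ᶠ x in 𝓝 m, D.br (q i) P x = 0) ∧
      (∀ i ∈ t, ∀ᶠ x in 𝓝 m, D.br (q i) Q x = 0) ∧
      (∀ i ∈ t, ∀ᶠ x in 𝓝 m, D.br (p i) Q x = 0) ∧ D.br (q k) P m = 1 := by
  have hne : ∀ i ∈ t, i ≠ k := fun i hi h => hk (h ▸ hi)
  let P := A.avg μ (p k)
  have hP : D.IsBasic P m := A.avg_isBasic μ (h.basic k)
  have hPi : A.Invariant P := A.avg_invariant μ _
  have hkP : D.br (q k) P m = 1 := by
    rw [A.avg_br_base μ (h.basic k).1, (h.br_qp k k).self_of_nhds, if_pos rfl]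
  have hqP : ∀ i ∈ t, ∀ᶠ x in 𝓝 m, D.br (q i) P x = 0 := fun i hi =>
    A.avg_br μ (h.basic k).1 (h.smooth i) (hq i hi) (by simpa [hne i hi] using h.br_qp i k)
  have hc : D.IsBasic (D.br (q k) P) m := isBasic_br (h.smooth k) (h.preserves k) hP
  have hc0 : D.br (q k) P m ≠ 0 := by rw [hkP]; exact one_ne_zero
  have hcev := hc.1.continuousAt.eventually_ne hc0
  have hci := hc.inv hc0
  -- Division by `{q k, P}`, which is basic and equals 1 at `m`, makes the bracket with `P`
  -- constant, so that it survives averaging. The brackets with the invariant `p i` and `q i` are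
  -- zero before averaging, hence also after it.
  let H : E → ℝ := fun x => q k x * (D.br (q k) P x)⁻¹
  have hH : SmoothNear H m := (h.smooth k).mul hci.1
  have hPH : ∀ᶠ x in 𝓝 m, D.br P H x = -1 := by
    filter_upwards [(h.smooth k).eventually, hci.eventually, hP.eventually, hcev] with x h1 h2 h3 h4
    rw [br_mul_right h1 h2.1, h3.br_eq_zero h2, D.br_skew P, mul_zero, zero_add, mul_neg,
      inv_mul_cancel₀ h4]
  refine ⟨P, A.avg μ H, hP, A.avg_smooth μ hH,
    A.avg_preservesBasic μ hH (preservesBasic_mul hci (h.smooth k) (h.preserves k)), hPi,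
    A.avg_invariant μ _, ?_, hqP, ?_, ?_, hkP⟩
  · filter_upwards [A.avg_br μ hH hP.1 hPi hPH] with x hx
    rw [D.br_skew, hx, neg_neg]
  · intro i hi
    refine A.avg_br μ hH (h.smooth i) (hq i hi) ?_
    filter_upwards [(h.smooth i).eventually, (h.smooth k).eventually, hP.eventually,
      hc.eventually, hci.eventually, hcev, eventually_eventually_nhds.2 (hqP i hi),
      eventually_eventually_nhds.2 (h.br_qq i k), h.br_qq i k] with x h1 h2 h3 h4 h5 h6 h7 h8 h9
    rw [br_mul_right h2 h5.1, br_inv_right h4.1 h6, br_jacobi h1 h2 h3.1, br_eq_zero_of_const h7,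
      D.br_skew (D.br (q i) (q k)), br_eq_zero_of_const h8, h9]
    simp
  · intro i hi
    refine A.avg_br μ hH (h.basic i).1 (hp i hi) ?_
    filter_upwards [(h.smooth k).eventually, hci.eventually, (h.basic i).eventually,
      h.br_qp k i] with x h1 h2 h3 h4
    rw [br_mul_right h1 h2.1, h3.br_eq_zero h2, D.br_skew (p i), h4, if_neg (hne i hi).symm]
    simp

/-- The induction step: one more pair of a canonical family is made invariant. -/
theorem exists_invariant_insert (μ : Measure G) [IsProbabilityMeasure μ] [μ.IsMulLeftInvariant]
    (h : D.IsCanonicalFamily m p q) {t : Finset κ}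
    (hp : ∀ i ∈ t, A.Invariant (p i)) (hq : ∀ i ∈ t, A.Invariant (q i)) {k : κ} (hk : k ∉ t) :
    ∃ p' q' : κ → E → ℝ, D.IsCanonicalFamily m p' q' ∧
      (∀ i ∈ insert k t, A.Invariant (p' i)) ∧ ∀ i ∈ insert k t, A.Invariant (q' i) := by
  obtain ⟨P, Q, hP, hQ, hQB, hPi, hQi, hQP, hqP, hqQ, hpQ, hkP⟩ :=
    A.exists_invariant_pair μ h hp hq hk
  obtain ⟨r, hr, hrB, hrP, hrp, hrr, hqr⟩ :=
    h.exists_adjusted k hP (by rw [hkP]; exact one_ne_zero)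
  obtain ⟨π, hπ⟩ := exists_isRetraction (ham_smooth (D := D.toPoissonModel) hQ) hP.1 hQP
  have hne : ∀ i ∈ t, i ≠ k := fun i hi h => hk (h ▸ hi)
  have hbb : ∀ {a b : E → ℝ}, D.IsBasic a m → D.IsBasic b m → ∀ᶠ x in 𝓝 m, D.br a b x = 0 := by
    intro a b ha hb
    filter_upwards [ha.eventually, hb.eventually] with x h1 h2 using h1.br_eq_zero h2
  have hskew : ∀ {a b : E → ℝ}, (∀ᶠ x in 𝓝 m, D.br a b x = 0) → ∀ᶠ x in 𝓝 m, D.br b a x = 0 := by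
    intro a b hab
    filter_upwards [hab] with x hx
    rw [D.br_skew, hx, neg_zero]
  -- Commutation with `a` passes to the composition with the retraction if `a` commutes with `P` and
  -- has constant bracket with `Q`.
  have hcomp : ∀ {a b : E → ℝ}, SmoothNear a m → SmoothNear b m → ∀ {c : ℝ},
      (∀ᶠ x in 𝓝 m, D.br a Q x = c) → (∀ᶠ x in 𝓝 m, D.br a P x = 0) →
      (∀ᶠ x in 𝓝 m, D.br a b x = 0) → ∀ᶠ x in 𝓝 m, D.br a (fun x => b (π x)) x = 0 := by
    intro a b ha hb c hc h0 hab
    filter_upwards [br_comp_retraction_of_const hπ hQ ha hb hc h0,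
      (tendsto_retraction hπ).eventually hab] with x h1 h2
    rw [h1, h2]
  have hPQ : ∀ᶠ x in 𝓝 m, D.br P Q x = -1 := by
    filter_upwards [hQP] with x hx
    rw [D.br_skew, hx]
  have hPP : ∀ᶠ x in 𝓝 m, D.br P P x = 0 := Eventually.of_forall fun x => D.br_self P x
  -- The invariant pairs stay untouched, the pair `k` becomes `(P, Q)`, and the remaining functions
  -- are composed with the retraction so that they commute with `Q`; the `q`-functions among them
  -- are first replaced by the adjusted `r i`.
  let p' : κ → E → ℝ := fun i =>
    if i ∈ t then p i else if i = k then P else fun x => p i (π x)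
  let q' : κ → E → ℝ := fun i =>
    if i ∈ t then q i else if i = k then Q else fun x => r i (π x)
  have p1 : ∀ i ∈ t, p' i = p i := fun i hi => if_pos hi
  have q1 : ∀ i ∈ t, q' i = q i := fun i hi => if_pos hi
  have p2 : p' k = P := by simp [p', hk]
  have q2 : q' k = Q := by simp [q', hk]
  have p3 : ∀ i, i ∉ t → i ≠ k → p' i = fun x => p i (π x) := fun i hi hik => by
    simp only [p', if_neg hi, if_neg hik]
  have q3 : ∀ i, i ∉ t → i ≠ k → q' i = fun x => r i (π x) := fun i hi hik => by
    simp only [q', if_neg hi, if_neg hik]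
  have hcases : ∀ i, i ∈ t ∨ i = k ∨ (i ∉ t ∧ i ≠ k) := fun i => by tauto
  refine ⟨p', q', ⟨?_, ?_, ?_, ?_, ?_⟩, ?_, ?_⟩
  · intro i
    obtain hi | rfl | ⟨hi, hik⟩ := hcases i
    · exact p1 i hi ▸ h.basic i
    · exact p2 ▸ hP
    · exact p3 i hi hik ▸ (h.basic i).comp_retraction hπ hQ hQB hP hQP
  · intro i
    obtain hi | rfl | ⟨hi, hik⟩ := hcases i
    · exact q1 i hi ▸ h.smooth i
    · exact q2 ▸ hQ
    · exact q3 i hi hik ▸ smooth_comp_retraction hπ (hr i)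
  · intro i
    obtain hi | rfl | ⟨hi, hik⟩ := hcases i
    · exact q1 i hi ▸ h.preserves i
    · exact q2 ▸ hQB
    · exact q3 i hi hik ▸ preservesBasic_comp_retraction (hr i) (hrB i) (hrP i) hπ hQ hQB hP hQP
  · intro i j
    obtain hi | rfl | ⟨hi, hik⟩ := hcases i <;> obtain hj | rfl | ⟨hj, hjk⟩ := hcases j
    · rw [q1 i hi, p1 j hj]
      exact h.br_qp i j
    · rw [q1 i hi, p2, if_neg (hne i hi)]
      exact hqP i hi
    · have hij : i ≠ j := fun hij => hj (hij ▸ hi)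
      rw [q1 i hi, p3 j hj hjk, if_neg hij]
      exact hcomp (h.smooth i) (h.basic j).1 (hqQ i hi) (hqP i hi)
        (by simpa [hij] using h.br_qp i j)
    · rw [q2, p1 j hj, if_neg (hne j hj).symm]
      exact hskew (hpQ j hj)
    · rw [q2, p2, if_pos rfl]
      exact hQP
    · rw [q2, p3 j hj hjk, if_neg hjk.symm]
      exact br_comp_retraction hπ (h.basic j).1
    · have hij : j ≠ i := fun hij => hi (hij ▸ hj)
      rw [q3 i hi hik, p1 j hj, if_neg hij.symm]
      exact hskew (hcomp (h.basic j).1 (hr i) (hpQ j hj) (hbb (h.basic j) hP)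
        (hskew (by simpa [hij.symm] using hrp i j (hne j hj))))
    · rw [q3 i hi hik, p2, if_neg hik]
      exact hskew (hcomp hP.1 (hr i) hPQ hPP (hskew (hrP i)))
    · rw [q3 i hi hik, p3 j hj hjk]
      filter_upwards [br_comp_comp_retraction hπ hQ (hr i) (h.basic j).1 (hrP i)
        (hbb (h.basic j) hP), (tendsto_retraction hπ).eventually (hrp i j hjk)] with x h1 h2
      rw [h1, h2]
  · intro i j
    obtain hi | rfl | ⟨hi, hik⟩ := hcases i <;> obtain hj | rfl | ⟨hj, hjk⟩ := hcases j
    · rw [q1 i hi, q1 j hj]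
      exact h.br_qq i j
    · rw [q1 i hi, q2]
      exact hqQ i hi
    · rw [q1 i hi, q3 j hj hjk]
      exact hcomp (h.smooth i) (hr j) (hqQ i hi) (hqP i hi) (hqr i j (hqP i hi))
    · rw [q2, q1 j hj]
      exact hskew (hqQ j hj)
    · exact Eventually.of_forall fun x => D.br_self _ x
    · rw [q2, q3 j hj hjk]
      exact br_comp_retraction hπ (hr j)
    · rw [q3 i hi hik, q1 j hj]
      exact hskew (hcomp (h.smooth j) (hr i) (hqQ j hj) (hqP j hj) (hqr j i (hqP j hj)))
    · rw [q3 i hi hik, q2]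
      exact hskew (br_comp_retraction hπ (hr i))
    · rw [q3 i hi hik, q3 j hj hjk]
      filter_upwards [br_comp_comp_retraction hπ hQ (hr i) (hr j) (hrP i) (hrP j),
        (tendsto_retraction hπ).eventually (hrr i j)] with x h1 h2
      rw [h1, h2]
  · intro i hi
    rcases Finset.mem_insert.1 hi with rfl | hi
    · exact p2 ▸ hPi
    · exact p1 i hi ▸ hp i hi
  · intro i hi
    rcases Finset.mem_insert.1 hi with rfl | hi
    · exact q2 ▸ hQi
    · exact q1 i hi ▸ hq i hi

/-- A canonical family can be replaced by an invariant one. -/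
theorem exists_invariant_family [Fintype κ] (μ : Measure G) [IsProbabilityMeasure μ]
    [μ.IsMulLeftInvariant] (h : D.IsCanonicalFamily m p q) :
    ∃ p' q' : κ → E → ℝ, D.IsCanonicalFamily m p' q' ∧
      (∀ i, A.Invariant (p' i)) ∧ ∀ i, A.Invariant (q' i) := by
  suffices H : ∀ t : Finset κ, ∃ p' q' : κ → E → ℝ, D.IsCanonicalFamily m p' q' ∧
      (∀ i ∈ t, A.Invariant (p' i)) ∧ ∀ i ∈ t, A.Invariant (q' i) by
    obtain ⟨p', q', h', hp', hq'⟩ := H Finset.univ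
    exact ⟨p', q', h', fun i => hp' i (Finset.mem_univ i), fun i => hq' i (Finset.mem_univ i)⟩
  intro t
  induction t using Finset.induction_on with
  | empty => exact ⟨p, q, h, by simp, by simp⟩
  | insert k t hk ih =>
    obtain ⟨p', q', h', hp', hq'⟩ := ih
    exact A.exists_invariant_insert μ h' hp' hq' hk

end LocalAction

end PoissonGeom

end

/-! ### Linear algebra at the base point and functions commuting with a family. -/

noncomputable section

open scoped Manifold ContDiff Topology
open Filter Set MeasureTheory

set_option linter.unusedSectionVars false

namespace PoissonGeom

section LinearAlgebra

variable {V : Type*} [AddCommGroup V] [Module ℝ V] [FiniteDimensional ℝ V]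

theorem exists_linearMap_ker_eq (T : Submodule ℝ V) {k : ℕ}
    (hk : Module.finrank ℝ V = Module.finrank ℝ T + k) :
    ∃ L : V →ₗ[ℝ] Fin k → ℝ, LinearMap.ker L = T := by
  have h := T.finrank_quotient_add_finrank
  have e : (V ⧸ T) ≃ₗ[ℝ] (Fin k → ℝ) := LinearEquiv.ofFinrankEq _ _ (by simp; omega)
  refine ⟨e.toLinearMap ∘ₗ T.mkQ, ?_⟩
  rw [LinearEquiv.ker_comp, Submodule.ker_mkQ]

/-- Linear coordinates modulo `S` that are adapted to a larger subspace `T`. -/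
theorem exists_adapted_linearMap {S T : Submodule ℝ V} (hST : S ≤ T) {s b : ℕ}
    (hs : Module.finrank ℝ V = Module.finrank ℝ S + s)
    (hb : Module.finrank ℝ V = Module.finrank ℝ T + b) :
    ∃ L : V →ₗ[ℝ] Fin s → ℝ, LinearMap.ker L = S ∧
      ∀ v, v ∈ T ↔ ∀ j : Fin s, (j : ℕ) < b → L v j = 0 := by
  have hle := Submodule.finrank_mono hST
  -- By the modular law `S` is the intersection of `T` with `S ⊔ C`. Linear coordinates modulo `T`
  -- and modulo `S ⊔ C` together therefore have kernel `S`; the former are the first `b` entries.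
  obtain ⟨C, hC⟩ := T.exists_isCompl
  have hinf : (S ⊔ C) ⊓ T = S := by
    rw [sup_inf_assoc_of_le C hST, hC.symm.inf_eq_bot, sup_bot_eq]
  have hsup : (S ⊔ C) ⊔ T = ⊤ :=
    top_unique (hC.symm.sup_eq_top ▸ sup_le_sup_right le_sup_right T)
  have hdim := Submodule.finrank_sup_add_finrank_inf_eq (S ⊔ C) T
  rw [hinf, hsup, finrank_top] at hdim
  obtain ⟨L₁, hL₁⟩ := exists_linearMap_ker_eq T hb
  obtain ⟨L₂, hL₂⟩ := exists_linearMap_ker_eq (S ⊔ C) (k := s - b) (by omega)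
  let L : V →ₗ[ℝ] Fin s → ℝ := LinearMap.pi fun j =>
    if h : (j : ℕ) < b then LinearMap.proj ⟨j, h⟩ ∘ₗ L₁
    else LinearMap.proj ⟨j - b, by omega⟩ ∘ₗ L₂
  have hT : ∀ v, v ∈ T ↔ ∀ j : Fin s, (j : ℕ) < b → L v j = 0 := by
    intro v
    rw [← hL₁, LinearMap.mem_ker]
    constructor
    · intro h j hj
      simp [L, hj, h]
    · intro h
      ext j
      simpa [L] using h ⟨j, by omega⟩ j.2
  refine ⟨L, ?_, hT⟩
  ext v
  rw [← hinf, Submodule.mem_inf, ← hL₂, hT, LinearMap.mem_ker, LinearMap.mem_ker]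
  constructor
  · intro h
    refine ⟨?_, fun j _ => congrFun h j⟩
    ext j
    simpa [L] using congrFun h ⟨j + b, by omega⟩
  · rintro ⟨h1, h2⟩
    ext j
    by_cases hj : (j : ℕ) < b
    · exact h2 j hj
    · simp [L, hj, h1]

end LinearAlgebra

namespace FoliatedModel

open PoissonModel

universe u

variable {E : Type u} [NormedAddCommGroup E] [NormedSpace ℝ E] [FiniteDimensional ℝ E]
  {ι : Type} [Fintype ι] {D : FoliatedModel E ι} {m : E}
  {κ : Type*} [DecidableEq κ] {p q : κ → E → ℝ}

variable (D) in
/-- The span at `m` of the Hamiltonian vector fields of the functions `y i`. -/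
def hamSpan (y : κ → E → ℝ) (m : E) : Submodule ℝ E := Submodule.span ℝ (range fun i => D.ham (y i) m)

namespace IsCanonicalFamily

theorem br_pq (h : D.IsCanonicalFamily m p q) (i j : κ) :
    ∀ᶠ x in 𝓝 m, D.br (p i) (q j) x = -(if j = i then 1 else 0) := by
  filter_upwards [h.br_qp j i] with x hx
  rw [D.br_skew, hx]

theorem br_pp (h : D.IsCanonicalFamily m p q) (i j : κ) :
    ∀ᶠ x in 𝓝 m, D.br (p i) (p j) x = 0 := by
  filter_upwards [(h.basic i).eventually, (h.basic j).eventually] with x h1 h2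
    using h1.br_eq_zero h2

variable [Fintype κ]

/-- The matrix of brackets of a canonical family is nondegenerate: `dp j` reads off `b j`, and `dq
j` reads off `- a j`. -/
theorem eq_zero_of_sum (h : D.IsCanonicalFamily m p q) {a b : κ → ℝ}
    (hp : ∀ j, fderiv ℝ (p j) m (∑ i, a i • D.ham (p i) m + ∑ i, b i • D.ham (q i) m) = 0)
    (hq : ∀ j, fderiv ℝ (q j) m (∑ i, a i • D.ham (p i) m + ∑ i, b i • D.ham (q i) m) = 0) :
    a = 0 ∧ b = 0 := by
  have h1 : ∀ i j, fderiv ℝ (p j) m (D.ham (p i) m) = 0 := fun i j => (h.br_pp i j).self_of_nhds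
  have h2 : ∀ i j, fderiv ℝ (p j) m (D.ham (q i) m) = if i = j then 1 else 0 := fun i j =>
    (h.br_qp i j).self_of_nhds
  have h3 : ∀ i j, fderiv ℝ (q j) m (D.ham (p i) m) = -(if j = i then 1 else 0) := fun i j =>
    (h.br_pq i j).self_of_nhds
  have h4 : ∀ i j, fderiv ℝ (q j) m (D.ham (q i) m) = 0 := fun i j => (h.br_qq i j).self_of_nhds
  simp only [map_add, map_sum, map_smul, h1, h2, h3, h4, smul_eq_mul, mul_zero, mul_neg, mul_ite,
    mul_one, Finset.sum_const_zero, zero_add, add_zero, Finset.sum_ite_eq', Finset.mem_univ,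
    if_true, Finset.sum_neg_distrib, Finset.sum_ite_eq, neg_eq_zero] at hp hq
  exact ⟨funext hq, funext hp⟩

theorem eq_zero_of_mem_hamSpan (h : D.IsCanonicalFamily m p q) {v : E}
    (hv : v ∈ D.hamSpan p m ⊔ D.hamSpan q m) (hp : ∀ j, fderiv ℝ (p j) m v = 0)
    (hq : ∀ j, fderiv ℝ (q j) m v = 0) : v = 0 := by
  obtain ⟨x, hx, y, hy, rfl⟩ := Submodule.mem_sup.1 hv
  obtain ⟨a, rfl⟩ := (Submodule.mem_span_range_iff_exists_fun ℝ).1 hx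
  obtain ⟨b, rfl⟩ := (Submodule.mem_span_range_iff_exists_fun ℝ).1 hy
  obtain ⟨rfl, rfl⟩ := h.eq_zero_of_sum hp hq
  simp

theorem finrank_hamSpan_q (h : D.IsCanonicalFamily m p q) :
    Module.finrank ℝ (D.hamSpan q m) = Fintype.card κ := by
  refine finrank_span_eq_card (Fintype.linearIndependent_iff.2 fun b hb => ?_)
  have := (h.eq_zero_of_sum (a := 0) (b := b) (by simp [hb]) (by simp [hb])).2
  exact fun i => congrFun this i

theorem finrank_hamSpan (h : D.IsCanonicalFamily m p q) :
    Module.finrank ℝ ↥(D.hamSpan p m ⊔ D.hamSpan q m) = 2 * Fintype.card κ := by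
  have : D.hamSpan p m ⊔ D.hamSpan q m =
      Submodule.span ℝ (range (Sum.elim (fun i => D.ham (p i) m) fun i => D.ham (q i) m)) := by
    rw [Set.Sum.elim_range, Submodule.span_union, hamSpan, hamSpan]
  rw [this, finrank_span_eq_card, Fintype.card_sum, two_mul]
  refine Fintype.linearIndependent_iff.2 fun b hb => ?_
  simp only [Fintype.sum_sum_type, Sum.elim_inl, Sum.elim_inr] at hb
  have := h.eq_zero_of_sum (a := fun i => b (Sum.inl i)) (b := fun i => b (Sum.inr i))
    (by simp [hb]) (by simp [hb])
  rintro (i | i)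
  exacts [congrFun this.1 i, congrFun this.2 i]

/-- The sum of the tangent space of the foliation and of the span of the Hamiltonian vector fields
of a canonical family. -/
theorem finrank_ker_sup (h : D.IsCanonicalFamily m p q) {b : ℕ}
    (hb : Fintype.card ι = Fintype.card κ + b) :
    Module.finrank ℝ E = Module.finrank ℝ ↥(LinearMap.ker (fderiv ℝ D.F m : E →ₗ[ℝ] ι → ℝ) ⊔
      (D.hamSpan p m ⊔ D.hamSpan q m)) + b := by
  let K := LinearMap.ker (fderiv ℝ D.F m : E →ₗ[ℝ] ι → ℝ)
  have hK : ∀ v, v ∈ K ↔ fderiv ℝ D.F m v = 0 := fun v => LinearMap.mem_ker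
  have hpK : D.hamSpan p m ≤ K := by
    refine Submodule.span_le.2 ?_
    rintro _ ⟨i, rfl⟩
    obtain ⟨ℓ, hℓ⟩ := (h.basic i).exists_fderiv
    rw [SetLike.mem_coe, hK]
    change fderiv ℝ D.F m (D.sharp m (fderiv ℝ (p i) m)) = 0
    rw [hℓ, fderiv_F_sharp]
  have hpv : ∀ j v, v ∈ K → fderiv ℝ (p j) m v = 0 := fun j v hv =>
    (h.basic j).2.self_of_nhds v ((hK v).1 hv)
  -- The Hamiltonian vectors of the `p i` lie in the leaf directions `K`. Those of the `q i` are
  -- independent modulo `K`, because the `dp j` vanish on `K` and separate them. The sum thus has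
  -- dimension `dim K + card κ`.
  have hdisj : K ⊓ D.hamSpan q m = ⊥ := by
    refine (Submodule.eq_bot_iff _).2 fun v ⟨hv, hvq⟩ => ?_
    obtain ⟨b, rfl⟩ := (Submodule.mem_span_range_iff_exists_fun ℝ).1 hvq
    refine h.eq_zero_of_mem_hamSpan ((le_sup_right : D.hamSpan q m ≤ _) hvq)
      (fun j => hpv j _ hv) fun j => ?_
    rw [map_sum]
    refine Finset.sum_eq_zero fun i _ => ?_
    rw [map_smul, show fderiv ℝ (q j) m (D.ham (q i) m) = 0 from (h.br_qq i j).self_of_nhds,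
      smul_zero]
  have hsup : K ⊔ (D.hamSpan p m ⊔ D.hamSpan q m) = K ⊔ D.hamSpan q m := by
    rw [← sup_assoc, sup_eq_left.2 hpK]
  have h1 := Submodule.finrank_sup_add_finrank_inf_eq K (D.hamSpan q m)
  rw [hdisj, finrank_bot, h.finrank_hamSpan_q] at h1
  have h2 := (fderiv ℝ D.F m : E →ₗ[ℝ] ι → ℝ).finrank_range_add_finrank_ker
  rw [LinearMap.range_eq_top.2 (D.surj m), finrank_top, Module.finrank_pi] at h2
  have h3 : Module.finrank ℝ K =
    Module.finrank ℝ (LinearMap.ker (fderiv ℝ D.F m : E →ₗ[ℝ] ι → ℝ)) := rfl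
  change _ = Module.finrank ℝ ↥(K ⊔ (D.hamSpan p m ⊔ D.hamSpan q m)) + b
  rw [hsup]
  omega

/-- A covector that annihilates the Hamiltonian vector fields of a canonical family is the
derivative of a function that commutes with the family. -/
theorem exists_commuting (h : D.IsCanonicalFamily m p q) (α : E →L[ℝ] ℝ)
    (hp : ∀ i, α (D.ham (p i) m) = 0) (hq : ∀ i, α (D.ham (q i) m) = 0) :
    ∃ k : E → ℝ, SmoothNear k m ∧ (∀ i, ∀ᶠ x in 𝓝 m, D.br (p i) k x = 0) ∧
      (∀ i, ∀ᶠ x in 𝓝 m, D.br (q i) k x = 0) ∧ fderiv ℝ k m = α := by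
  -- The joint family `(q, p)` has the dual functions `(p, -q)`, so the linear function `α` can be
  -- corrected to commute with all of it.
  let a : κ ⊕ κ → E → ℝ := Sum.elim q p
  let u : κ ⊕ κ → E → ℝ := Sum.elim p fun i x => - q i x
  have ha : ∀ i ∈ Finset.univ, SmoothNear (a i) m := by
    rintro (i | i) -
    exacts [h.smooth i, (h.basic i).1]
  have hu : ∀ i ∈ Finset.univ, SmoothNear (u i) m := by
    rintro (i | i) -
    exacts [(h.basic i).1, (h.smooth i).neg]
  have hau : ∀ i ∈ Finset.univ, ∀ j ∈ Finset.univ,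
      ∀ᶠ x in 𝓝 m, D.br (a i) (u j) x = if i = j then 1 else 0 := by
    rintro (i | i) - (j | j) -
    · simpa [a, u] using h.br_qp i j
    · filter_upwards [h.br_qq i j] with x hx
      simp only [a, u, Sum.elim_inl, Sum.elim_inr, br_neg_right, hx]
      simp
    · simpa [a, u] using h.br_pp i j
    · filter_upwards [h.br_pq i j] with x hx
      simp only [a, u, Sum.elim_inr, br_neg_right, hx, neg_neg]
      simp [eq_comm]
  have haa : ∀ i ∈ Finset.univ, ∀ j ∈ Finset.univ, ∃ c, ∀ᶠ x in 𝓝 m, D.br (a i) (a j) x = c := by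
    rintro (i | i) - (j | j) -
    exacts [⟨_, h.br_qq i j⟩, ⟨_, h.br_qp i j⟩, ⟨_, h.br_pq i j⟩, ⟨_, h.br_pp i j⟩]
  have hα : ∀ i ∈ Finset.univ, D.br (a i) α m = 0 := by
    rintro (i | i) - <;> rw [br_eq, α.fderiv]
    exacts [hq i, hp i]
  obtain ⟨k, -, hk, hak, hdk, -⟩ := exists_commuting_correction (D := D.toPoissonModel) (m := m)
    Finset.univ a u ha hu hau haa (fun _ => True) (fun _ _ _ _ _ _ => trivial) α
    (smoothNear_of_contDiff α.contDiff m) trivial hα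
  refine ⟨k, hk, fun i => hak (Sum.inr i) (Finset.mem_univ _),
    fun i => hak (Sum.inl i) (Finset.mem_univ _), ?_⟩
  rw [hdk, α.fderiv]

/-- A covector that annihilates the tangent space of the foliation and the Hamiltonian vector
fields of a canonical family is the derivative of a basic function that commutes with the family. -/
theorem exists_commuting_basic (h : D.IsCanonicalFamily m p q) (α : E →L[ℝ] ℝ)
    (hF : ∀ v, fderiv ℝ D.F m v = 0 → α v = 0) (hq : ∀ i, α (D.ham (q i) m) = 0) :
    ∃ k : E → ℝ, D.IsBasic k m ∧ (∀ i, ∀ᶠ x in 𝓝 m, D.br (p i) k x = 0) ∧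
      (∀ i, ∀ᶠ x in 𝓝 m, D.br (q i) k x = 0) ∧ fderiv ℝ k m = α := by
  obtain ⟨R, hR⟩ := LinearMap.exists_rightInverse_of_surjective
    (fderiv ℝ D.F m : E →ₗ[ℝ] ι → ℝ) (LinearMap.range_eq_top.2 (D.surj m))
  have hRv : ∀ w, fderiv ℝ D.F m (R w) = w := fun w => LinearMap.congr_fun hR w
  -- A covector that annihilates the leaf directions factors through `dF`, so it is the differential
  -- of a basic function that is linear in `F`.
  let ℓ : (ι → ℝ) →L[ℝ] ℝ := α.comp (LinearMap.toContinuousLinearMap R)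
  have hℓ : ℓ.comp (fderiv ℝ D.F m) = α := by
    ext v
    have := hF (R (fderiv ℝ D.F m v) - v) (by rw [map_sub, hRv, sub_self])
    rw [map_sub, sub_eq_zero] at this
    exact this
  let b : E → ℝ := fun x => ℓ (D.F x)
  have hb : D.IsBasic b m :=
    IsBasic.comp (g := ℓ) (smoothNear_of_contDiff ℓ.contDiff _) isBasic_F
  have hdb : fderiv ℝ b m = α :=
    (ℓ.hasFDerivAt.comp m (isBasic_F (D := D) (x := m)).1.differentiableAt.hasFDerivAt).fderiv.trans
      hℓ
  -- Only the brackets with the `q i` need correction, since basic functions commute with the `p i`.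
  -- Retracting along the `q i` keeps the function basic.
  obtain ⟨k, hkb, -, hqk, hdk, -⟩ := exists_commuting_correction (D := D.toPoissonModel) (m := m)
    Finset.univ q p (fun i _ => h.smooth i) (fun i _ => (h.basic i).1)
    (fun i _ j _ => h.br_qp i j) (fun i _ j _ => ⟨0, h.br_qq i j⟩) (fun b => D.IsBasic b m)
    (fun i _ π hπ b hb => hb.comp_retraction hπ (h.smooth i) (h.preserves i) (h.basic i)
      (by simpa using h.br_qp i i)) b hb.1 hb (fun i _ => by rw [br_eq, hdb]; exact hq i)
  refine ⟨k, hkb, fun i => ?_, fun i => hqk i (Finset.mem_univ i), hdk.trans hdb⟩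
  filter_upwards [(h.basic i).eventually, hkb.eventually] with x h1 h2 using h1.br_eq_zero h2

end IsCanonicalFamily

end FoliatedModel

end PoissonGeom

end

/-! ### Transverse coordinates and linearisation of the action. -/

noncomputable section

open scoped Manifold ContDiff Topology
open Filter Set MeasureTheory

set_option linter.unusedSectionVars false

namespace PoissonGeom

namespace FoliatedModel

open PoissonModel

universe u

variable {E : Type u} [NormedAddCommGroup E] [NormedSpace ℝ E] [FiniteDimensional ℝ E]
  {ι : Type} [Fintype ι] {D : FoliatedModel E ι} {m : E}
  {κ : Type*} [Fintype κ] [DecidableEq κ] {p q : κ → E → ℝ}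

/-- Coordinates transverse to a canonical family: they commute with the family and the first `b` of
them are constant along the leaves of the foliation. -/
structure IsTransverse (D : FoliatedModel E ι) (m : E) (p q : κ → E → ℝ) {s : ℕ} (b : ℕ)
    (z : E → Fin s → ℝ) : Prop where
  smooth : SmoothNear z m
  base : z m = 0
  ham_p : ∀ i, ∀ᶠ x in 𝓝 m, fderiv ℝ z x (D.ham (p i) x) = 0
  ham_q : ∀ i, ∀ᶠ x in 𝓝 m, fderiv ℝ z x (D.ham (q i) x) = 0
  foliation : ∀ᶠ x in 𝓝 m, ∀ v, fderiv ℝ D.F x v = 0 →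
    ∀ j : Fin s, (j : ℕ) < b → fderiv ℝ z x v j = 0
  mem_ker : ∀ v, fderiv ℝ z m v = 0 ↔ v ∈ D.hamSpan p m ⊔ D.hamSpan q m
  mem_sup : ∀ v, (∀ j : Fin s, (j : ℕ) < b → fderiv ℝ z m v j = 0) ↔
    v ∈ LinearMap.ker (fderiv ℝ D.F m : E →ₗ[ℝ] ι → ℝ) ⊔ (D.hamSpan p m ⊔ D.hamSpan q m)

/-- Linear coordinates modulo the Hamiltonian vectors are adapted to the sum of these with the leaf
directions. All the covectors are differentials of functions commuting with the family, and the
first `b` annihilate the leaves, so they come from basic functions. -/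
theorem IsCanonicalFamily.exists_isTransverse (h : D.IsCanonicalFamily m p q) {s b : ℕ}
    (hs : Module.finrank ℝ E = 2 * Fintype.card κ + s)
    (hb : Fintype.card ι = Fintype.card κ + b) :
    ∃ z : E → Fin s → ℝ, D.IsTransverse m p q b z := by
  obtain ⟨L, hL, hLT⟩ := exists_adapted_linearMap
    (S := D.hamSpan p m ⊔ D.hamSpan q m)
    (T := LinearMap.ker (fderiv ℝ D.F m : E →ₗ[ℝ] ι → ℝ) ⊔ (D.hamSpan p m ⊔ D.hamSpan q m))
    le_sup_right (by rw [h.finrank_hamSpan, hs]) (h.finrank_ker_sup hb)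
  have hS : ∀ v, L v = 0 ↔ v ∈ D.hamSpan p m ⊔ D.hamSpan q m := fun v => by
    rw [← hL, LinearMap.mem_ker]
  let α : Fin s → E →L[ℝ] ℝ := fun j => LinearMap.toContinuousLinearMap (LinearMap.proj j ∘ₗ L)
  have hα : ∀ j v, α j v = L v j := fun j v => rfl
  have hαp : ∀ j i, α j (D.ham (p i) m) = 0 := fun j i => by
    rw [hα, (hS _).2 (Submodule.mem_sup_left (Submodule.subset_span ⟨i, rfl⟩))]
    rfl
  have hαq : ∀ j i, α j (D.ham (q i) m) = 0 := fun j i => by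
    rw [hα, (hS _).2 (Submodule.mem_sup_right (Submodule.subset_span ⟨i, rfl⟩))]
    rfl
  have H : ∀ j : Fin s, ∃ k : E → ℝ, SmoothNear k m ∧ (∀ i, ∀ᶠ x in 𝓝 m, D.br (p i) k x = 0) ∧
      (∀ i, ∀ᶠ x in 𝓝 m, D.br (q i) k x = 0) ∧ fderiv ℝ k m = α j ∧
      ((j : ℕ) < b → D.IsBasic k m) := by
    intro j
    by_cases hj : (j : ℕ) < b
    · obtain ⟨k, h1, h2, h3, h4⟩ := h.exists_commuting_basic (α j)
        (fun v hv => (hLT v).1 (Submodule.mem_sup_left (LinearMap.mem_ker.2 hv)) j hj) (hαq j)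
      exact ⟨k, h1.1, h2, h3, h4, fun _ => h1⟩
    · obtain ⟨k, h1, h2, h3, h4⟩ := h.exists_commuting (α j) (hαp j) (hαq j)
      exact ⟨k, h1, h2, h3, h4, fun h => absurd h hj⟩
  choose k hk hpk hqk hdk hkb using H
  let z : E → Fin s → ℝ := fun x j => k j x - k j m
  have hz : SmoothNear z m := smoothNear_pi.2 fun j => (hk j).sub (smoothNear_const _ _)
  have hdz : ∀ᶠ x in 𝓝 m, ∀ v j, fderiv ℝ z x v j = fderiv ℝ (k j) x v := by
    filter_upwards [hz.eventually] with x hx v j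
    rw [fderiv_pi_apply hx.differentiableAt]
    exact congrArg (fun T : E →L[ℝ] ℝ => T v) (fderiv_sub_const _)
  have hdzm : ∀ v, fderiv ℝ z m v = L v := fun v => by
    ext j
    rw [hdz.self_of_nhds, hdk, hα]
  refine ⟨z, hz, by simp [z, Pi.zero_def], fun i => ?_, fun i => ?_, ?_, fun v => ?_, fun v => ?_⟩
  · filter_upwards [hdz, eventually_all.2 fun j => hpk j i] with x h1 h2
    ext j
    rw [h1]
    exact h2 j
  · filter_upwards [hdz, eventually_all.2 fun j => hqk j i] with x h1 h2
    ext j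
    rw [h1]
    exact h2 j
  · filter_upwards [hdz, eventually_all.2 fun j => eventually_imp_distrib_left.2
      fun hj => (hkb j hj).2] with x h1 h2 v hv j hj
    rw [h1]
    exact h2 j hj v hv
  · rw [hdzm, hS]
  · simp only [hdzm, hLT]

end FoliatedModel

namespace LocalAction

open PoissonModel FoliatedModel

variable {E : Type} [NormedAddCommGroup E] [NormedSpace ℝ E] [FiniteDimensional ℝ E]
  {ι : Type} [Fintype ι]
  {D : FoliatedModel E ι} {d : ℕ} {G : Type*} [Group G] [TopologicalSpace G]
  [ChartedSpace (EuclideanSpace ℝ (Fin d)) G] [LieGroup (𝓡 d) ∞ G] {m : E}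
  (A : LocalAction D d G m)

theorem fderiv_act_mul (g h : G) :
    fderiv ℝ (A.act (g * h)) m = (fderiv ℝ (A.act g) m).comp (fderiv ℝ (A.act h) m) := by
  have h1 : A.act (g * h) =ᶠ[𝓝 m] A.act g ∘ A.act h := by
    filter_upwards [A.eventually_mem A.mem] with x hx using A.mul g h x hx
  rw [h1.fderiv_eq]
  have h2 := (A.differentiableAt h A.mem).hasFDerivAt
  have h3 : HasFDerivAt (A.act g) (fderiv ℝ (A.act g) m) (A.act h m) := by
    rw [A.base]
    exact (A.differentiableAt g A.mem).hasFDerivAt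
  exact (h3.comp m h2).fderiv

theorem fderiv_act_one : fderiv ℝ (A.act 1) m = ContinuousLinearMap.id ℝ E := by
  have h1 : A.act 1 =ᶠ[𝓝 m] id := by
    filter_upwards [A.eventually_mem A.mem] with x hx using A.one x hx
  rw [h1.fderiv_eq, fderiv_id]

theorem contMDiff_fderiv_act :
    ContMDiff (𝓡 d) 𝓘(ℝ, E →L[ℝ] E) ∞ fun g => fderiv ℝ (A.act g) m := by
  have h1 := A.smooth.fderiv_snd A.isOpen
  have h2 : ContMDiffOn (𝓡 d) ((𝓡 d).prod 𝓘(ℝ, E)) ∞ (fun g : G => (g, m)) univ :=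
    (contMDiff_id.prodMk contMDiff_const).contMDiffOn
  exact contMDiffOn_univ.1 (h1.comp h2 fun g _ => ⟨mem_univ _, A.mem⟩)

variable {κ : Type*} [Fintype κ] [DecidableEq κ] {p q : κ → E → ℝ}

/-- Linearisation of the action in the transverse coordinates by averaging. -/
theorem exists_linear_isTransverse [CompactSpace G] [T2Space G] [MeasurableSpace G] [BorelSpace G]
    (μ : Measure G) [IsProbabilityMeasure μ] [μ.IsMulLeftInvariant]
    (h : D.IsCanonicalFamily m p q) (hp : ∀ i, A.Invariant (p i)) (hq : ∀ i, A.Invariant (q i))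
    {s b : ℕ} (hs : Module.finrank ℝ E = 2 * Fintype.card κ + s) {z : E → Fin s → ℝ}
    (hz : D.IsTransverse m p q b z) :
    ∃ (z' : E → Fin s → ℝ) (ρ : G →* Matrix (Fin s) (Fin s) ℝ), D.IsTransverse m p q b z' ∧
      Continuous ρ ∧ ∀ᶠ x in 𝓝 m, ∀ g, z' (A.act g x) = (ρ g).mulVec (z' x) := by
  have : IsTopologicalGroup G := topologicalGroup_of_lieGroup (𝓡 d) ∞
  let L := fderiv ℝ z m
  have hker : LinearMap.ker (L : E →ₗ[ℝ] Fin s → ℝ) = D.hamSpan p m ⊔ D.hamSpan q m := by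
    ext v
    exact hz.mem_ker v
  have hLs : LinearMap.range (L : E →ₗ[ℝ] Fin s → ℝ) = ⊤ := by
    refine Submodule.eq_top_of_finrank_eq ?_
    have := (L : E →ₗ[ℝ] Fin s → ℝ).finrank_range_add_finrank_ker
    rw [hker, h.finrank_hamSpan] at this
    rw [Module.finrank_fin_fun]
    omega
  obtain ⟨R₀, hR₀⟩ := LinearMap.exists_rightInverse_of_surjective _ hLs
  let R : (Fin s → ℝ) →L[ℝ] E := LinearMap.toContinuousLinearMap R₀
  have hLR : ∀ w, L (R w) = w := fun w => LinearMap.congr_fun hR₀ w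
  let a : G → E →L[ℝ] E := fun g => fderiv ℝ (A.act g) m
  have haS : ∀ g, ∀ v ∈ D.hamSpan p m ⊔ D.hamSpan q m, a g v = v := by
    intro g v hv
    have hle : D.hamSpan p m ⊔ D.hamSpan q m ≤
        LinearMap.eqLocus (a g : E →ₗ[ℝ] E) LinearMap.id := by
      refine sup_le (Submodule.span_le.2 ?_) (Submodule.span_le.2 ?_) <;>
      · rintro _ ⟨i, rfl⟩
        exact A.fixed g _
    exact hle hv
  -- The isotropy action is trivial on the Hamiltonian vectors, which span the kernel of `L`. It
  -- descends to a representation on the quotient, independent of the section `R`.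
  let B : G → (Fin s → ℝ) →L[ℝ] (Fin s → ℝ) := fun g => L.comp ((a g).comp R)
  have hBL : ∀ g v, B g (L v) = L (a g v) := by
    intro g v
    have h1 : R (L v) - v ∈ D.hamSpan p m ⊔ D.hamSpan q m := by
      rw [← hz.mem_ker]
      change L _ = 0
      rw [map_sub, hLR, sub_self]
    have h2 : L (R (L v) - v) = 0 := (hz.mem_ker _).2 h1
    have h3 := haS g _ h1
    rw [map_sub] at h3
    have h4 : a g (R (L v)) = a g v + (R (L v) - v) := by rw [← h3]; abel
    change L (a g (R (L v))) = _
    rw [h4, map_add, h2, add_zero]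
  have hBmul : ∀ g k w, B (g * k) w = B g (B k w) := by
    intro g k w
    have : B k w = L (a k (R w)) := rfl
    rw [this, hBL]
    change L (fderiv ℝ (A.act (g * k)) m (R w)) = _
    rw [A.fderiv_act_mul]
    rfl
  have hBone : ∀ w, B 1 w = w := by
    intro w
    change L (fderiv ℝ (A.act 1) m (R w)) = w
    rw [A.fderiv_act_one]
    exact hLR w
  -- Vectors with vanishing first `b` coordinates are the images of sums of leaf directions and
  -- Hamiltonian vectors. The isotropy action preserves the former and fixes the latter.
  have hBW : ∀ g w, (∀ j : Fin s, (j : ℕ) < b → w j = 0) →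
      ∀ j : Fin s, (j : ℕ) < b → B g w j = 0 := by
    intro g w hw
    have h1 := (hz.mem_sup (R w)).1 (by
      change ∀ j : Fin s, (j : ℕ) < b → L (R w) j = 0
      rwa [hLR])
    refine (hz.mem_sup (a g (R w))).2 ?_
    obtain ⟨x, hx, y, hy, hxy⟩ := Submodule.mem_sup.1 h1
    rw [← hxy, map_add, haS g y hy]
    refine Submodule.add_mem_sup (LinearMap.mem_ker.2 ?_) hy
    have := A.foliation g m A.mem x (LinearMap.mem_ker.1 hx)
    rwa [A.base] at this
  have hBs : ContMDiff (𝓡 d) 𝓘(ℝ, (Fin s → ℝ) →L[ℝ] (Fin s → ℝ)) ∞ B :=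
    contMDiff_const.clm_comp (A.contMDiff_fderiv_act.clm_comp contMDiff_const)
  -- The weight `B g` compensates the translate `z ∘ g⁻¹`: at `m` every integrand has differential
  -- `B g ∘ L ∘ a g⁻¹ = L`, and invariance of the measure makes `z'` equivariant.
  let z' := A.weightedAvg μ B z
  have hdz' := A.fderiv_weightedAvg μ hBs hz.smooth
  have hdzm : fderiv ℝ z' m = L := by
    ext1 v
    rw [hdz'.self_of_nhds v]
    have : ∀ g, B g (fderiv ℝ z (A.act g⁻¹ m) (fderiv ℝ (A.act g⁻¹) m v)) = L v := by
      intro g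
      rw [A.base]
      change B g (L (a g⁻¹ v)) = L v
      rw [← hBL g⁻¹, ← hBmul, mul_inv_cancel, hBone]
    simp only [this]
    simp
  have heq : ∀ᶠ x in 𝓝 m, ∀ g, z' (A.act g x) = B g (z' x) := by
    obtain ⟨N, hNo, hm, hNU, hN⟩ := A.exists_smooth_domain hz.smooth
    filter_upwards [hNo.mem_nhds hm] with x hx k
    have hcont : Continuous fun g => B g (z (A.act g⁻¹ x)) :=
      (A.jointlySmoothOn_weighted hBs hNU hN).continuous hx
    have h1 := integral_mul_left_eq_self (μ := μ) (fun g => B g (z (A.act g⁻¹ (A.act k x)))) k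
    change ∫ g, B g (z (A.act g⁻¹ (A.act k x))) ∂μ = B k (∫ g, B g (z (A.act g⁻¹ x)) ∂μ)
    rw [← h1, ← (B k).integral_comp_comm (integrable_of_continuous μ hcont)]
    congr 1
    ext1 g
    rw [hBmul, mul_inv_rev, A.mul g⁻¹ k⁻¹ _ (A.maps k x (hNU hx)), A.act_inv_act k (hNU hx)]
  let ρ : G →* Matrix (Fin s) (Fin s) ℝ :=
    { toFun := fun g => LinearMap.toMatrix' (B g : (Fin s → ℝ) →ₗ[ℝ] Fin s → ℝ)
      map_one' := by
        rw [← LinearMap.toMatrix'_one]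
        congr 1
        exact LinearMap.ext hBone
      map_mul' := fun g k => by
        rw [← LinearMap.toMatrix'_mul]
        congr 1
        exact LinearMap.ext (hBmul g k) }
  have hρ : ∀ g w, (ρ g).mulVec w = B g w := fun g w => LinearMap.toMatrix'_mulVec _ _
  refine ⟨z', ρ, ⟨A.weightedAvg_smooth μ hBs hz.smooth, ?_, fun i => ?_, fun i => ?_, ?_, ?_, ?_⟩,
    ?_, ?_⟩
  · change ∫ g, B g (z (A.act g⁻¹ m)) ∂μ = 0
    simp [A.base, hz.base]
  · filter_upwards [A.weightedAvg_ham μ hBs hz.smooth (h.basic i).1 (hp i) (hz.ham_p i)] with x hx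
    rw [hx]
    simp
  · filter_upwards [A.weightedAvg_ham μ hBs hz.smooth (h.smooth i) (hq i) (hz.ham_q i)] with x hx
    rw [hx]
    simp
  · filter_upwards [hdz', A.eventually_forall_act hz.foliation] with x h1 h2 v hv j hj
    rw [h1]
    have h3 : ∀ g, B g (fderiv ℝ z (A.act g⁻¹ x) (fderiv ℝ (A.act g⁻¹) x v)) j = 0 := fun g =>
      hBW g _ (h2.2 _ _ (A.foliation _ x h2.1 v hv)) j hj
    -- The `j`-th component may be taken under the integral if the integrand is integrable;
    -- otherwise the integral is zero by convention.
    by_cases hint : Integrable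
        (fun g => B g (fderiv ℝ z (A.act g⁻¹ x) (fderiv ℝ (A.act g⁻¹) x v))) μ
    · have h4 := (ContinuousLinearMap.proj (R := ℝ) (φ := fun _ : Fin s => ℝ) j).integral_comp_comm
        hint
      refine Eq.trans h4.symm ?_
      simp [h3]
    · rw [integral_undef hint]
      rfl
  · intro v
    rw [hdzm]
    exact hz.mem_ker v
  · intro v
    rw [hdzm]
    exact hz.mem_sup v
  · refine continuous_matrix fun i j => ?_
    have : ∀ g, ρ g i j = B g (Pi.single j 1) i := fun g => by
      rw [← hρ, Matrix.mulVec_single_one]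
      rfl
    simp only [this]
    exact (continuous_apply i).comp (hBs.continuous.clm_apply continuous_const)
  · filter_upwards [heq] with x hx g
    rw [hρ, hx]

end LocalAction

end PoissonGeom

end

/-! ### The Poisson tensor and the foliation in normal coordinates. -/

noncomputable section

open scoped Manifold ContDiff Topology
open Filter Set MeasureTheory

set_option linter.unusedSectionVars false

namespace PoissonGeom

theorem cjl_apply {l s : ℕ} (θ : CJLSpace l s →L[ℝ] ℝ) (w : CJLSpace l s) :
    θ w = ∑ i, w.1 i * θ (dP s i) + ∑ i, w.2.1 i * θ (dQ s i) + ∑ j, w.2.2 j * θ (dZ l j) := by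
  have h1 : w = ∑ i, w.1 i • dP s i + ∑ i, w.2.1 i • dQ s i + ∑ j, w.2.2 j • dZ l j := by
    refine Prod.ext ?_ (Prod.ext ?_ ?_) <;> ext i <;>
      simp [dP, dQ, dZ, Prod.fst_sum, Prod.snd_sum, Pi.single_apply]
  conv_lhs => rw [h1]
  simp only [map_add, map_sum, map_smul, smul_eq_mul]

namespace FoliatedModel

open PoissonModel

universe u

variable {E : Type u} [NormedAddCommGroup E] [NormedSpace ℝ E] [FiniteDimensional ℝ E]
  {ι : Type} [Fintype ι] {D : FoliatedModel E ι} {m x : E}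
  {l s b : ℕ} {p q : Fin l → E → ℝ} {z : E → Fin s → ℝ}

/-- The map with components `p`, `q`, `z`, normalised to vanish at `m`. -/
def coordMap (p q : Fin l → E → ℝ) (z : E → Fin s → ℝ) (m x : E) : CJLSpace l s :=
  (fun i => p i x - p i m, fun i => q i x - q i m, z x)

/-- The functions `p`, `q`, `z` satisfy near `x` the commutation relations of a normal form. -/
structure IsNormalAt (D : FoliatedModel E ι) (p q : Fin l → E → ℝ) (z : E → Fin s → ℝ) (b : ℕ)
    (x : E) : Prop where
  smooth_p : ∀ i, SmoothNear (p i) x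
  smooth_q : ∀ i, SmoothNear (q i) x
  smooth_z : SmoothNear z x
  br_pp : ∀ i j, D.br (p i) (p j) x = 0
  br_qp : ∀ i j, D.br (q i) (p j) x = if i = j then 1 else 0
  br_qq : ∀ i j, D.br (q i) (q j) x = 0
  ham_p : ∀ i, ∀ᶠ y in 𝓝 x, fderiv ℝ z y (D.ham (p i) y) = 0
  ham_q : ∀ i, ∀ᶠ y in 𝓝 x, fderiv ℝ z y (D.ham (q i) y) = 0
  basic_p : ∀ i v, fderiv ℝ D.F x v = 0 → fderiv ℝ (p i) x v = 0
  basic_z : ∀ v, fderiv ℝ D.F x v = 0 → ∀ j : Fin s, (j : ℕ) < b → fderiv ℝ z x v j = 0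

theorem IsCanonicalFamily.isNormalAt (h : D.IsCanonicalFamily m p q)
    (hz : D.IsTransverse m p q b z) : ∀ᶠ x in 𝓝 m, D.IsNormalAt p q z b x := by
  filter_upwards [eventually_all.2 fun i => (h.basic i).1.eventually,
    eventually_all.2 fun i => (h.smooth i).eventually, hz.smooth.eventually,
    eventually_all.2 fun i => eventually_all.2 fun j => h.br_pp i j,
    eventually_all.2 fun i => eventually_all.2 fun j => h.br_qp i j,
    eventually_all.2 fun i => eventually_all.2 fun j => h.br_qq i j,
    eventually_all.2 fun i => eventually_eventually_nhds.2 (hz.ham_p i),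
    eventually_all.2 fun i => eventually_eventually_nhds.2 (hz.ham_q i),
    eventually_all.2 fun i => (h.basic i).2, hz.foliation]
    with x h1 h2 h3 h4 h5 h6 h7 h8 h9 h10
  exact ⟨h1, h2, h3, h4, h5, h6, h7, h8, h9, h10⟩

theorem smoothNear_coordMap (hp : ∀ i, SmoothNear (p i) x) (hq : ∀ i, SmoothNear (q i) x)
    (hz : SmoothNear z x) (m : E) : SmoothNear (coordMap p q z m) x :=
  (smoothNear_pi.2 fun i => (hp i).sub (smoothNear_const (p i m) x)).prodMk
    ((smoothNear_pi.2 fun i => (hq i).sub (smoothNear_const (q i m) x)).prodMk hz)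

theorem fderiv_coordMap (hp : ∀ i, SmoothNear (p i) x) (hq : ∀ i, SmoothNear (q i) x)
    (hz : SmoothNear z x) (m v : E) : fderiv ℝ (coordMap p q z m) x v =
      (fun i => fderiv ℝ (p i) x v, fun i => fderiv ℝ (q i) x v, fderiv ℝ z x v) := by
  have h1 : HasFDerivAt (fun x i => p i x - p i m)
      (ContinuousLinearMap.pi fun i => fderiv ℝ (p i) x) x :=
    hasFDerivAt_pi.2 fun i => (hp i).differentiableAt.hasFDerivAt.sub_const _
  have h2 : HasFDerivAt (fun x i => q i x - q i m)
      (ContinuousLinearMap.pi fun i => fderiv ℝ (q i) x) x :=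
    hasFDerivAt_pi.2 fun i => (hq i).differentiableAt.hasFDerivAt.sub_const _
  rw [show coordMap p q z m = fun x => (fun i => p i x - p i m, fun i => q i x - q i m, z x)
    from rfl, (h1.prodMk (h2.prodMk hz.differentiableAt.hasFDerivAt)).fderiv]
  rfl

namespace IsNormalAt

theorem fderiv_z_apply (h : D.IsNormalAt p q z b x) (v : E) (j : Fin s) :
    fderiv ℝ z x v j = fderiv ℝ (fun y => z y j) x v :=
  fderiv_pi_apply h.smooth_z.differentiableAt v j

theorem smooth_z_apply (h : D.IsNormalAt p q z b x) (j : Fin s) : SmoothNear (fun y => z y j) x :=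
  smoothNear_pi.1 h.smooth_z j

theorem coordMap_ham_p (h : D.IsNormalAt p q z b x) (m : E) (i : Fin l) :
    fderiv ℝ (coordMap p q z m) x (D.ham (p i) x) = - dQ s i := by
  rw [fderiv_coordMap h.smooth_p h.smooth_q h.smooth_z, (h.ham_p i).self_of_nhds]
  refine Prod.ext ?_ (Prod.ext ?_ ?_)
  · ext j
    change D.br (p i) (p j) x = _
    simp [dQ, h.br_pp]
  · ext j
    change D.br (p i) (q j) x = _
    rw [D.br_skew, h.br_qp]
    simp [dQ, Pi.single_apply]
  · simp [dQ]

theorem coordMap_ham_q (h : D.IsNormalAt p q z b x) (m : E) (i : Fin l) :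
    fderiv ℝ (coordMap p q z m) x (D.ham (q i) x) = dP s i := by
  rw [fderiv_coordMap h.smooth_p h.smooth_q h.smooth_z, (h.ham_q i).self_of_nhds]
  refine Prod.ext ?_ (Prod.ext ?_ ?_)
  · ext j
    change D.br (q i) (p j) x = _
    rw [h.br_qp]
    simp [dP, Pi.single_apply, eq_comm]
  · ext j
    change D.br (q i) (q j) x = _
    simp [dP, h.br_qq]
  · simp [dP]

theorem coordMap_ham_z (h : D.IsNormalAt p q z b x) (m : E) (i : Fin s) :
    fderiv ℝ (coordMap p q z m) x (D.ham (fun y => z y i) x) =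
      (0, 0, fun j => D.br (fun y => z y i) (fun y => z y j) x) := by
  rw [fderiv_coordMap h.smooth_p h.smooth_q h.smooth_z]
  refine Prod.ext ?_ (Prod.ext ?_ ?_)
  · ext j
    change D.br (fun y => z y i) (p j) x = 0
    rw [D.br_skew, br_eq, ← h.fderiv_z_apply, (h.ham_p j).self_of_nhds]
    simp
  · ext j
    change D.br (fun y => z y i) (q j) x = 0
    rw [D.br_skew, br_eq, ← h.fderiv_z_apply, (h.ham_q j).self_of_nhds]
    simp
  · ext j
    exact h.fderiv_z_apply _ j

theorem sharp_coordMap (h : D.IsNormalAt p q z b x) (m : E) (θ : CJLSpace l s →L[ℝ] ℝ) :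
    D.sharp x (θ.comp (fderiv ℝ (coordMap p q z m) x)) =
      ∑ i, θ (dP s i) • D.ham (p i) x + ∑ i, θ (dQ s i) • D.ham (q i) x +
        ∑ j, θ (dZ l j) • D.ham (fun y => z y j) x := by
  have h1 : θ.comp (fderiv ℝ (coordMap p q z m) x) =
      ∑ i, θ (dP s i) • fderiv ℝ (p i) x + ∑ i, θ (dQ s i) • fderiv ℝ (q i) x +
        ∑ j, θ (dZ l j) • fderiv ℝ (fun y => z y j) x := by
    ext v
    rw [ContinuousLinearMap.comp_apply, cjl_apply,
      fderiv_coordMap h.smooth_p h.smooth_q h.smooth_z]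
    simp only [add_apply, FunLike.coe_sum, Finset.sum_apply, smul_apply, smul_eq_mul,
      h.fderiv_z_apply, mul_comm]
  rw [h1]
  simp only [map_add, map_sum, map_smul]
  rfl

/-- The Poisson bivector in the coordinates `p`, `q`, `z`. -/
theorem bivector_eq (h : D.IsNormalAt p q z b x) (m : E) (θ η : CJLSpace l s →L[ℝ] ℝ) :
    η (fderiv ℝ (coordMap p q z m) x
        (D.sharp x (θ.comp (fderiv ℝ (coordMap p q z m) x)))) =
      (∑ i, wedge (dQ s i) (dP s i) θ η) + ∑ i, ∑ j,
        (D.br (fun y => z y i) (fun y => z y j) x / 2) * wedge (dZ l i) (dZ l j) θ η := by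
  rw [h.sharp_coordMap]
  simp only [map_add, map_sum, map_smul, h.coordMap_ham_p, h.coordMap_ham_q, h.coordMap_ham_z,
    smul_eq_mul, map_neg]
  congr 1
  · simp only [wedge, Finset.sum_sub_distrib, mul_neg, Finset.sum_neg_distrib]
    ring
  · have h1 : ∀ i, η (0, 0, fun j => D.br (fun y => z y i) (fun y => z y j) x) =
        ∑ j, D.br (fun y => z y i) (fun y => z y j) x * η (dZ l j) := fun i => by
      rw [cjl_apply]
      simp
    -- The sum runs over all ordered pairs, so each wedge of `z`-directions occurs twice; this is
    -- the reason for the factor one half.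
    have h2 : ∑ i, ∑ j, D.br (fun y => z y i) (fun y => z y j) x / 2 *
          (θ (dZ l j) * η (dZ l i)) =
        - ∑ i, ∑ j, D.br (fun y => z y i) (fun y => z y j) x / 2 *
          (θ (dZ l i) * η (dZ l j)) := by
      rw [Finset.sum_comm, ← Finset.sum_neg_distrib]
      refine Finset.sum_congr rfl fun i _ => ?_
      rw [← Finset.sum_neg_distrib]
      refine Finset.sum_congr rfl fun j _ => ?_
      rw [D.br_skew]
      ring
    simp only [wedge, mul_sub, Finset.sum_sub_distrib, h2, h1, Finset.mul_sum, sub_neg_eq_add]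
    rw [← Finset.sum_add_distrib]
    refine Finset.sum_congr rfl fun i _ => ?_
    rw [← Finset.sum_add_distrib]
    refine Finset.sum_congr rfl fun j _ => ?_
    ring

/-- By Jacobi, a function that commutes with all `z k` commutes with their brackets. Applied to the
`p i` and `q i`, it says that these brackets do not vary in the `p` and `q` directions. -/
theorem br_p_br_z (h : D.IsNormalAt p q z b x) {y : E → ℝ} (hy : SmoothNear y x)
    (hyz : ∀ᶠ w in 𝓝 x, fderiv ℝ z w (D.ham y w) = 0) (i j : Fin s) :
    fderiv ℝ (D.br (fun w => z w i) (fun w => z w j)) x (D.ham y x) = 0 := by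
  have h1 : ∀ k, ∀ᶠ w in 𝓝 x, D.br y (fun w => z w k) w = 0 := by
    intro k
    filter_upwards [hyz, h.smooth_z.eventually] with w h2 h3
    rw [br_eq, ← fderiv_pi_apply h3.differentiableAt, h2]
    rfl
  have h2 := br_jacobi (D := D.toPoissonModel) hy (h.smooth_z_apply i) (h.smooth_z_apply j)
  rw [br_eq_zero_of_const (h1 j), D.br_skew _ (fun w => z w j), br_eq_zero_of_const (h1 i)] at h2
  simpa [br_eq] using h2

/-- The functions on the right are constant along the leaves, so one kernel contains the other; both
have codimension `l + b`. -/
theorem fderiv_F_eq_zero_iff (h : D.IsNormalAt p q z b x) (m : E)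
    (hsurj : Function.Surjective (fderiv ℝ (coordMap p q z m) x))
    (hι : Fintype.card ι = l + b) (hbs : b ≤ s) (v : E) :
    fderiv ℝ D.F x v = 0 ↔ (∀ i, fderiv ℝ (p i) x v = 0) ∧
      ∀ j : Fin s, (j : ℕ) < b → fderiv ℝ z x v j = 0 := by
  let Φ : E →ₗ[ℝ] (Fin l → ℝ) × (Fin b → ℝ) :=
    (LinearMap.pi fun i => (fderiv ℝ (p i) x : E →ₗ[ℝ] ℝ)).prod
      (LinearMap.pi fun j => LinearMap.proj (Fin.castLE hbs j) ∘ₗ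
        (fderiv ℝ z x : E →ₗ[ℝ] Fin s → ℝ))
  have hΦ : ∀ v, Φ v = (fun i => fderiv ℝ (p i) x v, fun j => fderiv ℝ z x v (Fin.castLE hbs j)) :=
    fun v => rfl
  have hΦ0 : ∀ v, Φ v = 0 ↔ (∀ i, fderiv ℝ (p i) x v = 0) ∧
      ∀ j : Fin s, (j : ℕ) < b → fderiv ℝ z x v j = 0 := by
    intro v
    rw [hΦ, Prod.mk_eq_zero, funext_iff, funext_iff]
    refine and_congr Iff.rfl ⟨fun h j hj => h ⟨j, hj⟩, fun h j => h _ j.2⟩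
  have hΦs : Function.Surjective Φ := by
    rintro ⟨α, β⟩
    obtain ⟨v, hv⟩ := hsurj (α, 0, fun j => if hj : (j : ℕ) < b then β ⟨j, hj⟩ else 0)
    rw [fderiv_coordMap h.smooth_p h.smooth_q h.smooth_z] at hv
    refine ⟨v, ?_⟩
    have hv1 : (fun i => fderiv ℝ (p i) x v) = α := (Prod.ext_iff.1 hv).1
    have hv2 := (Prod.ext_iff.1 (Prod.ext_iff.1 hv).2).2
    dsimp only at hv2
    rw [hΦ, hv1, hv2]
    simp
  have hle : LinearMap.ker (fderiv ℝ D.F x : E →ₗ[ℝ] ι → ℝ) ≤ LinearMap.ker Φ := by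
    intro v hv
    exact (hΦ0 v).2 ⟨fun i => h.basic_p i v hv, h.basic_z v hv⟩
  have heq : LinearMap.ker (fderiv ℝ D.F x : E →ₗ[ℝ] ι → ℝ) = LinearMap.ker Φ := by
    refine Submodule.eq_of_le_of_finrank_eq hle ?_
    have h1 := (fderiv ℝ D.F x : E →ₗ[ℝ] ι → ℝ).finrank_range_add_finrank_ker
    have h2 := Φ.finrank_range_add_finrank_ker
    rw [LinearMap.range_eq_top.2 (D.surj x), finrank_top, Module.finrank_pi, hι] at h1
    rw [LinearMap.range_eq_top.2 hΦs, finrank_top, Module.finrank_prod, Module.finrank_fin_fun,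
      Module.finrank_fin_fun] at h2
    omega
  rw [← hΦ0, ← LinearMap.mem_ker, ← heq]
  exact Iff.rfl

end IsNormalAt

/-- The kernel of `dz` is spanned by the Hamiltonian vectors of the family, which the `dp i` and `dq
i` separate. Injectivity and equal dimensions suffice. -/
theorem IsCanonicalFamily.bijective_fderiv_coordMap (h : D.IsCanonicalFamily m p q)
    (hz : D.IsTransverse m p q b z) (hs : Module.finrank ℝ E = 2 * l + s) :
    Function.Bijective (fderiv ℝ (coordMap p q z m) m) := by
  have h1 := fderiv_coordMap (fun i => (h.basic i).1) h.smooth hz.smooth m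
  have hinj : Function.Injective (fderiv ℝ (coordMap p q z m) m : E →ₗ[ℝ] CJLSpace l s) := by
    rw [injective_iff_map_eq_zero]
    intro v hv
    have hv' : fderiv ℝ (coordMap p q z m) m v = 0 := hv
    rw [h1, Prod.mk_eq_zero, Prod.mk_eq_zero] at hv'
    exact h.eq_zero_of_mem_hamSpan ((hz.mem_ker v).1 hv'.2.2) (congrFun hv'.1)
      (congrFun hv'.2.1)
  refine ⟨hinj, (LinearMap.injective_iff_surjective_of_finrank_eq_finrank ?_).1 hinj⟩
  simp only [hs, Module.finrank_prod, Module.finrank_fin_fun]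
  ring

end FoliatedModel

end PoissonGeom

end

/-! ### The chart on an invariant neighbourhood. -/

noncomputable section

open scoped Manifold ContDiff Topology
open Filter Set MeasureTheory

set_option linter.unusedSectionVars false

namespace PoissonGeom

/-- A linear action of a compact group has arbitrarily small invariant open neighbourhoods of `0`. -/
theorem exists_invariant_isOpen {G : Type*} [Group G] [TopologicalSpace G] [CompactSpace G] {s : ℕ}
    (ρ : G →* Matrix (Fin s) (Fin s) ℝ) (hρ : Continuous ρ) {ε : ℝ} (hε : 0 < ε) :
    ∃ V : Set (Fin s → ℝ), IsOpen V ∧ 0 ∈ V ∧ V ⊆ Metric.ball 0 ε ∧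
      ∀ g, ∀ w ∈ V, (ρ g).mulVec w ∈ V := by
  have hmul : ∀ g k w, (ρ g).mulVec ((ρ k).mulVec w) = (ρ (g * k)).mulVec w := fun g k w => by
    rw [Matrix.mulVec_mulVec, map_mul]
  have hcont : Continuous fun x : (Fin s → ℝ) × G => (ρ x.2).mulVec x.1 :=
    (hρ.comp continuous_snd).matrix_mulVec continuous_fst
  have h1 : ∀ᶠ w in 𝓝 (0 : Fin s → ℝ), ∀ g ∈ (univ : Set G),
      (ρ g).mulVec w ∈ Metric.ball (0 : Fin s → ℝ) ε := by
    refine isCompact_univ.eventually_forall_of_forall_eventually fun g _ => ?_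
    refine hcont.continuousAt.eventually (Metric.isOpen_ball.mem_nhds ?_)
    simpa using hε
  obtain ⟨δ, hδ, h2⟩ := Metric.eventually_nhds_iff_ball.1 h1
  -- The saturation of a ball so small that all its translates stay in the ball of radius `ε`.
  refine ⟨⋃ g, (fun w => (ρ g).mulVec w) ⁻¹' Metric.ball 0 δ, ?_, ?_, ?_, ?_⟩
  · exact isOpen_iUnion fun g => Metric.isOpen_ball.preimage
      (continuous_const.matrix_mulVec continuous_id)
  · exact mem_iUnion.2 ⟨1, by simpa using hδ⟩
  · intro w hw
    obtain ⟨g, hg⟩ := mem_iUnion.1 hw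
    have := h2 _ hg g⁻¹ (mem_univ _)
    rwa [hmul, inv_mul_cancel, map_one, Matrix.one_mulVec] at this
  · intro k w hw
    obtain ⟨g, hg⟩ := mem_iUnion.1 hw
    refine mem_iUnion.2 ⟨g * k⁻¹, ?_⟩
    rw [mem_preimage, hmul, inv_mul_cancel_right]
    exact hg

namespace FoliatedModel

open PoissonModel

universe u

variable {E : Type u} [NormedAddCommGroup E] [NormedSpace ℝ E] [FiniteDimensional ℝ E]
  {ι : Type} [Fintype ι] {D : FoliatedModel E ι} {m x : E}
  {l s b : ℕ} {p q : Fin l → E → ℝ} {z : E → Fin s → ℝ}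

/-- In normal form, the brackets of the transverse coordinates depend on these coordinates only. -/
theorem br_z_eq_of_isNormalAt (e : OpenPartialHomeomorph E (CJLSpace l s))
    (he : ∀ x, e x = coordMap p q z m x) (hes : ContDiffOn ℝ ∞ e.symm e.target)
    {ε : ℝ} (hε : 0 < ε) {V : Set (Fin s → ℝ)}
    (ht : e.target = Metric.ball 0 ε ×ˢ (Metric.ball 0 ε ×ˢ V))
    (hN : ∀ x ∈ e.source, D.IsNormalAt p q z b x) (hx : x ∈ e.source) (i j : Fin s) :
    D.br (fun y => z y i) (fun y => z y j) x =
      D.br (fun y => z y i) (fun y => z y j) (e.symm (0, 0, z x)) := by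
  let β : E → ℝ := D.br (fun y => z y i) (fun y => z y j)
  have hβ : ∀ y ∈ e.source, SmoothNear β y := fun y hy =>
    br_smooth ((hN y hy).smooth_z_apply i) ((hN y hy).smooth_z_apply j)
  let B : CJLSpace l s → ℝ := fun w => β (e.symm w)
  have hsymm : ∀ w ∈ e.target, DifferentiableAt ℝ e.symm w := fun w hw =>
    ((hes w hw).contDiffAt (e.open_target.mem_nhds hw)).differentiableAt (by simp)
  have hB : ∀ w ∈ e.target, DifferentiableAt ℝ B w := fun w hw =>
    ((hβ _ (e.map_target hw)).differentiableAt.hasFDerivAt.comp w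
      (hsymm w hw).hasFDerivAt).differentiableAt
  have hdB : ∀ y ∈ e.source, ∀ v, fderiv ℝ B (e y) (fderiv ℝ (coordMap p q z m) y v) =
      fderiv ℝ β y v := by
    intro y hy v
    have h := hN y hy
    have hZ := (smoothNear_coordMap h.smooth_p h.smooth_q h.smooth_z m).differentiableAt.hasFDerivAt
    have hBy := (hB (e y) (e.map_source hy)).hasFDerivAt
    rw [he y] at hBy
    have h1 : B ∘ coordMap p q z m =ᶠ[𝓝 y] β := by
      filter_upwards [e.open_source.mem_nhds hy] with w hw
      simp only [B, Function.comp_apply, ← he, e.left_inv hw]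
    rw [← h1.fderiv_eq, (hBy.comp y hZ).fderiv, he y]
    rfl
  -- In the chart `∂/∂p` is the Hamiltonian field of `q`, and `∂/∂q` is minus that of `p`. The
  -- brackets of the `z j` are constant along both, and each slice of the domain with fixed `z` is
  -- convex.
  have hdB0 : ∀ y ∈ e.source, ∀ a c : Fin l → ℝ, fderiv ℝ B (e y) (a, c, 0) = 0 := by
    intro y hy a c
    have h := hN y hy
    have hP : ∀ k, fderiv ℝ B (e y) (dP s k) = 0 := fun k => by
      rw [← h.coordMap_ham_q m k, hdB y hy]
      exact h.br_p_br_z (h.smooth_q k) (h.ham_q k) i j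
    have hQ : ∀ k, fderiv ℝ B (e y) (dQ s k) = 0 := fun k => by
      rw [← neg_eq_zero, ← map_neg, ← h.coordMap_ham_p m k, hdB y hy]
      exact h.br_p_br_z (h.smooth_p k) (h.ham_p k) i j
    rw [cjl_apply]
    simp [hP, hQ]
  let U : Set ((Fin l → ℝ) × (Fin l → ℝ)) := Metric.ball 0 ε ×ˢ Metric.ball 0 ε
  have hzV : z x ∈ V := by
    have := e.map_source hx
    rw [ht, he] at this
    exact this.2.2
  have hUt : ∀ u ∈ U, (u.1, u.2, z x) ∈ e.target := fun u hu => by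
    rw [ht]
    exact ⟨hu.1, hu.2, hzV⟩
  let γ : (Fin l → ℝ) × (Fin l → ℝ) → CJLSpace l s := fun u => (u.1, u.2, z x)
  have hγ : ∀ u, HasFDerivAt γ ((ContinuousLinearMap.fst ℝ (Fin l → ℝ) (Fin l → ℝ)).prod
      ((ContinuousLinearMap.snd ℝ (Fin l → ℝ) (Fin l → ℝ)).prod
        (0 : (Fin l → ℝ) × (Fin l → ℝ) →L[ℝ] Fin s → ℝ))) u := fun u =>
    HasFDerivAt.prodMk hasFDerivAt_fst
      (HasFDerivAt.prodMk hasFDerivAt_snd (hasFDerivAt_const (z x) u))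
  have hBγ : ∀ u ∈ U, HasFDerivAt (B ∘ γ)
      (0 : (Fin l → ℝ) × (Fin l → ℝ) →L[ℝ] ℝ) u := by
    intro u hu
    have h1 := (hB _ (hUt u hu)).hasFDerivAt.comp u (hγ u)
    refine h1.congr_fderiv (ContinuousLinearMap.ext fun v => ?_)
    have h2 := hdB0 _ (e.map_target (hUt u hu)) v.1 v.2
    rw [e.right_inv (hUt u hu)] at h2
    exact h2
  have hU : Convex ℝ U := (convex_ball _ _).prod (convex_ball _ _)
  have hUo : IsOpen U := Metric.isOpen_ball.prod Metric.isOpen_ball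
  have hconst := hUo.is_const_of_fderiv_eq_zero (f := B ∘ γ) hU.isPreconnected
    (fun u hu => (hBγ u hu).differentiableAt.differentiableWithinAt)
    (fun u hu => (hBγ u hu).fderiv)
    (x := ((coordMap p q z m x).1, (coordMap p q z m x).2.1)) (y := 0)
    (by
      have := e.map_source hx
      rw [ht, he] at this
      exact ⟨this.1, this.2.1⟩)
    ⟨Metric.mem_ball_self hε, Metric.mem_ball_self hε⟩
  have h1 : (B ∘ γ) ((coordMap p q z m x).1, (coordMap p q z m x).2.1) = β x := by
    change β (e.symm (coordMap p q z m x)) = β x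
    rw [← he, e.left_inv hx]
  rw [h1] at hconst
  exact hconst

end FoliatedModel

namespace LocalAction

open PoissonModel FoliatedModel

variable {E : Type} [NormedAddCommGroup E] [NormedSpace ℝ E] [FiniteDimensional ℝ E]
  {ι : Type} [Fintype ι]
  {D : FoliatedModel E ι} {d : ℕ} {G : Type*} [Group G] [TopologicalSpace G]
  [ChartedSpace (EuclideanSpace ℝ (Fin d)) G] [LieGroup (𝓡 d) ∞ G] {m : E}
  (A : LocalAction D d G m) [CompactSpace G]
  {l s b : ℕ} {p q : Fin l → E → ℝ} {z : E → Fin s → ℝ}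

/-- The chart given by an invariant canonical family and by transverse coordinates in which the
action is linear, on an invariant neighbourhood. -/
theorem exists_normal_chart (h : D.IsCanonicalFamily m p q) (hz : D.IsTransverse m p q b z)
    (hp : ∀ i, A.Invariant (p i)) (hq : ∀ i, A.Invariant (q i))
    (hs : Module.finrank ℝ E = 2 * l + s) (ρ : G →* Matrix (Fin s) (Fin s) ℝ) (hρ : Continuous ρ)
    (hzρ : ∀ᶠ x in 𝓝 m, ∀ g, z (A.act g x) = (ρ g).mulVec (z x)) :
    ∃ (e : OpenPartialHomeomorph E (CJLSpace l s)) (g : Fin s → Fin s → (Fin s → ℝ) → ℝ),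
      (∀ x, e x = coordMap p q z m x) ∧ m ∈ e.source ∧ e.source ⊆ A.U ∧
      ContDiffOn ℝ ∞ e e.source ∧ ContDiffOn ℝ ∞ e.symm e.target ∧
      (∀ x ∈ e.source, D.IsNormalAt p q z b x) ∧
      (∀ i j, ContDiffOn ℝ ∞ (g i j) ((fun x => (e x).2.2) '' e.source)) ∧
      (∀ x ∈ e.source, ∀ i j,
        g i j (z x) = D.br (fun y => z y i) (fun y => z y j) x / 2) ∧
      ∀ a, ∀ x ∈ e.source, A.act a x ∈ e.source ∧
        e (A.act a x) = ((e x).1, (e x).2.1, (ρ a).mulVec (e x).2.2) := by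
  have hcomplete : CompleteSpace E := FiniteDimensional.complete ℝ E
  let Z : E → CJLSpace l s := coordMap p q z m
  have hZ : SmoothNear Z m := smoothNear_coordMap (fun i => (h.basic i).1) h.smooth hz.smooth m
  have hZm : Z m = 0 := by
    simp only [Z, coordMap, sub_self, hz.base]
    rfl
  have hbij := h.bijective_fderiv_coordMap hz hs
  let Z' : E ≃L[ℝ] CJLSpace l s :=
    (LinearEquiv.ofBijective (fderiv ℝ Z m : E →ₗ[ℝ] CJLSpace l s) hbij).toContinuousLinearEquiv
  obtain ⟨e₁, he₁, hm₁, hs₁, ht₁⟩ := hZ.exists_openPartialHomeomorph Z'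
    (hZ.differentiableAt.hasFDerivAt.congr_fderiv (by ext1 v; rfl))
  have hev : ∀ᶠ x in 𝓝 m, x ∈ e₁.source ∧ D.IsNormalAt p q z b x ∧
      (∀ g, z (A.act g x) = (ρ g).mulVec (z x)) ∧ (∀ i, ∀ g, p i (A.act g x) = p i x) ∧
      ∀ i, ∀ g, q i (A.act g x) = q i x := by
    filter_upwards [e₁.open_source.mem_nhds hm₁, h.isNormalAt hz, hzρ, eventually_all.2 hp,
      eventually_all.2 hq] with x h1 h2 h3 h4 h5 using ⟨h1, h2, h3, h4, h5⟩
  obtain ⟨N₀, hN₀, hN₀o, hm₀⟩ := eventually_nhds_iff.1 hev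
  -- Points of `N₁` have their whole orbit in `N₀`, where the coordinates are injective and the
  -- equivariance formulas hold.
  obtain ⟨N₁, hN₁, hN₁o, hmN₁⟩ := eventually_nhds_iff.1
    ((A.eventually_forall_act (hN₀o.mem_nhds hm₀)).and (hN₀o.mem_nhds hm₀))
  have hN₁₀ : N₁ ⊆ N₀ := fun x hx => (hN₁ x hx).2
  have hN₁e : N₁ ⊆ e₁.source := fun x hx => (hN₀ x (hN₁₀ hx)).1
  have himg : e₁ '' N₁ ∈ 𝓝 (0 : CJLSpace l s) := by
    refine (e₁.isOpen_image_of_subset_source hN₁o hN₁e).mem_nhds ⟨m, hmN₁, ?_⟩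
    rw [he₁]
    exact hZm
  obtain ⟨ε, hε, hball⟩ := Metric.mem_nhds_iff.1 himg
  obtain ⟨V, hVo, hV0, hVε, hVρ⟩ := exists_invariant_isOpen ρ hρ hε
  -- The action in coordinates preserves the box because `V` is invariant. The product form also
  -- makes every point `(0, 0, w)` with `w ∈ V` available, where the coefficients are evaluated.
  let box : Set (CJLSpace l s) := Metric.ball 0 ε ×ˢ (Metric.ball 0 ε ×ˢ V)
  have hboxo : IsOpen box := Metric.isOpen_ball.prod (Metric.isOpen_ball.prod hVo)
  have hbox : box ⊆ e₁ '' N₁ := by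
    rintro ⟨a, c, w⟩ ⟨h1, h2, h3⟩
    refine hball ?_
    have h4 := hVε h3
    rw [mem_ball_zero_iff] at h1 h2 h4 ⊢
    exact max_lt h1 (max_lt h2 h4)
  let e : OpenPartialHomeomorph E (CJLSpace l s) := (e₁.symm.restrOpen box hboxo).symm
  have he : ∀ x, e x = coordMap p q z m x := he₁
  have hsymm : ∀ w, e.symm w = e₁.symm w := fun w => rfl
  have het : e.target = box := by
    change e₁.target ∩ box = box
    refine inter_eq_right.2 fun w hw => ?_
    obtain ⟨x, hx, rfl⟩ := hbox hw
    exact e₁.map_source (hN₁e hx)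
  have hesrc : e.source ⊆ N₁ := by
    intro x hx
    have h1 : e x ∈ box := het ▸ e.map_source hx
    obtain ⟨y, hy, hyx⟩ := hbox h1
    have h2 : e.symm (e x) = x := e.left_inv hx
    rw [← hyx, hsymm, e₁.left_inv (hN₁e hy)] at h2
    exact h2 ▸ hy
  -- Injectivity of the coordinates on `N₀` turns invariance of the box into invariance of the
  -- domain in `E`.
  have hmem : ∀ x ∈ N₀, coordMap p q z m x ∈ box → x ∈ e.source := by
    intro x hx hxb
    have h1 : e.symm (coordMap p q z m x) ∈ e.source := e.map_target (het.symm ▸ hxb)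
    rwa [hsymm, ← show e₁ x = coordMap p q z m x from he₁ x, e₁.left_inv (hN₀ x hx).1] at h1
  have hmbox : Z m ∈ box := by
    rw [hZm]
    exact ⟨Metric.mem_ball_self hε, Metric.mem_ball_self hε, hV0⟩
  have hN : ∀ x ∈ e.source, D.IsNormalAt p q z b x := fun x hx => (hN₀ x (hN₁₀ (hesrc hx))).2.1
  have hes : ContDiffOn ℝ ∞ e.symm e.target := by
    refine (ht₁.mono ?_).congr fun w _ => hsymm w
    exact fun w hw => hw.1
  refine ⟨e, fun i j w => D.br (fun y => z y i) (fun y => z y j) (e.symm (0, 0, w)) / 2, he,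
    hmem m hm₀ hmbox, fun x hx => (hN₁ x (hesrc hx)).1.1, ?_, hes, hN, ?_, ?_, ?_⟩
  · exact (hs₁.mono fun x hx => hN₁e (hesrc hx)).congr fun x _ => (he x).trans (he₁ x).symm
  · intro i j w hw
    obtain ⟨x, hx, rfl⟩ := hw
    have hzV : (e x).2.2 ∈ V := (het ▸ e.map_source hx : e x ∈ box).2.2
    have h1 : ((0, 0, (e x).2.2) : CJLSpace l s) ∈ e.target := by
      rw [het]
      exact ⟨Metric.mem_ball_self hε, Metric.mem_ball_self hε, hzV⟩
    have h2 := hN _ (e.map_target h1)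
    have h3 : ContDiffAt ℝ ∞ (D.br (fun y => z y i) (fun y => z y j))
        (e.symm (0, 0, (e x).2.2)) :=
      (br_smooth (h2.smooth_z_apply i) (h2.smooth_z_apply j)).contDiffAt
    have h4 : ContDiffAt ℝ ∞ (fun w : Fin s → ℝ => e.symm (0, 0, w)) (e x).2.2 := by
      have h5 : ContDiffAt ℝ ∞ e.symm (0, 0, (e x).2.2) :=
        (hes _ h1).contDiffAt (e.open_target.mem_nhds h1)
      have h6 : ContDiffAt ℝ ∞ (fun w : Fin s → ℝ => ((0, 0, w) : CJLSpace l s)) (e x).2.2 :=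
        contDiffAt_const.prodMk (contDiffAt_const.prodMk contDiffAt_id)
      exact ContDiffAt.comp (g := e.symm) _ h5 h6
    have h7 := ContDiffAt.comp (g := D.br (fun y => z y i) (fun y => z y j))
      (f := fun w : Fin s → ℝ => e.symm (0, 0, w)) (e x).2.2 h3 h4
    exact (h7.div_const 2).contDiffWithinAt
  · intro x hx i j
    rw [br_z_eq_of_isNormalAt e he hes hε het hN hx i j]
  · intro a x hx
    have hx₁ := hesrc hx
    obtain ⟨-, -, h3, h4, h5⟩ := hN₀ x (hN₁₀ hx₁)
    have h6 : coordMap p q z m (A.act a x) = ((coordMap p q z m x).1, (coordMap p q z m x).2.1,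
        (ρ a).mulVec (coordMap p q z m x).2.2) := by
      simp only [coordMap, h3, h4, h5]
    have h7 : coordMap p q z m x ∈ box := by
      rw [← he, ← het]
      exact e.map_source hx
    refine ⟨hmem _ ((hN₁ x hx₁).1.2 a) ?_, ?_⟩
    · rw [h6]
      exact ⟨h7.1, h7.2.1, hVρ a _ h7.2.2⟩
    · rw [he, he, h6]

end LocalAction

end PoissonGeom

end

/-! ### From Poisson manifolds to normed spaces; smooth charts. -/

noncomputable section

open scoped Manifold ContDiff Topology
open Filter Set MeasureTheory

set_option linter.unusedSectionVars false

namespace PoissonGeom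

/-- Euclidean space of dimension `k`. -/
abbrev Euc (k : ℕ) : Type := EuclideanSpace ℝ (Fin k)

theorem mvfderiv_euc {k : ℕ} {W : Type*} [NormedAddCommGroup W] [NormedSpace ℝ W] (f : Euc k → W)
    (x : Euc k) : mvfderiv (𝓡 k) f x = fderiv ℝ f x := by
  ext v
  change mfderiv (𝓡 k) 𝓘(ℝ, W) f x v = _
  rw [mfderiv_eq_fderiv]
  rfl

namespace PoissonStructure

variable {k : ℕ} (P : PoissonStructure k (Euc k))

/-- The Poisson tensor of a Poisson structure on Euclidean space. -/
def flatSharp (x : Euc k) : (Euc k →L[ℝ] ℝ) →L[ℝ] Euc k :=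
  LinearMap.toContinuousLinearMap (P.sharp x)

theorem bracket_eq_sharpBracket (a b : Euc k → ℝ) :
    (fun x => mvfderiv (𝓡 k) b x (P.sharp x (mvfderiv (𝓡 k) a x))) =
      sharpBracket P.flatSharp a b := by
  ext x
  rw [mvfderiv_euc, mvfderiv_euc]
  rfl

/-- The coefficients of the tensor are brackets of linear functions. -/
theorem contDiff_flatSharp : ContDiff ℝ ∞ P.flatSharp := by
  rw [contDiff_clm_apply_iff]
  intro α
  rw [contDiff_euclidean]
  intro i
  let β : Euc k →L[ℝ] ℝ := EuclideanSpace.proj i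
  have h := P.smooth univ α β isOpen_univ α.contDiff.contMDiff.contMDiffOn
    β.contDiff.contMDiff.contMDiffOn
  rw [bracket_eq_sharpBracket] at h
  have h2 := contMDiffOn_univ.1 h
  have h3 : ContDiff ℝ ∞ (sharpBracket P.flatSharp α β) := contMDiff_iff_contDiff.1 h2
  have h4 : sharpBracket P.flatSharp α β = fun x => β (P.flatSharp x α) := by
    ext x
    simp [sharpBracket]
  rw [h4] at h3
  exact h3

/-- The Poisson model defined by a Poisson structure on Euclidean space. -/
def toModel : PoissonModel (Euc k) where
  sharp := P.flatSharp
  smooth := P.contDiff_flatSharp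
  skew x α β := P.skew x α β
  jacobi x a b c ha hb hc := by
    obtain ⟨U, hU, hxU, haU⟩ := ha.exists_isOpen
    obtain ⟨V, hV, hxV, hbV⟩ := hb.exists_isOpen
    obtain ⟨W, hW, hxW, hcW⟩ := hc.exists_isOpen
    have h := P.jacobi (U ∩ V ∩ W) a b c ((hU.inter hV).inter hW)
      (haU.mono fun y hy => hy.1.1).contMDiffOn (hbV.mono fun y hy => hy.1.2).contMDiffOn
      (hcW.mono fun y hy => hy.2).contMDiffOn x ⟨⟨hxU, hxV⟩, hxW⟩
    have h1 : ∀ a b : Euc k → ℝ, mvfderiv (𝓡 k) b x (P.sharp x (mvfderiv (𝓡 k) a x)) =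
        sharpBracket P.flatSharp a b x := fun a b => congrFun (P.bracket_eq_sharpBracket a b) x
    simp only [bracket_eq_sharpBracket, h1] at h
    exact h

end PoissonStructure

/-- The Poisson tensor of a product of Poisson structures on Euclidean spaces. -/
def prodSharp {k s : ℕ} (P₁ : PoissonStructure k (Euc k)) (P₂ : PoissonStructure s (Euc s))
    (y : Euc k × Euc s) : (Euc k × Euc s →L[ℝ] ℝ) →L[ℝ] Euc k × Euc s :=
  ((P₁.flatSharp y.1).comp ((ContinuousLinearMap.compL ℝ (Euc k) (Euc k × Euc s) ℝ).flip
      (ContinuousLinearMap.inl ℝ _ _))).prod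
    ((P₂.flatSharp y.2).comp ((ContinuousLinearMap.compL ℝ (Euc s) (Euc k × Euc s) ℝ).flip
      (ContinuousLinearMap.inr ℝ _ _)))

section Product

variable {k s : ℕ} (P₁ : PoissonStructure k (Euc k)) (P₂ : PoissonStructure s (Euc s))

theorem prodSharp_apply (y : Euc k × Euc s) (α : Euc k × Euc s →L[ℝ] ℝ) : prodSharp P₁ P₂ y α =
    (P₁.flatSharp y.1 (α.comp (ContinuousLinearMap.inl ℝ _ _)),
      P₂.flatSharp y.2 (α.comp (ContinuousLinearMap.inr ℝ _ _))) := rfl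

theorem contDiff_prodSharp : ContDiff ℝ ∞ (prodSharp P₁ P₂) := by
  rw [contDiff_clm_apply_iff]
  intro α
  exact ((P₁.contDiff_flatSharp.comp contDiff_fst).clm_apply contDiff_const).prodMk
    ((P₂.contDiff_flatSharp.comp contDiff_snd).clm_apply contDiff_const)

theorem apply_prodSharp (y : Euc k × Euc s) (α β : Euc k × Euc s →L[ℝ] ℝ) :
    β (prodSharp P₁ P₂ y α) =
      P₁.bivector y.1 (α.comp (ContinuousLinearMap.inl ℝ _ _))
        (β.comp (ContinuousLinearMap.inl ℝ _ _)) +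
      P₂.bivector y.2 (α.comp (ContinuousLinearMap.inr ℝ _ _))
        (β.comp (ContinuousLinearMap.inr ℝ _ _)) := by
  rw [prodSharp_apply]
  have : ∀ v : Euc k × Euc s, β v = β.comp (ContinuousLinearMap.inl ℝ _ _) v.1 +
      β.comp (ContinuousLinearMap.inr ℝ _ _) v.2 := fun v => by
    simp [← map_add]
  rw [this]
  rfl

theorem prodSharp_skew (y : Euc k × Euc s) (α β : Euc k × Euc s →L[ℝ] ℝ) :
    β (prodSharp P₁ P₂ y α) = - α (prodSharp P₁ P₂ y β) := by
  rw [apply_prodSharp, apply_prodSharp, PoissonStructure.bivector, PoissonStructure.bivector,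
    P₁.skew, P₂.skew, PoissonStructure.bivector, PoissonStructure.bivector]
  ring

end Product

section Chart

variable {n : ℕ} {M : Type*} [TopologicalSpace M] [ChartedSpace (EuclideanSpace ℝ (Fin n)) M]
  {W : Type*} [NormedAddCommGroup W] [NormedSpace ℝ W] {e : OpenPartialHomeomorph M W}

namespace IsSmoothChart

theorem contMDiffAt (he : IsSmoothChart n e) {x : M} (hx : x ∈ e.source) :
    ContMDiffAt (𝓡 n) 𝓘(ℝ, W) ∞ e x :=
  he.smooth.contMDiffAt (e.open_source.mem_nhds hx)

theorem contMDiffAt_symm (he : IsSmoothChart n e) {y : W} (hy : y ∈ e.target) :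
    ContMDiffAt 𝓘(ℝ, W) (𝓡 n) ∞ e.symm y :=
  he.smooth_symm.contMDiffAt (e.open_target.mem_nhds hy)

theorem mdifferentiableAt (he : IsSmoothChart n e) {x : M} (hx : x ∈ e.source) :
    MDifferentiableAt (𝓡 n) 𝓘(ℝ, W) e x := (he.contMDiffAt hx).mdifferentiableAt (by simp)

theorem mdifferentiableAt_symm (he : IsSmoothChart n e) {y : W} (hy : y ∈ e.target) :
    MDifferentiableAt 𝓘(ℝ, W) (𝓡 n) e.symm y := (he.contMDiffAt_symm hy).mdifferentiableAt (by simp)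

theorem mvfderiv_comp {V : Type*} [NormedAddCommGroup V] [NormedSpace ℝ V]
    (he : IsSmoothChart n e) {x : M} (hx : x ∈ e.source) {f : W → V}
    (hf : DifferentiableAt ℝ f (e x)) :
    mvfderiv (𝓡 n) (fun y => f (e y)) x = (fderiv ℝ f (e x)).comp (mvfderiv (𝓡 n) e x) := by
  ext v
  change mfderiv (𝓡 n) 𝓘(ℝ, V) (f ∘ e) x v = _
  rw [mfderiv_comp x hf.mdifferentiableAt (he.mdifferentiableAt hx), mfderiv_eq_fderiv]
  rfl

theorem surjective_mvfderiv (he : IsSmoothChart n e) {x : M} (hx : x ∈ e.source) :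
    Function.Surjective (mvfderiv (𝓡 n) e x) := by
  suffices H : ∀ y ∈ e.target, Function.Surjective (mvfderiv (𝓡 n) e (e.symm y)) by
    have := H _ (e.map_source hx)
    rwa [e.left_inv hx] at this
  intro y hy w
  have h1 : e ∘ e.symm =ᶠ[𝓝 y] id := by
    filter_upwards [e.open_target.mem_nhds hy] with y hy using e.right_inv hy
  have h2 := mfderiv_comp (I := 𝓘(ℝ, W)) (I' := 𝓡 n) (I'' := 𝓘(ℝ, W)) (f := e.symm) (g := e)
    y (he.mdifferentiableAt (e.map_target hy)) (he.mdifferentiableAt_symm hy)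
  rw [h1.mfderiv_eq, mfderiv_id] at h2
  exact ⟨mfderiv 𝓘(ℝ, W) (𝓡 n) e.symm y w, (congrArg (fun T : W →L[ℝ] W => T w) h2).symm⟩

/-- Composition of a chart with a diffeomorphism between open subsets of normed spaces. -/
theorem trans {V : Type*} [NormedAddCommGroup V] [NormedSpace ℝ V] (he : IsSmoothChart n e)
    {e' : OpenPartialHomeomorph W V} (h1 : ContDiffOn ℝ ∞ e' e'.source)
    (h2 : ContDiffOn ℝ ∞ e'.symm e'.target) : IsSmoothChart n (e.trans e') := by
  constructor
  · rw [e.trans_source]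
    exact h1.contMDiffOn.comp (he.smooth.mono fun x hx => hx.1) fun x hx => hx.2
  · rw [e.trans_target]
    exact he.smooth_symm.comp (h2.contMDiffOn.mono fun x hx => hx.1) fun x hx => hx.2

end IsSmoothChart

end Chart

end PoissonGeom

end

/-! ### Split charts and the product Poisson structure. -/

noncomputable section

open scoped Manifold ContDiff Topology
open Filter Set MeasureTheory

set_option linter.unusedSectionVars false

namespace PoissonGeom

section Covectors

variable {V : Type*} [NormedAddCommGroup V] [NormedSpace ℝ V]
  {ι : Type*} [Fintype ι] {L : ι → V →L[ℝ] ℝ}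

/-- A nonzero functional vanishing on a proper range would have coefficients giving a linear
relation between the `L i`. -/
theorem surjective_of_linearIndependent (h : LinearIndependent ℝ L) :
    Function.Surjective fun v i => L i v := by
  classical
  let Φ : V →ₗ[ℝ] ι → ℝ := LinearMap.pi fun i => (L i : V →ₗ[ℝ] ℝ)
  suffices H : LinearMap.range Φ = ⊤ from LinearMap.range_eq_top.1 H
  by_contra hne
  obtain ⟨c, hc, hle⟩ := Submodule.exists_le_ker_of_lt_top _ (lt_top_iff_ne_top.2 hne)
  refine hc ?_
  have h1 : ∀ w, c w = ∑ i, w i * c (Pi.single i 1) := fun w => by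
    conv_lhs => rw [← Finset.univ_sum_single w, map_sum]
    refine Finset.sum_congr rfl fun i _ => ?_
    rw [← smul_eq_mul, ← map_smul]
    congr 1
    ext j
    simp [Pi.single_apply]
  have h2 := Fintype.linearIndependent_iff.1 h (fun i => c (Pi.single i 1)) (by
    ext v
    have h3 : c (Φ v) = 0 := hle ⟨v, rfl⟩
    rw [h1] at h3
    simpa [Φ, mul_comm] using h3)
  refine LinearMap.ext fun w => ?_
  rw [h1]
  simp [h2]

theorem linearIndependent_of_surjective (h : Function.Surjective fun v i => L i v) :
    LinearIndependent ℝ L := by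
  classical
  rw [Fintype.linearIndependent_iff]
  intro c hc i
  obtain ⟨v, hv⟩ := h (Pi.single i 1)
  have h1 : ∀ j, L j v = if j = i then 1 else 0 := fun j => by
    rw [← Pi.single_apply i (1 : ℝ) j, ← hv]
  have h2 := congrArg (fun T : V →L[ℝ] ℝ => T v) hc
  simpa [h1] using h2

end Covectors

section Manifold

variable {n : ℕ} {M : Type*} [TopologicalSpace M] [ChartedSpace (EuclideanSpace ℝ (Fin n)) M]

theorem mvfderiv_congr {W : Type*} [NormedAddCommGroup W] [NormedSpace ℝ W] {f h : M → W} {x : M}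
    (hfh : f =ᶠ[𝓝 x] h) (v : TangentSpace (𝓡 n) x) :
    mvfderiv (𝓡 n) f x v = mvfderiv (𝓡 n) h x v := by
  change mfderiv (𝓡 n) 𝓘(ℝ, W) f x v = mfderiv (𝓡 n) 𝓘(ℝ, W) h x v
  rw [hfh.mfderiv_eq]
  rfl

/-- `e` is a chart in which the Poisson structure `P` and the foliation given by `f` are products
of a symplectic manifold and of a Poisson manifold, with integrable systems. -/
structure IsSplitChart (P : PoissonStructure n M) {ι : Type*} (f : ι → M → ℝ) {k l s b : ℕ}
    (P₁ : PoissonStructure k (Euc k)) (φ : Fin l → Euc k → ℝ)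
    (P₂ : PoissonStructure s (Euc s)) (ψ : Fin b → Euc s → ℝ)
    (e : OpenPartialHomeomorph M (Euc k × Euc s)) : Prop where
  rank : ∀ a, P₁.rankAt a = k
  family₁ : P₁.IsInvolutiveFamily φ
  family₂ : P₂.IsInvolutiveFamily ψ
  chart : IsSmoothChart n e
  target : e.target = univ
  poisson : ∀ x ∈ e.source, ∀ θ η : Euc k × Euc s →L[ℝ] ℝ,
    P.bivector x (θ.comp (mvfderiv (𝓡 n) e x)) (η.comp (mvfderiv (𝓡 n) e x)) =
      P₁.bivector (e x).1 (θ.comp (ContinuousLinearMap.inl ℝ _ _))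
        (η.comp (ContinuousLinearMap.inl ℝ _ _)) +
      P₂.bivector (e x).2 (θ.comp (ContinuousLinearMap.inr ℝ _ _))
        (η.comp (ContinuousLinearMap.inr ℝ _ _))
  foliation : ∀ x ∈ e.source, ∀ v : TangentSpace (𝓡 n) x,
    v ∈ tangentFoliation n f x ↔
      (mvfderiv (𝓡 n) e x v).1 ∈ tangentFoliation k φ (e x).1 ∧
      (mvfderiv (𝓡 n) e x v).2 ∈ tangentFoliation s ψ (e x).2

namespace IsSplitChart

variable {P : PoissonStructure n M} {ι : Type*} {f : ι → M → ℝ} {k l s b : ℕ}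
  {P₁ : PoissonStructure k (Euc k)} {φ : Fin l → Euc k → ℝ}
  {P₂ : PoissonStructure s (Euc s)} {ψ : Fin b → Euc s → ℝ}
  {e : OpenPartialHomeomorph M (Euc k × Euc s)}

theorem mem_target (h : IsSplitChart P f P₁ φ P₂ ψ e) (y : Euc k × Euc s) : y ∈ e.target := by
  rw [h.target]
  exact mem_univ y

theorem right_inv (h : IsSplitChart P f P₁ φ P₂ ψ e) (y : Euc k × Euc s) : e (e.symm y) = y :=
  e.right_inv (h.mem_target y)

theorem symm_mem (h : IsSplitChart P f P₁ φ P₂ ψ e) (y : Euc k × Euc s) : e.symm y ∈ e.source :=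
  e.map_target (h.mem_target y)

theorem mvfderiv_sharp (h : IsSplitChart P f P₁ φ P₂ ψ e) {x : M} (hx : x ∈ e.source)
    (θ : Euc k × Euc s →L[ℝ] ℝ) :
    mvfderiv (𝓡 n) e x (P.sharp x (θ.comp (mvfderiv (𝓡 n) e x))) = prodSharp P₁ P₂ (e x) θ := by
  refine SeparatingDual.eq_iff_forall_dual_eq (R := ℝ) |>.2 fun η => ?_
  rw [apply_prodSharp]
  exact h.poisson x hx θ η

theorem bracket_comp (h : IsSplitChart P f P₁ φ P₂ ψ e) {x : M} (hx : x ∈ e.source)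
    {a b : Euc k × Euc s → ℝ} (ha : DifferentiableAt ℝ a (e x)) (hb : DifferentiableAt ℝ b (e x)) :
    mvfderiv (𝓡 n) (fun y => b (e y)) x (P.sharp x (mvfderiv (𝓡 n) (fun y => a (e y)) x)) =
      sharpBracket (prodSharp P₁ P₂) a b (e x) := by
  rw [h.chart.mvfderiv_comp hx ha, h.chart.mvfderiv_comp hx hb, ContinuousLinearMap.comp_apply,
    h.mvfderiv_sharp hx]
  rfl

theorem smoothNear_sharpBracket {a b : Euc k × Euc s → ℝ} {y : Euc k × Euc s}
    (ha : SmoothNear a y) (hb : SmoothNear b y) :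
    SmoothNear (sharpBracket (prodSharp P₁ P₂) a b) y :=
  hb.smooth_fderiv.clm_apply
    ((smoothNear_of_contDiff (contDiff_prodSharp P₁ P₂) y).clm_apply ha.smooth_fderiv)

/-- The product Poisson structure. -/
def toPoissonModel (h : IsSplitChart P f P₁ φ P₂ ψ e) : PoissonModel (Euc k × Euc s) where
  sharp := prodSharp P₁ P₂
  smooth := contDiff_prodSharp P₁ P₂
  skew := prodSharp_skew P₁ P₂
  jacobi y a b c ha hb hc := by
    -- The Jacobi identity is transported from the manifold: functions are pulled back along the
    -- chart, which turns the bracket there into the product bracket.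
    obtain ⟨U, hU, hyU⟩ : ∃ U, IsOpen U ∧ y ∈ U ∧
        ∀ w ∈ U, SmoothNear a w ∧ SmoothNear b w ∧ SmoothNear c w := by
      obtain ⟨U, h1, h2, h3⟩ := eventually_nhds_iff.1
        (ha.eventually.and (hb.eventually.and hc.eventually))
      exact ⟨U, h2, h3, h1⟩
    obtain ⟨hyU, hUs⟩ := hyU
    obtain ⟨x, hx, rfl⟩ : ∃ x ∈ e.source, e x = y := ⟨e.symm y, h.symm_mem y, h.right_inv y⟩
    let V := e.source ∩ e ⁻¹' U
    have hV : IsOpen V := e.isOpen_inter_preimage hU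
    have hxV : x ∈ V := ⟨hx, hyU⟩
    have hcomp : ∀ u : Euc k × Euc s → ℝ, (∀ w ∈ U, SmoothNear u w) →
        ContMDiffOn (𝓡 n) 𝓘(ℝ, ℝ) ∞ (fun w => u (e w)) V := fun u hu w hw =>
      (ContMDiffAt.comp (g := u) w (hu _ hw.2).contDiffAt.contMDiffAt
        (h.chart.contMDiffAt hw.1)).contMDiffWithinAt
    have key : ∀ u v w : Euc k × Euc s → ℝ, (∀ w ∈ U, SmoothNear u w) →
        (∀ w ∈ U, SmoothNear v w) → (∀ z ∈ U, SmoothNear w z) →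
        mvfderiv (𝓡 n) (fun z => mvfderiv (𝓡 n) (fun y => w (e y)) z
          (P.sharp z (mvfderiv (𝓡 n) (fun y => v (e y)) z))) x
          (P.sharp x (mvfderiv (𝓡 n) (fun y => u (e y)) x)) =
        sharpBracket (prodSharp P₁ P₂) u (sharpBracket (prodSharp P₁ P₂) v w) (e x) := by
      intro u v w hu hv hw
      have h1 : (fun z => mvfderiv (𝓡 n) (fun y => w (e y)) z
          (P.sharp z (mvfderiv (𝓡 n) (fun y => v (e y)) z))) =ᶠ[𝓝 x]
          fun z => sharpBracket (prodSharp P₁ P₂) v w (e z) := by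
        filter_upwards [hV.mem_nhds hxV] with z hz
        exact h.bracket_comp hz.1 (hv _ hz.2).differentiableAt (hw _ hz.2).differentiableAt
      rw [mvfderiv_congr h1]
      exact h.bracket_comp hx (hu _ hyU).differentiableAt
        (smoothNear_sharpBracket (hv _ hyU) (hw _ hyU)).differentiableAt
    have ha' : ∀ w ∈ U, SmoothNear a w := fun w hw => (hUs w hw).1
    have hb' : ∀ w ∈ U, SmoothNear b w := fun w hw => (hUs w hw).2.1
    have hc' : ∀ w ∈ U, SmoothNear c w := fun w hw => (hUs w hw).2.2
    have hJ := P.jacobi V _ _ _ hV (hcomp a ha') (hcomp b hb') (hcomp c hc') x hxV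
    simp only at hJ
    rw [key a b c ha' hb' hc', key b c a hb' hc' ha', key c a b hc' ha' hb'] at hJ
    exact hJ

end IsSplitChart

end Manifold

end PoissonGeom

end

/-! ### The product integrable system and its canonical family. -/

noncomputable section

open scoped Manifold ContDiff Topology
open Filter Set MeasureTheory

set_option linter.unusedSectionVars false

namespace PoissonGeom

namespace PoissonStructure.IsInvolutiveFamily

variable {k l : ℕ} {P : PoissonStructure k (Euc k)} {φ : Fin l → Euc k → ℝ}

theorem contDiff (h : P.IsInvolutiveFamily φ) (i : Fin l) : ContDiff ℝ ∞ (φ i) :=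
  contMDiff_iff_contDiff.1 (h.smooth i)

theorem linearIndependent_fderiv (h : P.IsInvolutiveFamily φ) (x : Euc k) :
    LinearIndependent ℝ fun i => fderiv ℝ (φ i) x := by
  have := h.independent x
  simp only [mvfderiv_euc] at this
  exact this

theorem fderiv_flatSharp (h : P.IsInvolutiveFamily φ) (i j : Fin l) (x : Euc k) :
    fderiv ℝ (φ j) x (P.flatSharp x (fderiv ℝ (φ i) x)) = 0 := by
  have := h.involution i j x
  rw [PoissonStructure.bracket, mvfderiv_euc, mvfderiv_euc] at this
  exact this

end PoissonStructure.IsInvolutiveFamily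

section Product

variable {k s : ℕ} (P₁ : PoissonStructure k (Euc k)) (P₂ : PoissonStructure s (Euc s))

theorem prodSharp_comp_fst (y : Euc k × Euc s) (α : Euc k →L[ℝ] ℝ) :
    prodSharp P₁ P₂ y (α.comp (ContinuousLinearMap.fst ℝ _ _)) = (P₁.flatSharp y.1 α, 0) := by
  rw [prodSharp_apply]
  refine Prod.ext ?_ ?_
  · exact congrArg (P₁.flatSharp y.1) (by ext v; simp)
  · rw [show (α.comp (ContinuousLinearMap.fst ℝ (Euc k) (Euc s))).comp
      (ContinuousLinearMap.inr ℝ (Euc k) (Euc s)) = 0 by ext v; simp, map_zero]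

theorem prodSharp_comp_snd (y : Euc k × Euc s) (α : Euc s →L[ℝ] ℝ) :
    prodSharp P₁ P₂ y (α.comp (ContinuousLinearMap.snd ℝ _ _)) = (0, P₂.flatSharp y.2 α) := by
  rw [prodSharp_apply]
  refine Prod.ext ?_ ?_
  · rw [show (α.comp (ContinuousLinearMap.snd ℝ (Euc k) (Euc s))).comp
      (ContinuousLinearMap.inl ℝ (Euc k) (Euc s)) = 0 by ext v; simp, map_zero]
  · exact congrArg (P₂.flatSharp y.2) (by ext v; simp)

variable {k s : ℕ} {V : Type*} [NormedAddCommGroup V] [NormedSpace ℝ V]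

theorem fderiv_comp_fst {u : Euc k → V} {y : Euc k × Euc s} (hu : DifferentiableAt ℝ u y.1) :
    fderiv ℝ (fun y : Euc k × Euc s => u y.1) y =
      (fderiv ℝ u y.1).comp (ContinuousLinearMap.fst ℝ _ _) :=
  (hu.hasFDerivAt.comp y hasFDerivAt_fst).fderiv

theorem fderiv_comp_snd {u : Euc s → V} {y : Euc k × Euc s} (hu : DifferentiableAt ℝ u y.2) :
    fderiv ℝ (fun y : Euc k × Euc s => u y.2) y =
      (fderiv ℝ u y.2).comp (ContinuousLinearMap.snd ℝ _ _) :=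
  (hu.hasFDerivAt.comp y hasFDerivAt_snd).fderiv

end Product

theorem mem_tangentFoliation_euc {k l : ℕ} {φ : Fin l → Euc k → ℝ} {x : Euc k}
    {v : TangentSpace (𝓡 k) x} : v ∈ tangentFoliation k φ x ↔ ∀ i, fderiv ℝ (φ i) x v = 0 := by
  rw [tangentFoliation, Submodule.mem_iInf]
  refine forall_congr' fun i => ?_
  rw [mvfderiv_euc]
  rfl

namespace IsSplitChart

variable {n : ℕ} {M : Type*} [TopologicalSpace M] [ChartedSpace (EuclideanSpace ℝ (Fin n)) M]
  {P : PoissonStructure n M} {ι : Type*} {f : ι → M → ℝ} {k l s b : ℕ}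
  {P₁ : PoissonStructure k (Euc k)} {φ : Fin l → Euc k → ℝ}
  {P₂ : PoissonStructure s (Euc s)} {ψ : Fin b → Euc s → ℝ}
  {e : OpenPartialHomeomorph M (Euc k × Euc s)}

/-- The integrable system of the product. -/
def prodSystem (φ : Fin l → Euc k → ℝ) (ψ : Fin b → Euc s → ℝ) (y : Euc k × Euc s) :
    Fin l ⊕ Fin b → ℝ := Sum.elim (fun i => φ i y.1) fun j => ψ j y.2

theorem contDiff_prodSystem (h : IsSplitChart P f P₁ φ P₂ ψ e) : ContDiff ℝ ∞ (prodSystem φ ψ) := by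
  rw [contDiff_pi]
  rintro (i | i)
  exacts [(h.family₁.contDiff i).comp contDiff_fst, (h.family₂.contDiff i).comp contDiff_snd]

theorem fderiv_φ (h : IsSplitChart P f P₁ φ P₂ ψ e) (y : Euc k × Euc s) (i : Fin l) :
    fderiv ℝ (fun y => prodSystem φ ψ y (Sum.inl i)) y =
      (fderiv ℝ (φ i) y.1).comp (ContinuousLinearMap.fst ℝ _ _) :=
  fderiv_comp_fst (u := φ i) ((h.family₁.contDiff i).differentiable (by simp) _)

theorem fderiv_ψ (h : IsSplitChart P f P₁ φ P₂ ψ e) (y : Euc k × Euc s) (i : Fin b) :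
    fderiv ℝ (fun y => prodSystem φ ψ y (Sum.inr i)) y =
      (fderiv ℝ (ψ i) y.2).comp (ContinuousLinearMap.snd ℝ _ _) :=
  fderiv_comp_snd (u := ψ i) ((h.family₂.contDiff i).differentiable (by simp) _)

theorem fderiv_prodSystem (h : IsSplitChart P f P₁ φ P₂ ψ e) (y v : Euc k × Euc s) :
    fderiv ℝ (prodSystem φ ψ) y v =
      Sum.elim (fun i => fderiv ℝ (φ i) y.1 v.1) fun j => fderiv ℝ (ψ j) y.2 v.2 := by
  ext (i | i) <;> rw [fderiv_pi_apply (h.contDiff_prodSystem.differentiable (by simp) y)]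
  · rw [h.fderiv_φ]
    rfl
  · rw [h.fderiv_ψ]
    rfl

theorem fderiv_prodSystem_eq_zero (h : IsSplitChart P f P₁ φ P₂ ψ e) {y v : Euc k × Euc s} :
    fderiv ℝ (prodSystem φ ψ) y v = 0 ↔
      v.1 ∈ tangentFoliation k φ y.1 ∧ v.2 ∈ tangentFoliation s ψ y.2 := by
  rw [h.fderiv_prodSystem, funext_iff, Sum.forall]
  exact and_congr mem_tangentFoliation_euc.symm mem_tangentFoliation_euc.symm

/-- The foliated model of a split chart. -/
def toFoliatedModel (h : IsSplitChart P f P₁ φ P₂ ψ e) :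
    FoliatedModel (Euc k × Euc s) (Fin l ⊕ Fin b) where
  toPoissonModel := h.toPoissonModel
  F := prodSystem φ ψ
  smooth_F := h.contDiff_prodSystem
  surj y w := by
    obtain ⟨v₁, hv₁⟩ := surjective_of_linearIndependent
      (h.family₁.linearIndependent_fderiv y.1) fun i => w (Sum.inl i)
    obtain ⟨v₂, hv₂⟩ := surjective_of_linearIndependent
      (h.family₂.linearIndependent_fderiv y.2) fun i => w (Sum.inr i)
    refine ⟨(v₁, v₂), ?_⟩
    rw [h.fderiv_prodSystem]
    ext (i | i)
    exacts [congrFun hv₁ i, congrFun hv₂ i]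
  invol i j y := by
    change fderiv ℝ _ y (prodSharp P₁ P₂ y (fderiv ℝ _ y)) = 0
    rcases i with i | i <;> rcases j with j | j <;>
      simp only [h.fderiv_φ, h.fderiv_ψ, prodSharp_comp_fst, prodSharp_comp_snd]
    · exact h.family₁.fderiv_flatSharp i j y.1
    · exact (fderiv ℝ (ψ j) y.2).map_zero
    · exact (fderiv ℝ (φ j) y.1).map_zero
    · exact h.family₂.fderiv_flatSharp i j y.2

theorem br_comp_fst (h : IsSplitChart P f P₁ φ P₂ ψ e) {a c : Euc k → ℝ} {y : Euc k × Euc s}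
    (ha : DifferentiableAt ℝ a y.1) (hc : DifferentiableAt ℝ c y.1) :
    h.toFoliatedModel.br (fun y => a y.1) (fun y => c y.1) y = P₁.toModel.br a c y.1 := by
  change fderiv ℝ _ y (prodSharp P₁ P₂ y (fderiv ℝ _ y)) = _
  rw [fderiv_comp_fst ha, fderiv_comp_fst hc, prodSharp_comp_fst]
  rfl

/-- The functions `φ i` are part of a canonical family. -/
theorem exists_isCanonicalFamily (h : IsSplitChart P f P₁ φ P₂ ψ e) (y : Euc k × Euc s) :
    ∃ p q : Fin l → Euc k × Euc s → ℝ, h.toFoliatedModel.IsCanonicalFamily y p q := by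
  have hφ : ∀ i, SmoothNear (φ i) y.1 := fun i => smoothNear_of_contDiff (h.family₁.contDiff i) _
  -- On the symplectic factor full rank makes the tensor injective, so independent differentials
  -- give independent Hamiltonian vectors.
  have hinj : Function.Injective (P₁.flatSharp y.1) := by
    have h1 : LinearMap.range (P₁.flatSharp y.1 : (Euc k →L[ℝ] ℝ) →ₗ[ℝ] Euc k) = ⊤ := by
      refine Submodule.eq_top_of_finrank_eq ?_
      rw [finrank_euclideanSpace_fin]
      exact h.rank y.1
    refine (LinearMap.injective_iff_surjective_of_finrank_eq_finrank
      (f := (P₁.flatSharp y.1 : (Euc k →L[ℝ] ℝ) →ₗ[ℝ] Euc k)) ?_).2 (LinearMap.range_eq_top.1 h1)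
    rw [← (LinearMap.toContinuousLinearMap (𝕜 := ℝ) (E := Euc k) (F' := ℝ)).finrank_eq]
    exact Subspace.dual_finrank_eq
  have hind : LinearIndependent ℝ fun i => P₁.toModel.ham (φ i) y.1 :=
    (h.family₁.linearIndependent_fderiv y.1).map'
      (P₁.flatSharp y.1 : (Euc k →L[ℝ] ℝ) →ₗ[ℝ] Euc k) (LinearMap.ker_eq_bot.2 hinj)
  obtain ⟨q, hq, hqφ, hqq⟩ := PoissonModel.exists_conjugate_functions (D := P₁.toModel) φ hφ
    (fun i j => Eventually.of_forall fun x => h.family₁.fderiv_flatSharp i j x) hind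
  have hfst : ContDiff ℝ ∞ (Prod.fst : Euc k × Euc s → Euc k) := contDiff_fst
  have htend : Tendsto (Prod.fst : Euc k × Euc s → Euc k) (𝓝 y) (𝓝 y.1) :=
    continuous_fst.continuousAt
  have hqs : ∀ i, SmoothNear (fun x : Euc k × Euc s => q i x.1) y := fun i =>
    SmoothNear.comp (g := q i) (f := Prod.fst) (hq i) (smoothNear_of_contDiff hfst y)
  have hbrφ : ∀ i j, ∀ᶠ x in 𝓝 y, h.toFoliatedModel.br (fun x => q i x.1)
      (fun x => prodSystem φ ψ x (Sum.inl j)) x = if i = j then 1 else 0 := by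
    intro i j
    filter_upwards [htend.eventually (hq i).eventually, htend.eventually (hqφ i j)] with x h1 h2
    rw [← h2]
    exact h.br_comp_fst h1.differentiableAt ((h.family₁.contDiff j).differentiable (by simp) _)
  -- The functions `q i` live on the first factor, so they commute with everything on the second.
  -- All brackets of `q i` with the product system are thus constant, and its flow preserves the
  -- foliation.
  have hbrψ : ∀ i j, ∀ᶠ x in 𝓝 y, h.toFoliatedModel.br (fun x => q i x.1)
      (fun x => prodSystem φ ψ x (Sum.inr j)) x = 0 := by
    intro i j
    filter_upwards [htend.eventually (hq i).eventually] with x h1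
    change fderiv ℝ _ x (prodSharp P₁ P₂ x (fderiv ℝ _ x)) = 0
    rw [fderiv_comp_fst h1.differentiableAt, h.fderiv_ψ, prodSharp_comp_fst]
    exact (fderiv ℝ (ψ j) x.2).map_zero
  refine ⟨fun i x => prodSystem φ ψ x (Sum.inl i), fun i x => q i x.1, ⟨?_, hqs, ?_, hbrφ, ?_⟩⟩
  · exact fun i => FoliatedModel.isBasic_F_apply (D := h.toFoliatedModel) (Sum.inl i)
  · intro i
    filter_upwards [(hqs i).eventually,
      eventually_all.2 fun j => eventually_eventually_nhds.2 (hbrφ i j),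
      eventually_all.2 fun j => eventually_eventually_nhds.2 (hbrψ i j)] with x h1 h2 h3
    refine FoliatedModel.preservesBasic_of_forall h1 ?_
    rintro (j | j) v -
    · have : h.toFoliatedModel.br (fun x => q i x.1)
        (fun x => h.toFoliatedModel.F x (Sum.inl j)) =ᶠ[𝓝 x] fun _ => if i = j then 1 else 0 := h2 j
      rw [this.fderiv_eq]
      simp
    · have : h.toFoliatedModel.br (fun x => q i x.1)
        (fun x => h.toFoliatedModel.F x (Sum.inr j)) =ᶠ[𝓝 x] fun _ => 0 := h3 j
      rw [this.fderiv_eq]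
      simp
  · intro i j
    filter_upwards [htend.eventually (hq i).eventually, htend.eventually (hq j).eventually,
      htend.eventually (hqq i j)] with x h1 h2 h3
    rw [← h3]
    exact h.br_comp_fst h1.differentiableAt h2.differentiableAt

end IsSplitChart

end PoissonGeom

end

/-! ### The group action in a split chart. -/

noncomputable section

open scoped Manifold ContDiff Topology
open Filter Set MeasureTheory

set_option linter.unusedSectionVars false

namespace PoissonGeom

namespace IsSplitChart

variable {n : ℕ} {M : Type*} [TopologicalSpace M] [ChartedSpace (EuclideanSpace ℝ (Fin n)) M]
  {P : PoissonStructure n M} {ι : Type*} {f : ι → M → ℝ} {k l s b : ℕ}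
  {P₁ : PoissonStructure k (Euc k)} {φ : Fin l → Euc k → ℝ}
  {P₂ : PoissonStructure s (Euc s)} {ψ : Fin b → Euc s → ℝ}
  {e : OpenPartialHomeomorph M (Euc k × Euc s)}

theorem apply_prodSharp_eq (h : IsSplitChart P f P₁ φ P₂ ψ e) {x : M} (hx : x ∈ e.source)
    (θ η : Euc k × Euc s →L[ℝ] ℝ) : η (prodSharp P₁ P₂ (e x) θ) =
      P.bivector x (θ.comp (mvfderiv (𝓡 n) e x)) (η.comp (mvfderiv (𝓡 n) e x)) := by
  rw [apply_prodSharp, h.poisson x hx]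

theorem fderiv_prodSystem_eq_zero_iff (h : IsSplitChart P f P₁ φ P₂ ψ e) {x : M}
    (hx : x ∈ e.source) (v : TangentSpace (𝓡 n) x) :
    fderiv ℝ (prodSystem φ ψ) (e x) (mvfderiv (𝓡 n) e x v) = 0 ↔ v ∈ tangentFoliation n f x := by
  rw [h.foliation x hx, h.fderiv_prodSystem_eq_zero]

/-- At a point where the rank of `P` is the dimension of the symplectic factor, the Poisson
structure of the second factor vanishes. -/
theorem flatSharp_snd_eq_zero (h : IsSplitChart P f P₁ φ P₂ ψ e) {m : M} (hm : m ∈ e.source)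
    (hl : P.rankAt m = k) (α : Euc s →L[ℝ] ℝ) : P₂.flatSharp (e m).2 α = 0 := by
  let S : (Euc k × Euc s →L[ℝ] ℝ) →ₗ[ℝ] Euc k × Euc s := (prodSharp P₁ P₂ (e m)).toLinearMap
  have hmem : ∀ θ, prodSharp P₁ P₂ (e m) θ ∈ LinearMap.range S := fun θ => ⟨θ, rfl⟩
  have hle : Module.finrank ℝ (LinearMap.range S) ≤ k := by
    have h1 : LinearMap.range S ≤ (LinearMap.range (P.sharp m)).map
        (mvfderiv (𝓡 n) e m : TangentSpace (𝓡 n) m →ₗ[ℝ] Euc k × Euc s) := by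
      rintro _ ⟨θ, rfl⟩
      exact ⟨P.sharp m (θ.comp (mvfderiv (𝓡 n) e m)), ⟨_, rfl⟩, h.mvfderiv_sharp hm θ⟩
    have : FiniteDimensional ℝ (TangentSpace (𝓡 n) m) :=
      inferInstanceAs (FiniteDimensional ℝ (EuclideanSpace ℝ (Fin n)))
    calc _ ≤ _ := Submodule.finrank_mono h1
      _ ≤ _ := Submodule.finrank_map_le _ _
      _ = k := hl
  -- The image of the product tensor has dimension at most `k` and projects onto the `k`-dimensional
  -- first factor. The projection is therefore injective on the image, which leaves no room for
  -- vectors of the second factor.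
  let T : LinearMap.range S →ₗ[ℝ] Euc k := LinearMap.fst ℝ (Euc k) (Euc s) ∘ₗ Submodule.subtype _
  have hT : Function.Surjective T := by
    have h1 : LinearMap.range (P₁.flatSharp (e m).1 : (Euc k →L[ℝ] ℝ) →ₗ[ℝ] Euc k) = ⊤ := by
      refine Submodule.eq_top_of_finrank_eq ?_
      rw [finrank_euclideanSpace_fin]
      exact h.rank (e m).1
    intro v
    obtain ⟨α₁, hα₁⟩ := LinearMap.range_eq_top.1 h1 v
    refine ⟨⟨_, hmem (α₁.comp (ContinuousLinearMap.fst ℝ _ _))⟩, ?_⟩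
    change (prodSharp P₁ P₂ (e m) (α₁.comp (ContinuousLinearMap.fst ℝ _ _))).1 = v
    rw [prodSharp_comp_fst]
    exact hα₁
  have hTi : Function.Injective T := by
    refine (LinearMap.injective_iff_surjective_of_finrank_eq_finrank ?_).2 hT
    have := LinearMap.finrank_le_finrank_of_surjective hT
    rw [finrank_euclideanSpace_fin] at this ⊢
    exact le_antisymm hle this
  have h2 : (⟨_, hmem (α.comp (ContinuousLinearMap.snd ℝ _ _))⟩ : LinearMap.range S) = 0 := by
    refine hTi ?_
    rw [map_zero]
    change (prodSharp P₁ P₂ (e m) (α.comp (ContinuousLinearMap.snd ℝ _ _))).1 = 0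
    rw [prodSharp_comp_snd]
  have h3 : prodSharp P₁ P₂ (e m) (α.comp (ContinuousLinearMap.snd ℝ _ _)) = 0 :=
    congrArg Subtype.val h2
  rw [prodSharp_comp_snd] at h3
  exact congrArg Prod.snd h3

variable [IsManifold (𝓡 n) ∞ M] {d : ℕ} {G : Type*} [Group G] [TopologicalSpace G]
  [ChartedSpace (EuclideanSpace ℝ (Fin d)) G] [MulAction G M] [ContMDiffSMul (𝓡 d) (𝓡 n) ∞ G M]

theorem _root_.PoissonGeom.IsSmoothChart.mvfderiv_comp_map {W : Type*} [NormedAddCommGroup W]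
    [NormedSpace ℝ W] {e : OpenPartialHomeomorph M W} (he : IsSmoothChart n e) {F : M → M} {x : M}
    (hx : F x ∈ e.source) (hF : MDifferentiableAt (𝓡 n) (𝓡 n) F x) (v : TangentSpace (𝓡 n) x) :
    mvfderiv (𝓡 n) (e ∘ F) x v = mvfderiv (𝓡 n) e (F x) (mfderiv (𝓡 n) (𝓡 n) F x v) := by
  change mfderiv (𝓡 n) 𝓘(ℝ, W) (e ∘ F) x v = _
  rw [mfderiv_comp x (he.mdifferentiableAt hx) hF]
  rfl

theorem contMDiff_const_smul' (d : ℕ) [ChartedSpace (EuclideanSpace ℝ (Fin d)) G]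
    [ContMDiffSMul (𝓡 d) (𝓡 n) ∞ G M] (g : G) :
    ContMDiff (𝓡 n) (𝓡 n) ∞ fun x : M => g • x :=
  (contMDiff_smul (I := 𝓡 d) (I' := 𝓡 n) (n := ∞) (G := G) (M := M)).comp
    (contMDiff_const.prodMk contMDiff_id)

/-- The action in the chart `e`. -/
def chartAct (e : OpenPartialHomeomorph M (Euc k × Euc s)) (g : G) (y : Euc k × Euc s) :
    Euc k × Euc s := e (g • e.symm y)

variable (d) in
theorem chartAct_contMDiffAt (h : IsSplitChart P f P₁ φ P₂ ψ e) {g : G} {y : Euc k × Euc s}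
    (hy : g • e.symm y ∈ e.source) :
    ContMDiffAt ((𝓡 d).prod 𝓘(ℝ, Euc k × Euc s)) 𝓘(ℝ, Euc k × Euc s) ∞
      (Function.uncurry (chartAct (G := G) e)) (g, y) := by
  have h1 : ContMDiffAt ((𝓡 d).prod 𝓘(ℝ, Euc k × Euc s)) ((𝓡 d).prod (𝓡 n)) ∞
      (fun p : G × (Euc k × Euc s) => (p.1, e.symm p.2)) (g, y) :=
    contMDiffAt_fst.prodMk (ContMDiffAt.comp (g := e.symm) (g, y)
      (h.chart.contMDiffAt_symm (h.mem_target y)) contMDiffAt_snd)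
  have h2 : ContMDiffAt ((𝓡 d).prod 𝓘(ℝ, Euc k × Euc s)) (𝓡 n) ∞
      (fun p : G × (Euc k × Euc s) => p.1 • e.symm p.2) (g, y) :=
    ContMDiffAt.comp (g := fun p : G × M => p.1 • p.2) (g, y)
      (contMDiff_smul (I := 𝓡 d) (I' := 𝓡 n) (n := ∞) (G := G) (M := M)).contMDiffAt h1
  exact ContMDiffAt.comp (g := e) (g, y) (h.chart.contMDiffAt hy) h2

theorem chartAct_apply {g : G} {x : M} (hx : x ∈ e.source) : chartAct e g (e x) = e (g • x) := by
  rw [chartAct, e.left_inv hx]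

theorem fderiv_chartAct (d : ℕ) [ChartedSpace (EuclideanSpace ℝ (Fin d)) G]
    [ContMDiffSMul (𝓡 d) (𝓡 n) ∞ G M] (h : IsSplitChart P f P₁ φ P₂ ψ e) {g : G} {x : M} (hx : x ∈ e.source)
    (hgx : g • x ∈ e.source) (v : TangentSpace (𝓡 n) x) :
    fderiv ℝ (chartAct e g) (e x) (mvfderiv (𝓡 n) e x v) =
      mvfderiv (𝓡 n) e (g • x) (mfderiv (𝓡 n) (𝓡 n) (fun x : M => g • x) x v) := by
  have hsm := contMDiff_const_smul' (n := n) (M := M) d g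
  have hd : DifferentiableAt ℝ (chartAct e g) (e x) := by
    have h1 := h.chartAct_contMDiffAt d (g := g) (y := e x) (by rwa [e.left_inv hx])
    have h2 : ContMDiffAt 𝓘(ℝ, Euc k × Euc s) 𝓘(ℝ, Euc k × Euc s) ∞ (chartAct e g) (e x) :=
      ContMDiffAt.comp (g := Function.uncurry (chartAct (G := G) e)) (f := fun y => (g, y)) (e x) h1
        (contMDiffAt_const.prodMk contMDiffAt_id)
    exact (contMDiffAt_iff_contDiffAt.1 h2).differentiableAt (by simp)
  have h1 : (fun y => chartAct e g (e y)) =ᶠ[𝓝 x] e ∘ fun x : M => g • x := by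
    filter_upwards [e.open_source.mem_nhds hx] with y hy using chartAct_apply hy
  have h2 := mvfderiv_congr h1 v
  rw [h.chart.mvfderiv_comp hx hd] at h2
  have h3 : mvfderiv (𝓡 n) (e ∘ fun x : M => g • x) x v =
      mvfderiv (𝓡 n) e (g • x) (mfderiv (𝓡 n) (𝓡 n) (fun x : M => g • x) x v) :=
    h.chart.mvfderiv_comp_map hgx (hsm.contMDiffAt.mdifferentiableAt (by simp)) v
  rw [← h3]
  exact h2

variable [LieGroup (𝓡 d) ∞ G] [CompactSpace G]

/-- The action in a split chart, near a point of a symplectic leaf that consists of fixed points. -/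
def localAction (h : IsSplitChart P f P₁ φ P₂ ψ e) (hP : ∀ g : G, P.IsPoissonMap fun x => g • x)
    (hG : ∀ g : G, PreservesFoliation n f fun x => g • x) {m : M} (hm : m ∈ e.source)
    (hl : P.rankAt m = k) (hfix : ∀ x ∈ e.source, (e x).2 = (e m).2 → ∀ g : G, g • x = x) :
    LocalAction h.toFoliatedModel d G (e m) where
  U := {y | ∀ g : G, g • e.symm y ∈ e.source}
  isOpen := by
    rw [isOpen_iff_mem_nhds]
    intro y hy
    have hc : Continuous fun p : (Euc k × Euc s) × G => p.2 • e.symm p.1 := by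
      have h1 := (contMDiff_smul (I := 𝓡 d) (I' := 𝓡 n) (n := ∞) (G := G) (M := M)).continuous
      have h2 : Continuous e.symm := by
        have := e.continuousOn_symm
        rwa [h.target, continuousOn_univ] at this
      exact h1.comp (continuous_snd.prodMk (h2.comp continuous_fst))
    have := isCompact_univ.eventually_forall_of_forall_eventually (x₀ := y) (K := (univ : Set G))
      (P := fun y g => g • e.symm y ∈ e.source) fun g _ =>
        hc.continuousAt.eventually (e.open_source.mem_nhds (hy g))
    filter_upwards [this] with z hz g using hz g (mem_univ g)
  mem g := by
    rw [e.left_inv hm, hfix m hm rfl]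
    exact hm
  act := chartAct e
  smooth := by
    rintro ⟨g, y⟩ ⟨-, hy⟩
    exact (h.chartAct_contMDiffAt d (hy g)).contMDiffWithinAt
  maps g y hy g' := by
    rw [chartAct, e.left_inv (hy g), ← mul_smul]
    exact hy _
  one y hy := by rw [chartAct, one_smul, h.right_inv]
  mul g g' y hy := by
    rw [chartAct, chartAct, chartAct, e.left_inv (hy g'), mul_smul]
  poisson g y hy α := by
    obtain ⟨x, hx, rfl⟩ : ∃ x ∈ e.source, e x = y := ⟨e.symm y, h.symm_mem y, h.right_inv y⟩
    have hgx : g • x ∈ e.source := by simpa [e.left_inv hx] using hy g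
    change fderiv ℝ (chartAct e g) (e x) (prodSharp P₁ P₂ (e x) _) = prodSharp P₁ P₂ _ α
    have key : ∀ θ : Euc k × Euc s →L[ℝ] ℝ,
        (θ.comp (fderiv ℝ (chartAct e g) (e x))).comp (mvfderiv (𝓡 n) e x) =
          (θ.comp (mvfderiv (𝓡 n) e (g • x))).comp
            (mfderiv (𝓡 n) (𝓡 n) (fun x : M => g • x) x) := fun θ => by
      ext v
      exact congrArg θ (h.fderiv_chartAct d hx hgx v)
    refine SeparatingDual.eq_iff_forall_dual_eq (R := ℝ) |>.2 fun η => ?_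
    rw [chartAct_apply hx, h.apply_prodSharp_eq hgx,
      ← ContinuousLinearMap.comp_apply η, h.apply_prodSharp_eq hx, key, key]
    exact (hP g x _ _).symm
  foliation g y hy w hw := by
    obtain ⟨x, hx, rfl⟩ : ∃ x ∈ e.source, e x = y := ⟨e.symm y, h.symm_mem y, h.right_inv y⟩
    have hgx : g • x ∈ e.source := by simpa [e.left_inv hx] using hy g
    obtain ⟨v, rfl⟩ := h.chart.surjective_mvfderiv hx w
    rw [chartAct_apply hx, h.fderiv_chartAct d hx hgx]
    refine (h.fderiv_prodSystem_eq_zero_iff hgx _).2 ?_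
    have hv := (h.fderiv_prodSystem_eq_zero_iff hx v).1 hw
    exact (hG g x).le (Submodule.mem_map_of_mem hv)
  base g := by rw [chartAct_apply hm, hfix m hm rfl]
  fixed g α := by
    change fderiv ℝ (chartAct e g) (e m) (prodSharp P₁ P₂ (e m) α) = prodSharp P₁ P₂ (e m) α
    -- The Hamiltonian vectors at the base point are tangent to the slice through it. This slice is
    -- a piece of the leaf and is fixed pointwise, so the derivative of the action is the identity
    -- on them.
    rw [prodSharp_apply, h.flatSharp_snd_eq_zero hm hl]
    generalize P₁.flatSharp (e m).1 (α.comp (ContinuousLinearMap.inl ℝ _ _)) = v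
    let j : Euc k → Euc k × Euc s := fun a => (a, (e m).2)
    have hj : HasFDerivAt j (ContinuousLinearMap.inl ℝ (Euc k) (Euc s)) (e m).1 :=
      hasFDerivAt_prodMk_left _ _
    have hgm : g • m ∈ e.source := by
      rw [hfix m hm rfl]
      exact hm
    have hd : DifferentiableAt ℝ (chartAct e g) (j (e m).1) := by
      have h1 := h.chartAct_contMDiffAt d (g := g) (y := e m) (by rwa [e.left_inv hm])
      have h2 : ContMDiffAt 𝓘(ℝ, Euc k × Euc s) 𝓘(ℝ, Euc k × Euc s) ∞ (chartAct e g) (e m) :=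
        ContMDiffAt.comp (g := Function.uncurry (chartAct (G := G) e)) (f := fun y => (g, y)) (e m)
          h1 (contMDiffAt_const.prodMk contMDiffAt_id)
      exact (contMDiffAt_iff_contDiffAt.1 h2).differentiableAt (by simp)
    have hfixj : chartAct e g ∘ j = j := by
      ext1 a
      have h1 : e (e.symm (j a)) = j a := h.right_inv _
      change e (g • e.symm (j a)) = j a
      rw [hfix _ (h.symm_mem _) (by rw [h1]), h1]
    have h2 := (hd.hasFDerivAt.comp (e m).1 hj).fderiv
    rw [hfixj, hj.fderiv] at h2
    exact (congrArg (fun T : Euc k →L[ℝ] Euc k × Euc s => T v) h2).symm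

end IsSplitChart

end PoissonGeom

end

/-! ### The normal form pulled back to the manifold. -/

noncomputable section

open scoped Manifold ContDiff Topology
open Filter Set MeasureTheory

set_option linter.unusedSectionVars false

namespace PoissonGeom

namespace IsSplitChart

variable {n : ℕ} {M : Type*} [TopologicalSpace M] [ChartedSpace (EuclideanSpace ℝ (Fin n)) M]
  {P : PoissonStructure n M} {ι : Type*} {f : ι → M → ℝ} {l s b : ℕ}
  {P₁ : PoissonStructure (2 * l) (Euc (2 * l))} {φ : Fin l → Euc (2 * l) → ℝ}
  {P₂ : PoissonStructure s (Euc s)} {ψ : Fin b → Euc s → ℝ}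
  {e : OpenPartialHomeomorph M (Euc (2 * l) × Euc s)}
  {p q : Fin l → Euc (2 * l) × Euc s → ℝ} {z : Euc (2 * l) × Euc s → Fin s → ℝ}
  {e' : OpenPartialHomeomorph (Euc (2 * l) × Euc s) (CJLSpace l s)} {m : Euc (2 * l) × Euc s}

theorem mvfderiv_trans (h : IsSplitChart P f P₁ φ P₂ ψ e)
    (he' : ∀ y, e' y = FoliatedModel.coordMap p q z m y)
    (hN : ∀ y ∈ e'.source, h.toFoliatedModel.IsNormalAt p q z b y) {x : M}
    (hx : x ∈ (e.trans e').source) : mvfderiv (𝓡 n) (e.trans e') x =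
      (fderiv ℝ (FoliatedModel.coordMap p q z m) (e x)).comp (mvfderiv (𝓡 n) e x) := by
  rw [e.trans_source] at hx
  have h1 := hN _ hx.2
  have h2 : (e.trans e' : M → CJLSpace l s) = fun x => FoliatedModel.coordMap p q z m (e x) :=
    funext fun x => he' (e x)
  rw [h2]
  exact h.chart.mvfderiv_comp hx.1
    (FoliatedModel.smoothNear_coordMap h1.smooth_p h1.smooth_q h1.smooth_z m).differentiableAt

theorem bivector_trans (h : IsSplitChart P f P₁ φ P₂ ψ e)
    (he' : ∀ y, e' y = FoliatedModel.coordMap p q z m y)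
    (hN : ∀ y ∈ e'.source, h.toFoliatedModel.IsNormalAt p q z b y) {x : M}
    (hx : x ∈ (e.trans e').source) (θ η : CJLSpace l s →L[ℝ] ℝ) :
    P.bivector x (θ.comp (mvfderiv (𝓡 n) (e.trans e') x))
        (η.comp (mvfderiv (𝓡 n) (e.trans e') x)) =
      (∑ i, wedge (dQ s i) (dP s i) θ η) + ∑ i, ∑ j,
        (h.toFoliatedModel.br (fun y => z y i) (fun y => z y j) (e x) / 2) *
          wedge (dZ l i) (dZ l j) θ η := by
  have hx' := hx
  rw [e.trans_source] at hx'
  rw [h.mvfderiv_trans he' hN hx, ← (hN _ hx'.2).bivector_eq m θ η,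
    ← ContinuousLinearMap.comp_assoc, ← ContinuousLinearMap.comp_assoc,
    ← h.apply_prodSharp_eq hx'.1]
  rfl

theorem generatesFoliationOn_trans (h : IsSplitChart P f P₁ φ P₂ ψ e)
    (he' : ∀ y, e' y = FoliatedModel.coordMap p q z m y)
    (hN : ∀ y ∈ e'.source, h.toFoliatedModel.IsNormalAt p q z b y)
    (hs : ContDiffOn ℝ ∞ e' e'.source) (hs' : ContDiffOn ℝ ∞ e'.symm e'.target) (hbs : b ≤ s) :
    GeneratesFoliationOn n f
      (Sum.elim (fun (i : Fin l) (x : M) => (e.trans e' x).1 i)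
        (fun (j : {j : Fin s // (j : ℕ) < b}) (x : M) => (e.trans e' x).2.2 j))
      (e.trans e').source := by
  have hchart := h.chart.trans hs hs'
  let κ := Fin l ⊕ {j : Fin s // (j : ℕ) < b}
  -- The generating coordinates are linear functionals of the chart, so their differentials are
  -- obtained from the chart's by composition.
  let c : κ → CJLSpace l s →L[ℝ] ℝ := Sum.elim
    (fun i => (ContinuousLinearMap.proj i).comp (ContinuousLinearMap.fst ℝ (Fin l → ℝ) _))
    (fun j => (ContinuousLinearMap.proj (j : Fin s)).comp
      ((ContinuousLinearMap.snd ℝ (Fin l → ℝ) (Fin s → ℝ)).comp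
        (ContinuousLinearMap.snd ℝ (Fin l → ℝ) _)))
  have hc : (Sum.elim (fun (i : Fin l) (x : M) => (e.trans e' x).1 i)
      (fun (j : {j : Fin s // (j : ℕ) < b}) (x : M) => (e.trans e' x).2.2 j)) =
      fun (i : κ) (x : M) => c i (e.trans e' x) := by
    funext i x
    rcases i with i | i <;> rfl
  have hdc : ∀ x ∈ (e.trans e').source, ∀ i : κ, mvfderiv (𝓡 n) (fun x => c i (e.trans e' x)) x =
      (c i).comp (mvfderiv (𝓡 n) (e.trans e') x) := fun x hx i => by
    rw [hchart.mvfderiv_comp (f := c i) hx (c i).differentiableAt, (c i).fderiv]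
  rw [hc]
  constructor
  · exact fun i => (c i).contDiff.contMDiff.comp_contMDiffOn hchart.smooth
  · intro x hx
    simp only [hdc x hx]
    refine linearIndependent_of_surjective (V := EuclideanSpace ℝ (Fin n)) fun w => ?_
    obtain ⟨v, hv⟩ := hchart.surjective_mvfderiv hx (fun i => w (Sum.inl i), 0,
      fun j => if hj : (j : ℕ) < b then w (Sum.inr ⟨j, hj⟩) else 0)
    refine ⟨v, funext fun i => ?_⟩
    refine (congrArg (c i) hv).trans ?_
    rcases i with i | i
    · rfl
    · exact dif_pos i.2
  · intro x hx
    have hx' := hx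
    rw [e.trans_source] at hx'
    have hn := hN _ hx'.2
    ext v
    rw [← h.fderiv_prodSystem_eq_zero_iff hx'.1, tangentFoliation, Submodule.mem_iInf]
    have hsurj : Function.Surjective (fderiv ℝ (FoliatedModel.coordMap p q z m) (e x)) := by
      intro w
      obtain ⟨v, hv⟩ := hchart.surjective_mvfderiv hx w
      rw [h.mvfderiv_trans he' hN hx] at hv
      exact ⟨_, hv⟩
    refine Iff.trans ?_ (hn.fderiv_F_eq_zero_iff m hsurj (by simp) hbs
      (mvfderiv (𝓡 n) e x v)).symm
    have hv : ∀ i : κ, v ∈ LinearMap.ker (mvfderiv (𝓡 n) (fun x => c i (e.trans e' x)) x :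
        TangentSpace (𝓡 n) x →ₗ[ℝ] ℝ) ↔
        c i (fderiv ℝ (FoliatedModel.coordMap p q z m) (e x) (mvfderiv (𝓡 n) e x v)) = 0 := by
      intro i
      rw [hdc x hx, h.mvfderiv_trans he' hN hx]
      rfl
    rw [forall_congr' hv, Sum.forall,
      FoliatedModel.fderiv_coordMap hn.smooth_p hn.smooth_q hn.smooth_z]
    exact and_congr Iff.rfl ⟨fun H j hj => H ⟨j, hj⟩, fun H j => H j j.2⟩

end IsSplitChart

end PoissonGeom

end

/-! ### Assembly of the normal form theorem. -/

theorem mainTheorem6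
    {n r l s d : ℕ}
    {M : Type*} [TopologicalSpace M] [ChartedSpace (EuclideanSpace ℝ (Fin n)) M]
    [IsManifold (𝓡 n) ∞ M] [T2Space M] [SecondCountableTopology M]
    {G : Type*} [Group G] [TopologicalSpace G] [ChartedSpace (EuclideanSpace ℝ (Fin d)) G]
    [LieGroup (𝓡 d) ∞ G] [CompactSpace G] [T2Space G]
    [MulAction G M] [ContMDiffSMul (𝓡 d) (𝓡 n) ∞ G M]
    (P : PoissonGeom.PoissonStructure n M)
    (hP : ∀ g : G, P.IsPoissonMap fun x => g • x)
    (f : Fin (n - r) → M → ℝ) (hf : P.IsIntegrableSystem r f)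
    (hG : ∀ g : G, PoissonGeom.PreservesFoliation n f fun x => g • x)
    (m : M) (hl : P.rankAt m = 2 * l) (hs : n = 2 * l + s)
    (hfix : ∀ x ∈ P.symplecticLeaf m, ∀ g : G, g • x = x)
    (hsplit : P.IsSplitAt r l s f m) :
    ∃ (e : OpenPartialHomeomorph M (PoissonGeom.CJLSpace l s))
      (g : Fin s → Fin s → (Fin s → ℝ) → ℝ) (A : G →* GL (Fin s) ℝ),
      -- local coordinates `(p, q, z)` centered at `m`
      PoissonGeom.IsSmoothChart n e ∧ m ∈ e.source ∧ e m = 0 ∧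
      -- normal form of the Poisson structure, with smooth coefficients depending on `z` only
      (∀ i j, ContDiffOn ℝ ∞ (g i j) ((fun x => (e x).2.2) '' e.source)) ∧
      (∀ x ∈ e.source, ∀ θ η : PoissonGeom.CJLSpace l s →L[ℝ] ℝ,
        P.bivector x (θ.comp (mvfderiv (𝓡 n) e x)) (η.comp (mvfderiv (𝓡 n) e x)) =
          (∑ i, PoissonGeom.wedge (PoissonGeom.dQ s i) (PoissonGeom.dP s i) θ η) +
          ∑ i, ∑ j, g i j (e x).2.2 *
            PoissonGeom.wedge (PoissonGeom.dZ l i) (PoissonGeom.dZ l j) θ η) ∧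
      -- the action of `G` on the neighbourhood: trivial on `p` and `q`, linear on `z`
      (∀ a : G, ∀ x ∈ e.source, a • x ∈ e.source ∧
        e (a • x) = ((e x).1, (e x).2.1,
          Matrix.mulVec (A a : Matrix (Fin s) (Fin s) ℝ) (e x).2.2)) ∧
      -- `p₁, …, p_l, z₁, …, z_{n-r-l}` generate the integrable system
      PoissonGeom.GeneratesFoliationOn n f
        (Sum.elim (fun (i : Fin l) (x : M) => (e x).1 i)
          (fun (j : {j : Fin s // (j : ℕ) < n - r - l}) (x : M) => (e x).2.2 j))
        e.source := by
  open PoissonGeom in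
  obtain ⟨P₁, φ, P₂, ψ, e, hrank, hφ, hψ, he, hm, ht, hleaf, hpois, hfol⟩ := hsplit
  have h : IsSplitChart P f P₁ φ P₂ ψ e := ⟨hrank, hφ, hψ, he, ht, hpois, hfol⟩
  let A : LocalAction h.toFoliatedModel d G (e m) :=
    h.localAction hP hG hm hl fun x hx hxm => hfix x (hleaf x hx hxm)
  have : IsTopologicalGroup G := topologicalGroup_of_lieGroup (𝓡 d) ∞
  let _ : MeasurableSpace G := borel G
  have : BorelSpace G := ⟨rfl⟩
  -- The Haar measure is normalised on the compact set `⊤`, that is on all of `G`, so it is a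
  -- probability measure.
  let μ : MeasureTheory.Measure G := MeasureTheory.Measure.haarMeasure ⊤
  have : MeasureTheory.IsProbabilityMeasure μ := ⟨MeasureTheory.Measure.haarMeasure_self⟩
  have hdim : Module.finrank ℝ (Euc (2 * l) × Euc s) = 2 * l + s := by simp
  -- The rank at `m` is at most the maximal rank. Hence `l ≤ r`, so there are at least `n - r - l`
  -- transverse coordinates.
  have hlr : 2 * l ≤ 2 * r := hl ▸ hf.hasRank.2 ⟨m, rfl⟩
  obtain ⟨p₀, q₀, hcan₀⟩ := h.exists_isCanonicalFamily (e m)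
  obtain ⟨p, q, hcan, hp, hq⟩ := A.exists_invariant_family μ hcan₀
  obtain ⟨z₀, hz₀⟩ := hcan.exists_isTransverse (s := s) (b := n - r - l) (by simp) (by simp)
  obtain ⟨z, ρ, hz, hρ, hzρ⟩ := A.exists_linear_isTransverse μ hcan hp hq (by simp) hz₀
  obtain ⟨e', g, he', hm', hU, hs, hs', hN, hg, hgz, hact⟩ :=
    A.exists_normal_chart hcan hz hp hq hdim ρ hρ hzρ
  refine ⟨e.trans e', g, ρ.toHomUnits, h.chart.trans hs hs', ?_, ?_, ?_, ?_, ?_,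
    h.generatesFoliationOn_trans he' hN hs hs' (by omega)⟩
  · rw [e.trans_source]
    exact ⟨hm, hm'⟩
  · change e' (e m) = 0
    rw [he', FoliatedModel.coordMap, hz.base]
    simp only [sub_self]
    rfl
  · intro i j
    refine (hg i j).mono ?_
    rintro _ ⟨x, hx, rfl⟩
    rw [e.trans_source] at hx
    exact ⟨e x, hx.2, rfl⟩
  · intro x hx θ η
    rw [h.bivector_trans he' hN hx]
    rw [e.trans_source] at hx
    have h1 : (e.trans e' x).2.2 = z (e x) := congrArg (fun w => w.2.2) (he' (e x))
    simp only [h1, hgz (e x) hx.2]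
  · intro a x hx
    rw [e.trans_source] at hx
    obtain ⟨h1, h2⟩ := hact a (e x) hx.2
    have h3 : a • x ∈ e.source := by
      have := hU hx.2 a
      rwa [e.left_inv hx.1] at this
    have h4 : A.act a (e x) = e (a • x) := IsSplitChart.chartAct_apply hx.1
    rw [h4] at h1 h2
    refine ⟨?_, h2⟩
    rw [e.trans_source]
    exact ⟨h3, h1⟩
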